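/- **Setting.** Let $S^1=\mathbb R/2\pi\mathbb Z$, $E=\mathbb C^n$, $k\ge 1$ an integer, $2<p<\infty$, $0<\delta<1$, $b\ge 0$. Let $C_-=(-\infty,-b)\times S^1$, $C_+=(b,\infty)\times S^1$ with coordinates $(t_\pm,s_\pm)$. For $C=C_\pm$ let $L^p_{k,\delta}(C,E)$ be the Banach space of all $u:C\to E$ with $e^{\delta|t|}u\in L^p_k(C,E)$ (Sobolev space of functions whose weak derivatives of order $\le k$ lie in $L^p$), with norm $\|u\|_{k,p,\delta}=\|e^{\delta|t|}u\|_{k,p}$, and let $L^p_{k,\delta}(S,E)=L^p_{k,\delta}(C_-,E)\times L^p_{k,\delta}(C_+,E)$. Fix a smooth $\alpha:\mathbb R\to[0,1]$ with $\alpha=1$ on $(-\infty,-1)$, $\alpha=0$ on $(1,\infty)$ and $\alpha'\le 0$. For $R>1$ put $l=L(R)=R^{1/2}\ln^2R$, $d=3l$, $\beta_-(t)=\alpha((t-d)/l)$, $\beta_+(t)=1-\alpha((t+d)/l)$ and $$T_\beta=\begin{pmatrix}\beta_-&-\beta_+\\ \beta_+&\beta_-\end{pmatrix},\qquad \omega=-\begin{pmatrix}\beta_-'&-\beta_+'\\0&0\end{pmatrix}T_\beta^{-1}.$$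 For $a=(R,\theta)$ with $\theta\in S^1$ let $\tau_{\pm a}\xi(t,s)=\xi(t\pm R,s\pm\theta)$. In the coordinates $t=t_\pm\mp R$, $s=s_\pm\mp\theta$ let $S^a_-=\mathbb R\times S^1$ and $S^a_+=(-(R-b),R-b)\times S^1$. With $u_\pm$ extended by zero outside $C_\pm$, the total gluing $T^a(u_-,u_+)$ is the pair of functions on $(S^a_-,S^a_+)$ given by $T_\beta\,(\tau_{-a}u_-,\tau_au_+)^{\mathsf T}$, and its inverse is $(T^a)^{-1}(\eta_-,\eta_+)=\mathrm{diag}(\tau_a,\tau_{-a})\,T_\beta^{-1}(\eta_-,\eta_+)^{\mathsf T}$, a pair of functions on $(C_-,C_+)$. Put $$\Psi_L^a=(T^a)^{-1}\circ(\partial_t+\omega)\circ T^a\quad(R<\infty),\qquad \Psi_L^\infty=\partial_t ,$$ with $\partial_t$ the weak derivative. Let $r_0>0$ and use the gluing profile $R(r)=e^{1/r}-e^{1/r_0}$. Let $0<r_1\le r_0$ be small enough that $b+4L(R(r))<R(r)$ for all $0<r<r_1$, so that the splicing regions lie inside the glued cylinder. Let $D_{r_1}=\{z\in\mathbb C:|z|<r_1\}$.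 **Theorem.** The formula $$\Psi_L(u,re^{i\theta})=\Psi_L^{(R(r),\theta)}(u)\quad(0<r<r_1,\ \theta\in S^1),\qquad \Psi_L(u,0)=\Psi_L^\infty(u)=\partial_tu$$ defines a map $\Psi_L:L^p_{k,\delta}(S,E)\times D_{r_1}\to L^p_{k-1,\delta}(S,E)$, and this map is of class $C^1$ (continuously Fréchet differentiable between real Banach spaces), including at the points $(u,0)$, where $R=\infty$. -/

import Mathlib

open MeasureTheory Set Filter
open scoped ENNReal ContDiff Topology

noncomputable section

namespace FilledSection

/-! ### Cylinders, coordinate derivatives, test functions -/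

instance factTwoPiPos : Fact (0 < 2 * Real.pi) := ⟨Real.two_pi_pos⟩

/-- The circle `S¹ = ℝ / 2πℤ`. -/
abbrev S1 : Type := AddCircle (2 * Real.pi)

/-- The cylinder `ℝ × S¹` with coordinates `(t, s)`. -/
abbrev Cyl : Type := ℝ × S1

/-- The target space `E = ℂⁿ`. -/
abbrev E (n : ℕ) : Type := EuclideanSpace ℂ (Fin n)

/-- The coordinate derivative `∂_t φ` of a function on the cylinder. -/
def dt (φ : Cyl → ℝ) (x : Cyl) : ℝ := deriv (fun t : ℝ => φ (t, x.2)) x.1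

/-- The coordinate derivative `∂_s φ` of a function on the cylinder. -/
def ds (φ : Cyl → ℝ) (x : Cyl) : ℝ := deriv (fun h : ℝ => φ (x.1, x.2 + (h : S1))) 0

/-- The universal covering `ℝ × ℝ → ℝ × S¹`. -/
def cover (y : ℝ × ℝ) : Cyl := (y.1, (y.2 : S1))

/-- Test functions on an open set `Ω` of the cylinder: smooth (as functions on the universal
covering), with compact support contained in `Ω`. -/
structure IsTest (Ω : Set Cyl) (φ : Cyl → ℝ) : Prop where
  smooth : ContDiff ℝ ∞ (fun y => φ (cover y))
  compact : HasCompactSupport φ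
  subset : tsupport φ ⊆ Ω

/-- `g` is the weak derivative of `f` on the open set `Ω`, for the coordinate derivative `D`
(which will be `dt` or `ds`). -/
structure HasWeakDeriv {n : ℕ} (D : (Cyl → ℝ) → Cyl → ℝ) (Ω : Set Cyl) (f g : Cyl → E n) :
    Prop where
  left : LocallyIntegrableOn f Ω
  right : LocallyIntegrableOn g Ω
  byParts : ∀ φ : Cyl → ℝ, IsTest Ω φ →
    ∫ x in Ω, D φ x • f x = - ∫ x in Ω, φ x • g x

/-! ### Basic facts on test functions, needed for the Sobolev spaces to be linear -/

theorem isOpenQuotientMap_cover : IsOpenQuotientMap cover :=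
  (IsOpenQuotientMap.id (X := ℝ)).prodMap
    (QuotientAddGroup.isOpenQuotientMap_mk (G := ℝ))

theorem continuous_of_cover {φ : Cyl → ℝ} (h : Continuous (fun y => φ (cover y))) :
    Continuous φ :=
  isOpenQuotientMap_cover.continuous_comp_iff.1 h

theorem dt_cover {φ : Cyl → ℝ} (h : ContDiff ℝ ∞ (fun y => φ (cover y))) (y : ℝ × ℝ) :
    dt φ (cover y) = fderiv ℝ (fun y => φ (cover y)) y (1, 0) := by
  have h1 : HasFDerivAt (fun y => φ (cover y)) (fderiv ℝ (fun y => φ (cover y)) y) (y.1, y.2) :=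
    (h.differentiable (by simp) y).hasFDerivAt
  have h2 : HasDerivAt (fun t : ℝ => (t, y.2)) ((1 : ℝ), (0 : ℝ)) y.1 :=
    (hasDerivAt_id y.1).prodMk (hasDerivAt_const y.1 y.2)
  exact (h1.comp_hasDerivAt y.1 h2).deriv

theorem ds_cover {φ : Cyl → ℝ} (h : ContDiff ℝ ∞ (fun y => φ (cover y))) (y : ℝ × ℝ) :
    ds φ (cover y) = fderiv ℝ (fun y => φ (cover y)) y (0, 1) := by
  have h1 : HasFDerivAt (fun y => φ (cover y)) (fderiv ℝ (fun y => φ (cover y)) y)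
      (y.1, y.2 + 0) := by
    simpa using (h.differentiable (by simp) y).hasFDerivAt
  have h2 : HasDerivAt (fun t : ℝ => (y.1, y.2 + t)) ((0 : ℝ), (1 : ℝ)) 0 :=
    (hasDerivAt_const _ y.1).prodMk ((hasDerivAt_id (0 : ℝ)).const_add y.2)
  have h3 := (h1.comp_hasDerivAt (0 : ℝ) h2).deriv
  rw [← h3]
  rfl

theorem IsTest.continuous {Ω : Set Cyl} {φ : Cyl → ℝ} (h : IsTest Ω φ) : Continuous φ :=
  continuous_of_cover h.smooth.continuous

theorem IsTest.continuous_dt {Ω : Set Cyl} {φ : Cyl → ℝ} (h : IsTest Ω φ) :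
    Continuous (dt φ) := by
  refine continuous_of_cover ?_
  simp_rw [dt_cover h.smooth]
  exact (h.smooth.continuous_fderiv (by simp)).clm_apply continuous_const

theorem IsTest.continuous_ds {Ω : Set Cyl} {φ : Cyl → ℝ} (h : IsTest Ω φ) :
    Continuous (ds φ) := by
  refine continuous_of_cover ?_
  simp_rw [ds_cover h.smooth]
  exact (h.smooth.continuous_fderiv (by simp)).clm_apply continuous_const

theorem dt_eq_zero {φ : Cyl → ℝ} {x : Cyl} (hx : x ∉ tsupport φ) : dt φ x = 0 := by
  have h0 : φ =ᶠ[𝓝 x] 0 := notMem_tsupport_iff_eventuallyEq.1 hx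
  have hc : Tendsto (fun t : ℝ => ((t, x.2) : Cyl)) (𝓝 x.1) (𝓝 x) :=
    (Continuous.prodMk_left x.2).tendsto x.1
  have h1 : (fun t : ℝ => φ (t, x.2)) =ᶠ[𝓝 x.1] fun _ => (0 : ℝ) := hc.eventually h0
  simp [dt, h1.deriv_eq]

theorem ds_eq_zero {φ : Cyl → ℝ} {x : Cyl} (hx : x ∉ tsupport φ) : ds φ x = 0 := by
  have h0 : φ =ᶠ[𝓝 x] 0 := notMem_tsupport_iff_eventuallyEq.1 hx
  have hc : Tendsto (fun h : ℝ => ((x.1, x.2 + (h : S1)) : Cyl)) (𝓝 0) (𝓝 x) := by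
    have : Continuous (fun h : ℝ => ((x.1, x.2 + (h : S1)) : Cyl)) :=
      continuous_const.prodMk (continuous_const.add (AddCircle.continuous_mk' _))
    simpa using this.tendsto 0
  have h1 : (fun h : ℝ => φ (x.1, x.2 + (h : S1))) =ᶠ[𝓝 0] fun _ => (0 : ℝ) := hc.eventually h0
  simp [ds, h1.deriv_eq]

theorem integrable_smul_of_tsupport {n : ℕ} {Ω : Set Cyl} {φ ψ : Cyl → ℝ} (hφ : IsTest Ω φ)
    (hψ : Continuous ψ) (h0 : ∀ x, x ∉ tsupport φ → ψ x = 0) {f : Cyl → E n}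
    (hf : LocallyIntegrableOn f Ω) : IntegrableOn (fun x => ψ x • f x) Ω := by
  have h1 : IntegrableOn f (tsupport φ) :=
    hf.integrableOn_compact_subset hφ.subset hφ.compact
  have h2 : IntegrableOn (fun x => ψ x • f x) (tsupport φ) :=
    h1.continuousOn_smul hψ.continuousOn hφ.compact
  refine Integrable.integrableOn ?_
  refine (integrableOn_iff_integrable_of_support_subset ?_).1 h2
  intro x hx
  by_contra hn
  exact hx (by simp [h0 x hn])

/-- The two coordinate derivatives: `∂_t` for `false`, `∂_s` for `true`. -/
def coordDeriv : Bool → (Cyl → ℝ) → Cyl → ℝ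
  | false => dt
  | true => ds

theorem coordDeriv_spec {Ω : Set Cyl} {φ : Cyl → ℝ} (hφ : IsTest Ω φ) (j : Bool) :
    Continuous (coordDeriv j φ) ∧ ∀ x, x ∉ tsupport φ → coordDeriv j φ x = 0 := by
  cases j
  · exact ⟨by simpa [coordDeriv] using hφ.continuous_dt,
      fun x hx => by simpa [coordDeriv] using dt_eq_zero hx⟩
  · exact ⟨by simpa [coordDeriv] using hφ.continuous_ds,
      fun x hx => by simpa [coordDeriv] using ds_eq_zero hx⟩

theorem HasWeakDeriv.add {n : ℕ} {j : Bool} {Ω : Set Cyl} {f₁ f₂ g₁ g₂ : Cyl → E n}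
    (h₁ : HasWeakDeriv (coordDeriv j) Ω f₁ g₁) (h₂ : HasWeakDeriv (coordDeriv j) Ω f₂ g₂) :
    HasWeakDeriv (coordDeriv j) Ω (f₁ + f₂) (g₁ + g₂) := by
  refine ⟨h₁.left.add h₂.left, h₁.right.add h₂.right, fun φ hφ => ?_⟩
  obtain ⟨hc, h0⟩ := coordDeriv_spec hφ j
  have h0' : ∀ x, x ∉ tsupport φ → φ x = 0 := fun x hx => image_eq_zero_of_notMem_tsupport hx
  simp only [Pi.add_apply, smul_add]
  rw [integral_add (integrable_smul_of_tsupport hφ hc h0 h₁.left)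
      (integrable_smul_of_tsupport hφ hc h0 h₂.left),
    integral_add (integrable_smul_of_tsupport hφ hφ.continuous h0' h₁.right)
      (integrable_smul_of_tsupport hφ hφ.continuous h0' h₂.right),
    h₁.byParts φ hφ, h₂.byParts φ hφ, neg_add]

theorem HasWeakDeriv.const_smul {n : ℕ} {j : Bool} {Ω : Set Cyl} {f g : Cyl → E n}
    (h : HasWeakDeriv (coordDeriv j) Ω f g) (c : ℝ) :
    HasWeakDeriv (coordDeriv j) Ω (c • f) (c • g) := by
  refine ⟨h.left.smul c, h.right.smul c, fun φ hφ => ?_⟩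
  simp only [Pi.smul_apply, smul_comm _ c]
  rw [integral_smul, integral_smul, h.byParts φ hφ, smul_neg]

theorem HasWeakDeriv.congr_Lp {n : ℕ} {j : Bool} {Ω : Set Cyl} {p : ℝ≥0∞} (hp : 1 ≤ p)
    {f g f' g' : Cyl → E n}
    (h : HasWeakDeriv (coordDeriv j) Ω f g)
    (hf : f' =ᵐ[volume.restrict Ω] f) (hg : g' =ᵐ[volume.restrict Ω] g)
    (hf' : MemLp f' p (volume.restrict Ω)) (hg' : MemLp g' p (volume.restrict Ω)) :
    HasWeakDeriv (coordDeriv j) Ω f' g' := by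
  refine ⟨locallyIntegrableOn_of_locallyIntegrable_restrict (hf'.locallyIntegrable hp),
    locallyIntegrableOn_of_locallyIntegrable_restrict (hg'.locallyIntegrable hp),
    fun φ hφ => ?_⟩
  rw [integral_congr_ae (g := fun x => coordDeriv j φ x • f x)
      (by filter_upwards [hf] with x hx; rw [hx]),
    integral_congr_ae (f := fun x => φ x • g' x) (g := fun x => φ x • g x)
      (by filter_upwards [hg] with x hx; rw [hx])]
  exact h.byParts φ hφ

theorem hasWeakDeriv_zero {n : ℕ} {j : Bool} {Ω : Set Cyl} :
    HasWeakDeriv (n := n) (coordDeriv j) Ω 0 0 :=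
  ⟨locallyIntegrableOn_zero, locallyIntegrableOn_zero, fun φ _ => by simp⟩

/-! ### Sobolev spaces -/

/-- Multi-indices `(i, j)` with `i + j ≤ k`; `(i, j)` labels `∂_t^i ∂_s^j`. -/
abbrev MIdx (k : ℕ) : Type :=
  {α : Fin (k + 1) × Fin (k + 1) // (α.1 : ℕ) + (α.2 : ℕ) ≤ k}

/-- The multi-index `(0, 0)`. -/
def MIdx.zero (k : ℕ) : MIdx k := ⟨(0, 0), by simp⟩

/-- `β` is obtained from `α` by one more derivative: in `t` if `j = false`, in `s` if
`j = true`. -/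
def MIdx.Step {k : ℕ} (j : Bool) (α β : MIdx k) : Prop :=
  (β.1.1 : ℕ) = α.1.1 + (if j then 0 else 1) ∧ (β.1.2 : ℕ) = α.1.2 + (if j then 1 else 0)

/-- The Sobolev space `L^p_k(Ω, E)`. An element is stored as the family `(v_α)`, `|α| ≤ k`, of the
function `v = v_(0,0)` and all its weak derivatives `v_α = ∂^α v`, each in `L^p`; the norm is the
usual one, `(∑_α ‖∂^α v‖_p ^ p) ^ (1/p)`. -/
def sobolev (n k : ℕ) (p : ℝ≥0∞) [Fact (1 ≤ p)] (Ω : Set Cyl) :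
    Submodule ℝ (PiLp p (fun _ : MIdx k => Lp (E n) p (volume.restrict Ω))) where
  carrier := {v | ∀ (j : Bool) (α β : MIdx k), MIdx.Step j α β →
    HasWeakDeriv (coordDeriv j) Ω (v α : Cyl → E n) (v β : Cyl → E n)}
  zero_mem' := fun j _ _ _ =>
    (hasWeakDeriv_zero (n := n) (j := j)).congr_Lp (p := p) Fact.out
      (Lp.coeFn_zero _ _ _) (Lp.coeFn_zero _ _ _) (Lp.memLp _) (Lp.memLp _)
  add_mem' := fun {v w} hv hw j α β hs =>
    ((hv j α β hs).add (hw j α β hs)).congr_Lp (p := p) Fact.out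
      (Lp.coeFn_add (v α) (w α)) (Lp.coeFn_add (v β) (w β)) (Lp.memLp _) (Lp.memLp _)
  smul_mem' := fun c v hv j α β hs =>
    ((hv j α β hs).const_smul c).congr_Lp (p := p) Fact.out
      (Lp.coeFn_smul c (v α)) (Lp.coeFn_smul c (v β)) (Lp.memLp _) (Lp.memLp _)

/-- The exponentially weighted Sobolev space `L^p_{k,δ}(Ω, E)` of all `u` such that
`e^{δ|t|} u ∈ L^p_k(Ω, E)`, with norm `‖u‖_{k,p,δ} = ‖e^{δ|t|} u‖_{k,p}`. The element `u` is
stored as `v = e^{δ|t|} u`, and recovered by `WSob.toFun`. -/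
@[nolint unusedArguments]
abbrev WSob (n k : ℕ) (p : ℝ≥0∞) [Fact (1 ≤ p)] (_δ : ℝ) (Ω : Set Cyl) : Type :=
  sobolev n k p Ω

/-- The function `u = e^{-δ|t|} v` on `Ω` given by an element of `L^p_{k,δ}(Ω, E)` (a representative
up to equality almost everywhere on `Ω`; its values outside `Ω` have no meaning). -/
def WSob.toFun {n k : ℕ} {p : ℝ≥0∞} [Fact (1 ≤ p)] {δ : ℝ} {Ω : Set Cyl}
    (u : WSob n k p δ Ω) (x : Cyl) : E n :=
  Real.exp (-(δ * |x.1|)) • (u.1 (MIdx.zero k) : Cyl → E n) x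

/-! ### The nodal surface and its total gluing -/

/-- The half-cylinder `C_- = (-∞, -b) × S¹`. -/
def Cminus (b : ℝ) : Set Cyl := {x | x.1 < -b}

/-- The half-cylinder `C_+ = (b, ∞) × S¹`. -/
def Cplus (b : ℝ) : Set Cyl := {x | b < x.1}

/-- The finite cylinder `S^R_+ = C_- ⊕_R C_+`, in the glued coordinate `t`. The other piece
`S^R_- = C_- ⊖_R C_+` is the whole cylinder. -/
def neck (b R : ℝ) : Set Cyl := {x | -(R - b) < x.1 ∧ x.1 < R - b}

/-- `L^p_{k,δ}(S, E) = L^p_{k,δ}(C_-, E) × L^p_{k,δ}(C_+, E)`. -/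
abbrev WSobS (n k : ℕ) (p : ℝ≥0∞) [Fact (1 ≤ p)] (δ b : ℝ) : Type :=
  WSob n k p δ (Cminus b) × WSob n k p δ (Cplus b)

/-- The exponential gluing profile `R = e^{1/r} - e^{1/r₀}`. -/
def gluingProfile (r₀ r : ℝ) : ℝ := Real.exp (1 / r) - Real.exp (1 / r₀)

/-- The length function `L(R) = R^{1/2} ln² R`. -/
def lengthFn (R : ℝ) : ℝ := Real.sqrt R * Real.log R ^ 2

/-- `β_-(t) = α((t - d) / l)` with `l = L(R)`, `d = 3 l`. -/
def betaMinus (α : ℝ → ℝ) (R t : ℝ) : ℝ := α ((t - 3 * lengthFn R) / lengthFn R)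

/-- `β_+(t) = (1 - α)((t + d) / l)` with `l = L(R)`, `d = 3 l`. -/
def betaPlus (α : ℝ → ℝ) (R t : ℝ) : ℝ := 1 - α ((t + 3 * lengthFn R) / lengthFn R)

/-- The splicing matrix `T_β`. -/
def splicingMatrix (α : ℝ → ℝ) (R t : ℝ) : Matrix (Fin 2) (Fin 2) ℝ :=
  !![betaMinus α R t, -betaPlus α R t; betaPlus α R t, betaMinus α R t]

/-- The connection matrix `ω(t) = - [[β_-', -β_+'], [0, 0]] T_β⁻¹`. -/
def connectionMatrix (α : ℝ → ℝ) (R t : ℝ) : Matrix (Fin 2) (Fin 2) ℝ :=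
  -(!![deriv (betaMinus α R) t, -deriv (betaPlus α R) t; 0, 0] * (splicingMatrix α R t)⁻¹)

/-- A real `2 × 2` matrix acting on a column vector `(v_-, v_+)` with entries in `E`. -/
def matAct {n : ℕ} (M : Matrix (Fin 2) (Fin 2) ℝ) (v : E n × E n) : E n × E n :=
  (M 0 0 • v.1 + M 0 1 • v.2, M 1 0 • v.1 + M 1 1 • v.2)

/-- The total gluing `T^a(u_-, u_+) = (u_- ⊖_a u_+, u_- ⊕_a u_+) = T_β (τ_{-a} u_-, τ_a u_+)`,
`a = (R, θ)`, in the glued coordinates `(t, s)`: `(t_±, s_±) = (t ± R, s ± θ)` and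
`τ_{±a} u (t, s) = u (t ± R, s ± θ)`. The functions `u_±` on `C_±` are extended by zero. -/
def totalGluing {n : ℕ} (α : ℝ → ℝ) (b R : ℝ) (θ : S1) (u : (Cyl → E n) × (Cyl → E n))
    (x : Cyl) : E n × E n :=
  matAct (splicingMatrix α R x.1)
    ((Cminus b).indicator u.1 (x.1 - R, x.2 - θ), (Cplus b).indicator u.2 (x.1 + R, x.2 + θ))

/-- The inverse `(T^a)⁻¹(η_-, η_+) = (τ_a 0; 0 τ_{-a}) T_β⁻¹ (η_-, η_+)` of the total gluing, a
pair of functions on `C_-` and `C_+`. -/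
def totalGluingInv {n : ℕ} (α : ℝ → ℝ) (R : ℝ) (θ : S1) (η : Cyl → E n × E n) :
    (Cyl → E n) × (Cyl → E n) :=
  (fun x => (matAct (splicingMatrix α R (x.1 + R))⁻¹ (η (x.1 + R, x.2 + θ))).1,
   fun x => (matAct (splicingMatrix α R (x.1 - R))⁻¹ (η (x.1 - R, x.2 - θ))).2)

/-- `ζ = ∂_t η` for a pair `η = (η_-, η_+)` of functions on `S^R_- = ℝ × S¹` and on `S^R_+`. -/
def IsDtGlued {n : ℕ} (b R : ℝ) (η ζ : Cyl → E n × E n) : Prop :=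
  HasWeakDeriv dt univ (fun x => (η x).1) (fun x => (ζ x).1) ∧
  HasWeakDeriv dt (neck b R) (fun x => (η x).2) (fun x => (ζ x).2)

/-- Two pairs of functions on `C_-` and `C_+` agree almost everywhere. -/
def EqAE {n : ℕ} (b : ℝ) (u w : (Cyl → E n) × (Cyl → E n)) : Prop :=
  u.1 =ᵐ[volume.restrict (Cminus b)] w.1 ∧ u.2 =ᵐ[volume.restrict (Cplus b)] w.2

/-- `w = Ψ_L^a(u) = ((T^a)⁻¹ ∘ (∂_t + ω) ∘ T^a)(u)` for a finite gluing parameter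
`a = (R, θ)`. -/
def IsPsiFinite {n : ℕ} (α : ℝ → ℝ) (b R : ℝ) (θ : S1) (u w : (Cyl → E n) × (Cyl → E n)) :
    Prop :=
  ∃ ζ : Cyl → E n × E n, IsDtGlued b R (totalGluing α b R θ u) ζ ∧
    EqAE b w (totalGluingInv α R θ
      (fun x => ζ x + matAct (connectionMatrix α R x.1) (totalGluing α b R θ u x)))

/-- `w = Ψ_L^∞(u) = ∂_t u`, the case of the gluing parameter `R = ∞`. -/
def IsPsiInfinite {n : ℕ} (b : ℝ) (u w : (Cyl → E n) × (Cyl → E n)) : Prop :=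
  HasWeakDeriv dt (Cminus b) u.1 w.1 ∧ HasWeakDeriv dt (Cplus b) u.2 w.2

/-- `w = Ψ_L(u, z)`, where `z = r e^{iθ}` is a point of the disk of gluing parameters: the gluing
parameter is `(R, θ)` with `R = e^{1/r} - e^{1/r₀}`, and `R = ∞` if `z = 0`. -/
def IsPsi {n : ℕ} (α : ℝ → ℝ) (b r₀ : ℝ) (z : ℂ) (u w : (Cyl → E n) × (Cyl → E n)) : Prop :=
  (z = 0 → IsPsiInfinite b u w) ∧
  (z ≠ 0 → IsPsiFinite α b (gluingProfile r₀ ‖z‖) (Complex.arg z : S1) u w)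

/-- The pair of functions on `C_-` and `C_+` given by an element of `L^p_{k,δ}(S, E)`. -/
def WSobS.toFun {n k : ℕ} {p : ℝ≥0∞} [Fact (1 ≤ p)] {δ b : ℝ} (u : WSobS n k p δ b) :
    (Cyl → E n) × (Cyl → E n) :=
  (WSob.toFun (δ := δ) u.1, WSob.toFun (δ := δ) u.2)

end FilledSection

end

/-! Conjugating by `T_β` adds to `∂_t` only the zeroth order term `T_β⁻¹(T_β' + ω T_β)`, and `ω`
cancels the first row of `T_β'`. Since `d = 3l`, the cutoffs `β_-` and `β_+` vary on the disjoint
intervals `[2l, 4l]` and `[-4l, -2l]`, each where the other equals `1`. With `λ = 1 / L(R)` the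
component on `C_-` is therefore `∂_t u_- + λ φ_d(λ(t+R)+3) u_- + λ φ_c(λ(t+R)-3) u_+(t+2R, s+2θ)`,
where the bumps `φ_d`, `φ_c` do not depend on `R`; `C_+` is symmetric (`splicing_conj`,
`splicing_coefficients`, `isPsiFinite_of_formula`).

The diagonal term multiplies by a function of `t` of size `O(λ)`, whose `R`-derivative is `O(λ² +
|λ'|)`. The profile has speed `|dR/dr| = (R + c) ln²(R + c)` with `c = e^{1/r₀}`, and `R ln²R · λ² =
1 / ln²R` tends to zero: this is the reason for the form of `L` (`isCoef_coef`).

The cross term contains a translation by `(2R, 2θ)`. Translations are differentiable only pointwise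
on functions, with the loss of one derivative, which the target `L^p_{k-1}` can afford
(`hasFDerivAt_transL`). The weights on the two half-cylinders turn the coefficient into one with the
factor `e^{-2δ(t+R)} ≤ e^{-4δl}` on its support. As `l ≥ √R` for large `R`, this beats both the
speed of the profile and the factor `1/|z|` from the angle (`contDiffOn_crossOp`).

So for fixed `u` the terms are `C¹` in `z ≠ 0` with derivatives tending to zero at the centre, hence
`C¹` on the disk (`contDiffOn_one_of_polar`). Linearity in `u` and the uniform boundedness principle
give joint `C¹` regularity (`contDiffOn_one_of_linear_family`). All this is done in `L^p` for each
derivative `∂_t^i ∂_s^j`; it suffices because Sobolev spaces are closed in products of `L^p` spaces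
(`isClosed_sobolev`, `contDiffOn_one_of_coe`). -/

noncomputable section

namespace FilledSection

/-! ### Criteria for continuous differentiability -/

section Calculus

variable {X Y Z : Type*} [NormedAddCommGroup X] [NormedSpace ℝ X]
  [NormedAddCommGroup Y] [NormedSpace ℝ Y] [NormedAddCommGroup Z] [NormedSpace ℝ Z]

theorem contDiffOn_one_of_hasFDerivAt {U : Set X} (hU : IsOpen U) {f : X → Y} {f' : X → X →L[ℝ] Y}
    (h : ∀ x ∈ U, HasFDerivAt f (f' x) x) (hc : ContinuousOn f' U) : ContDiffOn ℝ 1 f U := by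
  have h1 : ContDiffOn ℝ (0 + 1) f U := by
    rw [contDiffOn_succ_iff_fderiv_of_isOpen hU]
    refine ⟨fun x hx => (h x hx).differentiableAt.differentiableWithinAt, by simp, ?_⟩
    rw [contDiffOn_zero]
    exact hc.congr fun x hx => (h x hx).fderiv
  simpa using h1

theorem continuousOn_fderiv_of_contDiffOn {U : Set X} (hU : IsOpen U) {f : X → Y}
    (h : ContDiffOn ℝ 1 f U) : ContinuousOn (fderiv ℝ f) U :=
  h.continuousOn_fderiv_of_isOpen hU le_rfl

/-- For fixed `x` the mean value inequality bounds the difference quotients on a compact ball;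
uniform boundedness makes the bound independent of `x`. Differentiability of `B` in operator norm,
which fails for translations, is not needed. -/
theorem lipschitz_of_contDiffOn_apply [CompleteSpace X] [FiniteDimensional ℝ Z] {U : Set Z}
    (hU : IsOpen U) {B : Z → X →L[ℝ] Y} (hB : ∀ x, ContDiffOn ℝ 1 (fun z => B z x) U)
    {z₀ : Z} (hz₀ : z₀ ∈ U) :
    ∃ r > 0, Metric.closedBall z₀ r ⊆ U ∧ ∃ C, 0 ≤ C ∧
      ∀ z ∈ Metric.closedBall z₀ r, ∀ z' ∈ Metric.closedBall z₀ r,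
        ‖B z - B z'‖ ≤ C * ‖z - z'‖ := by
  obtain ⟨r, hr, hrU⟩ := Metric.nhds_basis_closedBall.mem_iff.1 (hU.mem_nhds hz₀)
  refine ⟨r, hr, hrU, ?_⟩
  have hp : ProperSpace Z := FiniteDimensional.proper ℝ Z
  have h1 : ∀ x, ∃ C, ∀ z ∈ Metric.closedBall z₀ r, ∀ z' ∈ Metric.closedBall z₀ r,
      ‖B z x - B z' x‖ ≤ C * ‖z - z'‖ := by
    intro x
    obtain ⟨C, hC⟩ := (isCompact_closedBall z₀ r).exists_bound_of_continuousOn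
      ((continuousOn_fderiv_of_contDiffOn hU (hB x)).mono hrU)
    refine ⟨C, fun z hz z' hz' => ?_⟩
    refine (convex_closedBall z₀ r).norm_image_sub_le_of_norm_fderiv_le (𝕜 := ℝ)
      (f := fun z => B z x) (fun w hw => ?_) hC hz' hz
    exact ((hB x).differentiableOn (by simp)).differentiableAt (hU.mem_nhds (hrU hw))
  -- Pairs with equal entries are harmless, because the inverse norm is `0` there.
  obtain ⟨C, hC⟩ := banach_steinhaus (𝕜 := ℝ) (𝕜₂ := ℝ) (σ₁₂ := RingHom.id ℝ)
    (ι := Metric.closedBall z₀ r × Metric.closedBall z₀ r)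
    (g := fun i => ‖(i.1 : Z) - i.2‖⁻¹ • (B i.1 - B i.2)) (by
      intro x
      obtain ⟨C, hC⟩ := h1 x
      refine ⟨max C 0, fun i => ?_⟩
      simp only [smul_apply, sub_apply, norm_smul,
        norm_inv, norm_norm]
      refine (inv_mul_le_of_le_mul₀ (norm_nonneg _) (le_max_right _ _) ?_)
      refine (hC i.1 i.1.2 i.2 i.2.2).trans ?_
      rw [mul_comm]
      gcongr
      exact le_max_left _ _)
  refine ⟨max C 0, le_max_right _ _, fun z hz z' hz' => ?_⟩
  rcases eq_or_ne z z' with rfl | hne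
  · simp
  have h2 := hC (⟨z, hz⟩, ⟨z', hz'⟩)
  simp only [norm_smul, norm_inv, norm_norm] at h2
  have h3 : 0 < ‖z - z'‖ := norm_pos_iff.2 (sub_ne_zero.2 hne)
  rw [inv_mul_le_iff₀ h3] at h2
  refine h2.trans ?_
  rw [mul_comm]
  gcongr
  exact le_max_left _ _

/-- A family of bounded linear maps which is pointwise of class `C¹` in a finite dimensional
parameter is jointly of class `C¹`. -/
theorem contDiffOn_one_of_linear_family [CompleteSpace X] [FiniteDimensional ℝ Z] {U : Set Z}
    (hU : IsOpen U) {B : Z → X →L[ℝ] Y} (hB : ∀ x, ContDiffOn ℝ 1 (fun z => B z x) U) :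
    ContDiffOn ℝ 1 (fun q : X × Z => B q.2 q.1) (univ ×ˢ U) := by
  have hd : ∀ x, ∀ z ∈ U, HasFDerivAt (fun z => B z x) (fderiv ℝ (fun z => B z x) z) z :=
    fun x z hz => (((hB x).differentiableOn (by simp)).differentiableAt
      (hU.mem_nhds hz)).hasFDerivAt
  refine contDiffOn_one_of_hasFDerivAt (isOpen_univ.prod hU)
    (f' := fun q => (B q.2).comp (ContinuousLinearMap.fst ℝ X Z) +
      (fderiv ℝ (fun z => B z q.1) q.2).comp (ContinuousLinearMap.snd ℝ X Z)) ?_ ?_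
  · rintro ⟨x₀, z₀⟩ ⟨-, hz₀⟩
    obtain ⟨r, hr, hrU, C, hC0, hC⟩ := lipschitz_of_contDiffOn_apply hU hB hz₀
    have e1 : HasFDerivAt (fun q : X × Z => B z₀ q.1)
        ((B z₀).comp (ContinuousLinearMap.fst ℝ X Z)) (x₀, z₀) :=
      (B z₀).hasFDerivAt.comp (x₀, z₀) hasFDerivAt_fst
    have e2 : HasFDerivAt (fun q : X × Z => B q.2 x₀)
        ((fderiv ℝ (fun z => B z x₀) z₀).comp (ContinuousLinearMap.snd ℝ X Z)) (x₀, z₀) :=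
      HasFDerivAt.comp (g := fun z => B z x₀) (f := Prod.snd) (x₀, z₀) (hd x₀ z₀ hz₀)
        hasFDerivAt_snd
    -- The mixed remainder is a product of two first order quantities, hence quadratically small.
    have e3 : HasFDerivAt (fun q : X × Z => (B q.2 - B z₀) (q.1 - x₀))
        (0 : X × Z →L[ℝ] Y) (x₀, z₀) := by
      rw [hasFDerivAt_iff_isLittleO]
      simp only [sub_self, map_zero, sub_zero, zero_apply]
      have hO : (fun q : X × Z => (B q.2 - B z₀) (q.1 - x₀)) =O[𝓝 (x₀, z₀)]
          fun q => ‖q - (x₀, z₀)‖ * ‖q - (x₀, z₀)‖ := by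
        refine Asymptotics.IsBigO.of_bound C ?_
        have hmem : ∀ᶠ q : X × Z in 𝓝 (x₀, z₀), q.2 ∈ Metric.closedBall z₀ r :=
          continuous_snd.continuousAt.eventually (Metric.closedBall_mem_nhds z₀ hr)
        filter_upwards [hmem] with q hq
        have h1 := hC q.2 hq z₀ (Metric.mem_closedBall_self hr.le)
        calc ‖(B q.2 - B z₀) (q.1 - x₀)‖ ≤ ‖B q.2 - B z₀‖ * ‖q.1 - x₀‖ :=
              ContinuousLinearMap.le_opNorm _ _
          _ ≤ (C * ‖q.2 - z₀‖) * ‖q.1 - x₀‖ := by gcongr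
          _ ≤ (C * ‖q - (x₀, z₀)‖) * ‖q - (x₀, z₀)‖ := by
              gcongr
              · exact norm_snd_le (q - (x₀, z₀))
              · exact norm_fst_le (q - (x₀, z₀))
          _ = C * ‖‖q - (x₀, z₀)‖ * ‖q - (x₀, z₀)‖‖ := by
              rw [Real.norm_of_nonneg (by positivity)]; ring
      refine hO.trans_isLittleO ?_
      have : (fun q : X × Z => ‖q - (x₀, z₀)‖ * ‖q - (x₀, z₀)‖) =o[𝓝 (x₀, z₀)]
          fun q => (1 : ℝ) * ‖q - (x₀, z₀)‖ := by
        refine Asymptotics.IsLittleO.mul_isBigO ?_ (Asymptotics.isBigO_refl _ _)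
        rw [Asymptotics.isLittleO_one_iff]
        have : Continuous fun q : X × Z => ‖q - (x₀, z₀)‖ := by fun_prop
        simpa using this.tendsto (x₀, z₀)
      simpa using this
    have := ((e1.add e2).add e3).sub_const (B z₀ x₀)
    rw [add_zero] at this
    refine this.congr_of_eventuallyEq (Eventually.of_forall fun q => ?_)
    simp
    abel
  · rintro ⟨x₀, z₀⟩ ⟨-, hz₀⟩
    refine ContinuousAt.continuousWithinAt ?_
    obtain ⟨r, hr, hrU, C, hC0, hC⟩ := lipschitz_of_contDiffOn_apply hU hB hz₀
    have hBc : ContinuousAt B z₀ := by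
      rw [ContinuousAt, tendsto_iff_norm_sub_tendsto_zero]
      refine squeeze_zero' (g := fun z => C * ‖z - z₀‖) (Eventually.of_forall fun _ => norm_nonneg _) ?_ ?_
      · filter_upwards [Metric.closedBall_mem_nhds z₀ hr] with z hz
        exact hC z hz z₀ (Metric.mem_closedBall_self hr.le)
      · have : Continuous fun z => C * ‖z - z₀‖ := by fun_prop
        simpa using this.tendsto z₀
    -- The Lipschitz bound passes to the partial derivative and controls its dependence on `x`
    -- uniformly in `z`; continuity in `z` is then needed at `x₀` only.
    have hbd : ∀ x, ∀ z ∈ Metric.ball z₀ r, ‖fderiv ℝ (fun z => B z x) z‖ ≤ C * ‖x‖ := by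
      intro x z hz
      refine norm_fderiv_le_of_lip' ℝ (by positivity) ?_
      filter_upwards [Metric.isOpen_ball.mem_nhds hz] with w hw
      calc ‖B w x - B z x‖ = ‖(B w - B z) x‖ := rfl
        _ ≤ ‖B w - B z‖ * ‖x‖ := ContinuousLinearMap.le_opNorm _ _
        _ ≤ (C * ‖w - z‖) * ‖x‖ := by
          gcongr
          exact hC w (Metric.ball_subset_closedBall hw) z (Metric.ball_subset_closedBall hz)
        _ = C * ‖x‖ * ‖w - z‖ := by ring
    have hDc : ContinuousAt (fun q : X × Z => fderiv ℝ (fun z => B z q.1) q.2) (x₀, z₀) := by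
      rw [ContinuousAt, tendsto_iff_norm_sub_tendsto_zero]
      have hx0 : ContinuousAt (fderiv ℝ fun z => B z x₀) z₀ :=
        (continuousOn_fderiv_of_contDiffOn hU (hB x₀)).continuousAt (hU.mem_nhds hz₀)
      refine squeeze_zero' (g := fun q : X × Z => C * ‖q.1 - x₀‖ +
        ‖fderiv ℝ (fun z => B z x₀) q.2 - fderiv ℝ (fun z => B z x₀) z₀‖)
        (Eventually.of_forall fun _ => norm_nonneg _) ?_ ?_
      · have hmem : ∀ᶠ q : X × Z in 𝓝 (x₀, z₀), q.2 ∈ Metric.ball z₀ r :=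
          continuous_snd.continuousAt.eventually (Metric.ball_mem_nhds z₀ hr)
        filter_upwards [hmem] with q hq
        have hqU : q.2 ∈ U := hrU (Metric.ball_subset_closedBall hq)
        have e : fderiv ℝ (fun z => B z q.1) q.2 =
            fderiv ℝ (fun z => B z (q.1 - x₀)) q.2 + fderiv ℝ (fun z => B z x₀) q.2 := by
          rw [← ((hd (q.1 - x₀) q.2 hqU).add (hd x₀ q.2 hqU)).fderiv]
          congr 1
          ext z
          simp
        rw [e, add_sub_assoc]
        exact (norm_add_le _ _).trans (add_le_add (hbd _ _ hq) le_rfl)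
      · have h1 : ContinuousAt (fun q : X × Z => C * ‖q.1 - x₀‖ +
          ‖fderiv ℝ (fun z => B z x₀) q.2 - fderiv ℝ (fun z => B z x₀) z₀‖) (x₀, z₀) := by
          have : ContinuousAt (fun q : X × Z => fderiv ℝ (fun z => B z x₀) q.2) (x₀, z₀) :=
            ContinuousAt.comp (f := Prod.snd) (x := (x₀, z₀)) hx0 continuous_snd.continuousAt
          fun_prop
        simpa using h1.tendsto
    have h1 : ContinuousAt (fun q : X × Z => B q.2) (x₀, z₀) :=
      ContinuousAt.comp (f := Prod.snd) (x := (x₀, z₀)) hBc continuous_snd.continuousAt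
    exact (h1.clm_comp continuousAt_const).add (hDc.clm_comp continuousAt_const)

/-- A map into a closed subspace is of class `C¹` if it is so as a map into the ambient space. -/
theorem contDiffOn_one_of_coe {S : Submodule ℝ Y} (hS : IsClosed (S : Set Y)) {U : Set X}
    (hU : IsOpen U) {f : X → S} (h : ContDiffOn ℝ 1 (fun x => (f x : Y)) U) :
    ContDiffOn ℝ 1 f U := by
  have hd : ∀ x ∈ U, HasFDerivAt (fun x => (f x : Y)) (fderiv ℝ (fun x => (f x : Y)) x) x :=
    fun x hx => ((h.differentiableOn (by simp)).differentiableAt (hU.mem_nhds hx)).hasFDerivAt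
  -- Derivatives are limits of difference quotients, which lie in the closed subspace.
  have hm : ∀ x ∈ U, ∀ v, fderiv ℝ (fun x => (f x : Y)) x v ∈ S := by
    intro x hx v
    have h1 := ((hd x hx).hasLineDerivAt v)
    have h2 := hasDerivAt_iff_tendsto_slope_zero.1 (h1 : HasDerivAt _ _ _)
    refine hS.mem_of_tendsto h2 (Eventually.of_forall fun t => ?_)
    exact S.smul_mem _ (S.sub_mem (f _).2 (f _).2)
  classical
  let f' : X → X →L[ℝ] S := fun x =>
    if hx : x ∈ U then (fderiv ℝ (fun x => (f x : Y)) x).codRestrict S (hm x hx) else 0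
  have hf' : ∀ x ∈ U, S.subtypeL.comp (f' x) = fderiv ℝ (fun x => (f x : Y)) x := by
    intro x hx
    ext v
    simp [f', hx]
  refine contDiffOn_one_of_hasFDerivAt hU (f' := f') (fun x hx => ?_) fun x hx => ?_
  · have h1 := (hd x hx)
    rw [← hf' x hx, hasFDerivAt_iff_isLittleO] at h1
    rw [hasFDerivAt_iff_isLittleO, ← Asymptotics.isLittleO_norm_left]
    rw [← Asymptotics.isLittleO_norm_left] at h1
    exact h1
  · have h1 := (continuousOn_fderiv_of_contDiffOn hU h) x hx
    rw [ContinuousWithinAt, tendsto_iff_norm_sub_tendsto_zero] at h1 ⊢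
    refine h1.congr' ?_
    filter_upwards [self_mem_nhdsWithin] with y hy
    rw [← hf' x hx, ← hf' y hy, ← ContinuousLinearMap.comp_sub]
    exact (S.subtypeₗᵢ).norm_toContinuousLinearMap_comp

/-! ### Polar coordinates on the disk of gluing parameters. -/

/-- The derivative of the norm of `ℂ` away from zero. -/
def dNorm (z : ℂ) : ℂ →L[ℝ] ℝ := innerSL ℝ ((‖z‖⁻¹ : ℝ) • z)

/-- The derivative of the argument away from zero. -/
def dArg (z : ℂ) : ℂ →L[ℝ] ℝ :=
  Complex.imCLM.comp ((ContinuousLinearMap.mul ℝ ℂ) z⁻¹)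

theorem norm_dNorm_le (z : ℂ) : ‖dNorm z‖ ≤ 1 := by
  rw [dNorm, innerSL_apply_norm, norm_smul, norm_inv, norm_norm]
  exact inv_mul_le_one

theorem norm_dArg_le (z : ℂ) : ‖dArg z‖ ≤ ‖z‖⁻¹ := by
  refine ContinuousLinearMap.opNorm_le_bound _ (by positivity) fun h => ?_
  rw [← norm_inv, ← norm_mul]
  exact Complex.abs_im_le_norm _

theorem hasFDerivAt_norm_complex {z : ℂ} (hz : z ≠ 0) :
    HasFDerivAt (fun z : ℂ => ‖z‖) (dNorm z) z := by
  have h1 : HasFDerivAt (fun z : ℂ => ‖z‖ ^ 2) (2 • (innerSL ℝ z)) z := by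
    simpa using (hasStrictFDerivAt_norm_sq z).hasFDerivAt
  have h2 := h1.sqrt (by positivity)
  simp only [Real.sqrt_sq (norm_nonneg _)] at h2
  have e : dNorm z = (1 / (2 * ‖z‖)) • (2 • (innerSL ℝ z)) := by
    ext w
    have : ‖z‖ ≠ 0 := norm_ne_zero_iff.2 hz
    simp only [dNorm, innerSL_apply_apply, inner_smul_left, smul_apply]
    simp
    field_simp
  rw [e]
  exact h2

theorem continuousOn_dNorm : ContinuousOn dNorm {0}ᶜ := by
  refine (innerSL ℝ (E := ℂ)).continuous.comp_continuousOn ?_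
  refine ContinuousOn.smul (ContinuousOn.inv₀ continuous_norm.continuousOn ?_) continuousOn_id
  simp

theorem continuousOn_dArg : ContinuousOn dArg {0}ᶜ :=
  continuousOn_const.clm_comp
    ((ContinuousLinearMap.mul ℝ ℂ).continuous.comp_continuousOn continuousOn_inv₀)

/-- A map which is of class `C¹` on a punctured disk, with a derivative that is given in polar
coordinates and tends to zero at the centre, is of class `C¹` on the disk. -/
theorem contDiffOn_one_of_polar {r : ℝ} {G A B : ℂ → Y}
    (hG : ∀ z ∈ Metric.ball (0 : ℂ) r, z ≠ 0 →
      HasFDerivAt G ((dNorm z).smulRight (A z) + (dArg z).smulRight (B z)) z)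
    (hA : ContinuousOn A (Metric.ball 0 r \ {0})) (hB : ContinuousOn B (Metric.ball 0 r \ {0}))
    (hG0 : Tendsto G (𝓝[≠] 0) (𝓝 (G 0))) (hA0 : Tendsto A (𝓝[≠] 0) (𝓝 0))
    (hB0 : Tendsto (fun z => ‖z‖⁻¹ * ‖B z‖) (𝓝[≠] 0) (𝓝 0)) :
    ContDiffOn ℝ 1 G (Metric.ball 0 r) := by
  classical
  let D : ℂ → ℂ →L[ℝ] Y := fun z => (dNorm z).smulRight (A z) + (dArg z).smulRight (B z)
  have hDb : ∀ z, ‖D z‖ ≤ ‖A z‖ + ‖z‖⁻¹ * ‖B z‖ := by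
    intro z
    refine (norm_add_le _ _).trans ?_
    rw [ContinuousLinearMap.norm_smulRight_apply, ContinuousLinearMap.norm_smulRight_apply]
    gcongr
    · exact mul_le_of_le_one_left (norm_nonneg _) (norm_dNorm_le z)
    · exact norm_dArg_le z
  have hD0 : Tendsto (fun z => ‖D z‖) (𝓝[≠] 0) (𝓝 0) := by
    refine squeeze_zero (fun _ => norm_nonneg _) hDb ?_
    simpa using hA0.norm.add hB0
  have hDc : ContinuousOn D (Metric.ball 0 r \ {0}) := by
    have h1 : ContinuousOn dNorm (Metric.ball 0 r \ {0}) := continuousOn_dNorm.mono fun z hz => hz.2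
    have h2 : ContinuousOn dArg (Metric.ball 0 r \ {0}) := continuousOn_dArg.mono fun z hz => hz.2
    exact (((ContinuousLinearMap.smulRightL ℝ ℂ Y).continuous.comp_continuousOn h1).clm_apply
      hA).add (((ContinuousLinearMap.smulRightL ℝ ℂ Y).continuous.comp_continuousOn h2).clm_apply
      hB)
  have key : HasFDerivAt G (0 : ℂ →L[ℝ] Y) 0 ∨ r ≤ 0 := by
    rcases le_or_gt r 0 with hr | hr
    · exact Or.inr hr
    left
    rw [hasFDerivAt_iff_isLittleO, Asymptotics.isLittleO_iff]
    intro c hc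
    have h1 : ∀ᶠ z in 𝓝[≠] (0 : ℂ), ‖D z‖ < c := hD0.eventually (gt_mem_nhds hc)
    rw [eventually_nhdsWithin_iff] at h1
    obtain ⟨ρ, hρ, hρ'⟩ := Metric.eventually_nhds_iff_ball.1 h1
    filter_upwards [Metric.ball_mem_nhds (0 : ℂ) (lt_min hρ hr)] with z hz
    rcases eq_or_ne z 0 with rfl | hz0
    · simp
    have hzn : ‖z‖ < min ρ r := by simpa using hz
    -- The segment from `s • z` to `z` avoids the origin, where differentiability is not yet known.
    -- Continuity of `G` at `0` then permits `s → 0`.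
    have h2 : ∀ s ∈ Ioo (0 : ℝ) 1, ‖G z - G (s • z)‖ ≤ c * ‖z‖ := by
      intro s hs
      have hseg : ∀ w ∈ segment ℝ (s • z) z, w ≠ 0 ∧ ‖w‖ < min ρ r := by
        rintro w ⟨a, b, ha, hb, hab, rfl⟩
        have e : a • s • z + b • z = (a * s + b) • z := by rw [add_smul, mul_smul]
        rw [e]
        have hpos : 0 < a * s + b := by
          rcases ha.eq_or_lt with h | h
          · rw [← h] at hab ⊢; linarith
          · have := mul_pos h hs.1; linarith
        have hle : a * s + b ≤ 1 := by nlinarith [hs.2]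
        refine ⟨smul_ne_zero hpos.ne' hz0, ?_⟩
        rw [norm_smul, Real.norm_of_nonneg hpos.le]
        exact (mul_le_of_le_one_left (norm_nonneg _) hle).trans_lt hzn
      have h3 := (convex_segment (s • z) z).norm_image_sub_le_of_norm_hasFDerivWithin_le (𝕜 := ℝ)
        (f := G) (f' := D) (C := c) (fun w hw => (hG w (by
          simpa using (hseg w hw).2.trans_le (min_le_right _ _)) (hseg w hw).1).hasFDerivWithinAt)
        (fun w hw => (hρ' w (by simpa using (hseg w hw).2.trans_le (min_le_left _ _))
          (hseg w hw).1).le) (left_mem_segment ℝ _ _) (right_mem_segment ℝ _ _)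
      refine h3.trans ?_
      gcongr
      have e : z - s • z = (1 - s) • z := by rw [sub_smul, one_smul]
      rw [e, norm_smul, Real.norm_of_nonneg (by linarith [hs.2])]
      exact mul_le_of_le_one_left (norm_nonneg _) (by linarith [hs.1])
    have h4 : Tendsto (fun s : ℝ => ‖G z - G (s • z)‖) (𝓝[>] 0) (𝓝 ‖G z - G 0‖) := by
      refine (tendsto_const_nhds.sub (hG0.comp ?_)).norm
      rw [tendsto_nhdsWithin_iff]
      constructor
      · have : Continuous fun s : ℝ => s • z := by fun_prop
        simpa using (this.tendsto 0).mono_left nhdsWithin_le_nhds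
      · filter_upwards [self_mem_nhdsWithin] with s hs
        exact smul_ne_zero (ne_of_gt hs) hz0
    have h5 : ‖G z - G 0‖ ≤ c * ‖z‖ := by
      refine le_of_tendsto h4 ?_
      filter_upwards [Ioo_mem_nhdsGT (zero_lt_one' ℝ)] with s hs using h2 s hs
    simpa using h5
  rcases key with key | hr
  swap
  · rw [Metric.ball_eq_empty.2 hr]
    exact fun x hx => absurd hx (notMem_empty x)
  -- Since `0⁻¹ = 0`, both `dNorm 0` and `dArg 0` vanish, so the formula for `D` has the right value
  -- at the centre as well.
  have hD00 : D 0 = 0 := by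
    have h1 : dNorm 0 = 0 := by simp [dNorm]
    have h2 : dArg 0 = 0 := by simp [dArg]
    ext
    simp [D, h1, h2]
  refine contDiffOn_one_of_hasFDerivAt Metric.isOpen_ball (f' := D) (fun z hz => ?_) fun z hz => ?_
  · rcases eq_or_ne z 0 with rfl | h0
    · rwa [hD00]
    · exact hG z hz h0
  · refine ContinuousAt.continuousWithinAt ?_
    rcases eq_or_ne z 0 with rfl | h0
    · rw [continuousAt_iff_punctured_nhds, hD00, tendsto_zero_iff_norm_tendsto_zero]
      exact hD0
    · exact hDc.continuousAt ((Metric.isOpen_ball.sdiff isClosed_singleton).mem_nhds ⟨hz, h0⟩)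

end Calculus

/-! ### Operators on `Lᵖ` spaces of the cylinder -/

section Operators

open scoped BoundedContinuousFunction

variable {F : Type*} [NormedAddCommGroup F] [NormedSpace ℝ F] {p : ℝ≥0∞}

instance : (volume : Measure Cyl).IsAddHaarMeasure :=
  inferInstanceAs ((volume : Measure ℝ).prod (volume : Measure S1)).IsAddHaarMeasure

theorem memLp_bcf_smul {μ : Measure Cyl} (q : ℝ →ᵇ ℝ) {f : Cyl → F} (hf : MemLp f p μ) :
    MemLp (fun x => q x.1 • f x) p μ := by
  refine hf.of_le_mul (c := ‖q‖) ?_ (Eventually.of_forall fun x => ?_)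
  · exact (q.continuous.comp continuous_fst).aestronglyMeasurable.smul hf.1
  · rw [norm_smul]
    gcongr
    exact q.norm_coe_le_norm _

variable [Fact (1 ≤ p)]

/-- Multiplication of an `Lᵖ` function on the cylinder by a bounded continuous function of `t`. -/
def mulL (μ : Measure Cyl) : (ℝ →ᵇ ℝ) →L[ℝ] Lp F p μ →L[ℝ] Lp F p μ :=
  LinearMap.mkContinuous₂
    (LinearMap.mk₂ ℝ (fun (q : ℝ →ᵇ ℝ) (V : Lp F p μ) =>
        (memLp_bcf_smul q (Lp.memLp V)).toLp (fun x => q x.1 • V x))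
      (by
        intro q q' V
        rw [← MemLp.toLp_add]
        refine MemLp.toLp_congr _ _ (Eventually.of_forall fun x => ?_)
        simp [add_smul])
      (by
        intro c q V
        rw [← MemLp.toLp_const_smul]
        refine MemLp.toLp_congr _ _ (Eventually.of_forall fun x => ?_)
        simp [mul_smul])
      (by
        intro q V V'
        rw [← MemLp.toLp_add]
        refine MemLp.toLp_congr _ _ ?_
        filter_upwards [Lp.coeFn_add V V'] with x hx
        rw [hx, Pi.add_apply, smul_add]
        rfl)
      (by
        intro c q V
        rw [← MemLp.toLp_const_smul]
        refine MemLp.toLp_congr _ _ ?_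
        filter_upwards [Lp.coeFn_smul c V] with x hx
        simp [hx, smul_comm c]))
    1 (by
      intro q V
      rw [one_mul]
      refine Lp.norm_le_mul_norm_of_ae_le_mul ?_
      filter_upwards [(memLp_bcf_smul q (Lp.memLp V)).coeFn_toLp] with x hx
      simp only [LinearMap.mk₂_apply]
      rw [hx, norm_smul]
      gcongr
      exact q.norm_coe_le_norm _)

theorem coeFn_mulL {μ : Measure Cyl} (q : ℝ →ᵇ ℝ) (V : Lp F p μ) :
    mulL μ q V =ᵐ[μ] fun x => q x.1 • V x :=
  (memLp_bcf_smul q (Lp.memLp V)).coeFn_toLp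

theorem norm_mulL_le {μ : Measure Cyl} (q : ℝ →ᵇ ℝ) (V : Lp F p μ) :
    ‖mulL μ q V‖ ≤ ‖q‖ * ‖V‖ := by
  refine Lp.norm_le_mul_norm_of_ae_le_mul ?_
  filter_upwards [coeFn_mulL q V] with x hx
  rw [hx, norm_smul]
  gcongr
  exact q.norm_coe_le_norm _

/-- Extension by zero. -/
def extL {Ω : Set Cyl} (hΩ : MeasurableSet Ω) :
    Lp F p (volume.restrict Ω) →L[ℝ] Lp F p (volume : Measure Cyl) :=
  LinearMap.mkContinuous
    { toFun := fun V => ((memLp_indicator_iff_restrict hΩ).2 (Lp.memLp V)).toLp (Ω.indicator V)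
      map_add' := by
        intro V V'
        rw [← MemLp.toLp_add]
        refine MemLp.toLp_congr _ _ ?_
        filter_upwards [(ae_restrict_iff' hΩ).1 (Lp.coeFn_add V V')] with x hx
        by_cases h : x ∈ Ω
        · simp only [Pi.add_apply, indicator_of_mem h]
          exact hx h
        · simp [h]
      map_smul' := by
        intro c V
        rw [RingHom.id_apply, ← MemLp.toLp_const_smul]
        refine MemLp.toLp_congr _ _ ?_
        filter_upwards [(ae_restrict_iff' hΩ).1 (Lp.coeFn_smul c V)] with x hx
        by_cases h : x ∈ Ω
        · simp [h, hx h]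
        · simp [h] }
    1 (by
      intro V
      rw [one_mul]
      simp only [LinearMap.coe_mk, AddHom.coe_mk]
      rw [Lp.norm_toLp, eLpNorm_indicator_eq_eLpNorm_restrict hΩ, Lp.norm_def])

theorem coeFn_extL {Ω : Set Cyl} (hΩ : MeasurableSet Ω) (V : Lp F p (volume.restrict Ω)) :
    extL hΩ V =ᵐ[volume] Ω.indicator V :=
  ((memLp_indicator_iff_restrict hΩ).2 (Lp.memLp V)).coeFn_toLp

/-- Translation, `(τ_a V)(x) = V (a + x)`. -/
def transL (a : Cyl) : Lp F p (volume : Measure Cyl) →L[ℝ] Lp F p (volume : Measure Cyl) :=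
  (Lp.compMeasurePreservingₗᵢ ℝ (a + ·) (measurePreserving_add_left volume a)).toContinuousLinearMap

theorem coeFn_transL (a : Cyl) (V : Lp F p (volume : Measure Cyl)) :
    transL a V =ᵐ[volume] fun x => V (a + x) :=
  Lp.coeFn_compMeasurePreserving _ _

theorem norm_transL (a : Cyl) (V : Lp F p (volume : Measure Cyl)) : ‖transL a V‖ = ‖V‖ :=
  Lp.norm_compMeasurePreserving _ _

theorem transL_add (a c : Cyl) (V : Lp F p (volume : Measure Cyl)) :
    transL (a + c) V = transL a (transL c V) := by
  refine Lp.ext ?_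
  have h1 := (measurePreserving_add_left volume a).quasiMeasurePreserving.ae_eq_comp
    (coeFn_transL c V)
  filter_upwards [coeFn_transL (a + c) V, coeFn_transL a (transL c V), h1] with x h2 h3 h4
  simp only [Function.comp_apply] at h4
  rw [h2, h3, h4]
  congr 1
  abel

theorem transL_zero (V : Lp F p (volume : Measure Cyl)) : transL 0 V = V := by
  refine Lp.ext ?_
  filter_upwards [coeFn_transL 0 V] with x hx
  simpa using hx

/-- Only strong continuity holds, not continuity in operator norm; here `p < ∞` is essential. -/
theorem continuous_transL [Fact (p ≠ ⊤)] (V : Lp F p (volume : Measure Cyl)) :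
    Continuous fun a => transL a V := by
  let g : C(Cyl, C(Cyl, Cyl)) := (ContinuousMap.mk (fun a : Cyl × Cyl ↦ a.1 + a.2)).curry
  exact continuous_const.compMeasurePreservingLp g.continuous
    (fun a => measurePreserving_add_left volume a) Fact.out

end Operators

/-! ### Test functions separate functions -/

/-- The function on the cylinder obtained from a function with support in the strip
`ℝ × (0, 2π)`. -/
def ofStrip (g : ℝ × ℝ → ℝ) (x : Cyl) : ℝ := g (x.1, AddCircle.equivIco (2 * Real.pi) 0 x.2)

theorem ofStrip_cover (g : ℝ × ℝ → ℝ) {y : ℝ × ℝ} (hy : y.2 ∈ Ico 0 (2 * Real.pi)) :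
    ofStrip g (cover y) = g y := by
  have : (AddCircle.equivIco (2 * Real.pi) 0 (y.2 : S1) : ℝ) = y.2 :=
    AddCircle.equivIco_coe_of_mem (by simpa using hy)
  simp [ofStrip, cover, this]

theorem cover_add_period (y : ℝ × ℝ) (m : ℤ) :
    cover (y + (0, m * (2 * Real.pi))) = cover y := by
  simp [cover]

/-- The only danger is the seam at angle `0`. Away from it the function is locally a translate of
`g`; near it the function vanishes, since the compact support of `g` keeps a distance `ε` from both
edges of the strip. -/
theorem isTest_ofStrip {g : ℝ × ℝ → ℝ} (hg : ContDiff ℝ ∞ g) (hc : HasCompactSupport g)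
    (hs : tsupport g ⊆ univ ×ˢ Ioo 0 (2 * Real.pi)) : IsTest univ (ofStrip g) := by
  have hpi := Real.two_pi_pos
  have h0 : ∀ y : ℝ × ℝ, y.2 ∉ Ioo 0 (2 * Real.pi) → g y = 0 := fun y hy =>
    image_eq_zero_of_notMem_tsupport fun h => hy (hs h).2
  obtain ⟨ε, hε, hεs⟩ : ∃ ε > 0, ∀ y ∈ tsupport g, y.2 ∈ Icc ε (2 * Real.pi - ε) := by
    have hK : IsCompact (Prod.snd '' tsupport g) := hc.isCompact.image continuous_snd
    rcases (Prod.snd '' tsupport g).eq_empty_or_nonempty with he | hne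
    · refine ⟨1, one_pos, fun y hy => ?_⟩
      have : y.2 ∈ Prod.snd '' tsupport g := mem_image_of_mem _ hy
      rw [he] at this
      exact absurd this (notMem_empty _)
    · obtain ⟨m, hm, hm'⟩ := hK.exists_isLeast hne
      obtain ⟨M, hM, hM'⟩ := hK.exists_isGreatest hne
      obtain ⟨y1, hy1, rfl⟩ := hm
      obtain ⟨y2, hy2, rfl⟩ := hM
      refine ⟨min y1.2 (2 * Real.pi - y2.2), lt_min (hs hy1).2.1 (sub_pos.2 (hs hy2).2.2),
        fun y hy => ⟨(min_le_left _ _).trans (hm' (mem_image_of_mem _ hy)), ?_⟩⟩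
      have h1 := hM' (mem_image_of_mem Prod.snd hy)
      have h2 := min_le_right y1.2 (2 * Real.pi - y2.2)
      linarith
  have h0' : ∀ y : ℝ × ℝ, y.2 ∉ Icc ε (2 * Real.pi - ε) → g y = 0 := fun y hy =>
    image_eq_zero_of_notMem_tsupport fun h => hy (hεs y h)
  have hper : ∀ (y : ℝ × ℝ) (m : ℤ), y.2 + m * (2 * Real.pi) ∈ Ico 0 (2 * Real.pi) →
      ofStrip g (cover y) = g (y + (0, m * (2 * Real.pi))) := by
    intro y m hm
    rw [← cover_add_period y m]
    exact ofStrip_cover g (by simpa using hm)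
  refine ⟨contDiff_iff_contDiffAt.2 fun y => ?_, ?_, subset_univ _⟩
  -- `m` periods bring the angle into `[0, 2π)`.
  · set m : ℤ := -toIcoDiv hpi 0 y.2 with hm
    have hmem : y.2 + m * (2 * Real.pi) ∈ Ico 0 (2 * Real.pi) := by
      have := sub_toIcoDiv_zsmul_mem_Ico hpi 0 y.2
      simpa [hm, sub_eq_add_neg] using this
    by_cases h1 : 0 < y.2 + m * (2 * Real.pi)
    · have hev : ∀ᶠ y' : ℝ × ℝ in 𝓝 y, y'.2 + m * (2 * Real.pi) ∈ Ioo 0 (2 * Real.pi) := by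
        have hcont : Continuous fun y' : ℝ × ℝ => y'.2 + m * (2 * Real.pi) := by fun_prop
        exact hcont.continuousAt.eventually (Ioo_mem_nhds h1 hmem.2)
      have h2 : ContDiffAt ℝ ∞ (fun y' => g (y' + (0, m * (2 * Real.pi)))) y :=
        (hg.comp (contDiff_id.add contDiff_const)).contDiffAt
      refine h2.congr_of_eventuallyEq ?_
      filter_upwards [hev] with y' hy'
      exact hper y' m (Ioo_subset_Ico_self hy')
    · have h2 : y.2 + m * (2 * Real.pi) = 0 := le_antisymm (not_lt.1 h1) hmem.1
      have hev : ∀ᶠ y' : ℝ × ℝ in 𝓝 y, y'.2 + m * (2 * Real.pi) ∈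
          Ioo (-min ε (2 * Real.pi)) (min ε (2 * Real.pi)) := by
        have hcont : Continuous fun y' : ℝ × ℝ => y'.2 + m * (2 * Real.pi) := by fun_prop
        refine hcont.continuousAt.eventually (Ioo_mem_nhds ?_ ?_) <;> simp only [h2]
        · simpa using ⟨hε, Real.pi_pos⟩
        · exact lt_min hε hpi
      refine (contDiffAt_const (c := (0 : ℝ))).congr_of_eventuallyEq ?_
      filter_upwards [hev] with y' hy'
      have hlt := hy'.2.trans_le (min_le_left _ _)
      have hlt2 := hy'.2.trans_le (min_le_right _ _)
      have hgt := hy'.1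
      have hmin1 := min_le_left ε (2 * Real.pi)
      have hmin2 := min_le_right ε (2 * Real.pi)
      rcases lt_or_ge (y'.2 + m * (2 * Real.pi)) 0 with h3 | h3
      · have h4 : y'.2 + (m + 1 : ℤ) * (2 * Real.pi) ∈ Ico 0 (2 * Real.pi) := by
          push_cast
          constructor <;> linarith
        rw [hper y' (m + 1) h4]
        refine h0' _ fun h => ?_
        have := h.2
        simp at this
        linarith
      · rw [hper y' m ⟨h3, hlt2⟩]
        refine h0' _ fun h => ?_
        have := h.1
        simp at this
        linarith
  · refine HasCompactSupport.intro (K := cover '' tsupport g)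
      (hc.isCompact.image isOpenQuotientMap_cover.continuous) fun x hx => ?_
    by_contra hne
    refine hx ⟨(x.1, AddCircle.equivIco (2 * Real.pi) 0 x.2), subset_tsupport _ hne, ?_⟩
    simp only [cover]
    rw [AddCircle.coe_equivIco]

/-- The covering restricted to `ℝ × (0, 2π]` preserves the measure, so the fundamental lemma on the
open strip applies; the omitted line at angle `2π` is a null set. -/
theorem ae_eq_zero_of_integral_test {n : ℕ} {f : Cyl → E n} (hf : LocallyIntegrable f)
    (h : ∀ φ, IsTest univ φ → ∫ x, φ x • f x = 0) : f =ᵐ[volume] 0 := by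
  have hpi := Real.two_pi_pos
  have hmp : MeasurePreserving cover
      (volume.restrict (univ ×ˢ Ioc 0 (2 * Real.pi))) (volume : Measure Cyl) := by
    have h1 := (MeasurePreserving.id (volume : Measure ℝ)).prod
      (AddCircle.measurePreserving_mk (2 * Real.pi) 0)
    rw [zero_add] at h1
    have h2 : (volume : Measure (ℝ × ℝ)).restrict (univ ×ˢ Ioc 0 (2 * Real.pi)) =
        (volume : Measure ℝ).prod (volume.restrict (Ioc 0 (2 * Real.pi))) := by
      rw [Measure.volume_eq_prod, ← Measure.prod_restrict, Measure.restrict_univ]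
    rw [h2]
    exact h1
  have hU : IsOpen (univ ×ˢ Ioo 0 (2 * Real.pi) : Set (ℝ × ℝ)) := isOpen_univ.prod isOpen_Ioo
  have hsub : (univ ×ˢ Ioo 0 (2 * Real.pi) : Set (ℝ × ℝ)) ⊆ univ ×ˢ Ioc 0 (2 * Real.pi) :=
    prod_mono le_rfl Ioo_subset_Ioc_self
  have hmeas : MeasurableSet (univ ×ˢ Ioc 0 (2 * Real.pi) : Set (ℝ × ℝ)) :=
    MeasurableSet.univ.prod measurableSet_Ioc
  have hfm : AEStronglyMeasurable f volume := hf.aestronglyMeasurable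
  have hloc : LocallyIntegrableOn (fun y => f (cover y)) (univ ×ˢ Ioo 0 (2 * Real.pi)) := by
    rw [locallyIntegrableOn_iff hU.isLocallyClosed]
    intro k hk hkc
    have hck : IsCompact (cover '' k) := hkc.image isOpenQuotientMap_cover.continuous
    have h1 : Integrable ((cover '' k).indicator f) :=
      (integrable_indicator_iff hck.measurableSet).2 (hf.integrableOn_isCompact hck)
    have h2 : IntegrableOn ((cover '' k).indicator f ∘ cover) k volume :=
      IntegrableOn.mono_set (t := univ ×ˢ Ioc 0 (2 * Real.pi))
        (hmp.integrable_comp_of_integrable h1) (hk.trans hsub)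
    refine h2.congr_fun (fun y hy => ?_) hkc.measurableSet
    simp [mem_image_of_mem cover hy]
  have h1 := hU.ae_eq_zero_of_integral_contDiff_smul_eq_zero hloc ?_
  · have h2 : ∀ᵐ y ∂(volume.restrict (univ ×ˢ Ioc 0 (2 * Real.pi))), f (cover y) = 0 := by
      rw [ae_restrict_iff' hmeas]
      have h3 : ∀ᵐ y : ℝ × ℝ, y.2 ≠ 2 * Real.pi := by
        have : (volume : Measure (ℝ × ℝ)) {y | y.2 = 2 * Real.pi} = 0 := by
          have e : {y : ℝ × ℝ | y.2 = 2 * Real.pi} = univ ×ˢ {2 * Real.pi} := by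
            ext y; simp
          rw [e, Measure.volume_eq_prod, Measure.prod_prod]
          simp
        simpa [ae_iff] using this
      filter_upwards [h1, h3] with y hy hy3 hmem
      exact hy ⟨mem_univ _, hmem.2.1, lt_of_le_of_ne hmem.2.2 hy3⟩
    have h4 := hmp.quasiMeasurePreserving.ae_eq_comp hfm.ae_eq_mk
    have h5 : ∀ᵐ y ∂(volume.restrict (univ ×ˢ Ioc 0 (2 * Real.pi))), hfm.mk f (cover y) = 0 := by
      filter_upwards [h2, h4] with y hy hy'
      exact hy'.symm.trans hy
    have h6 : ∀ᵐ x, hfm.mk f x = 0 := by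
      have h7 := (ae_map_iff (p := fun x => hfm.mk f x = 0) hmp.measurable.aemeasurable ?_).2 h5
      · rwa [hmp.map_eq] at h7
      exact hfm.stronglyMeasurable_mk.measurable (measurableSet_singleton 0)
    filter_upwards [h6, hfm.ae_eq_mk] with x hx hx'
    simp [hx', hx]
  · intro g hg hgc hgs
    have ht := isTest_ofStrip hg hgc hgs
    have h2 := h _ ht
    rw [← hmp.map_eq, integral_map hmp.measurable.aemeasurable
      (by rw [hmp.map_eq]; exact ht.continuous.aestronglyMeasurable.smul hfm)] at h2
    rw [← h2, ← integral_indicator hmeas]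
    refine integral_congr_ae (Eventually.of_forall fun y => ?_)
    by_cases hy : y.2 ∈ Ioo 0 (2 * Real.pi)
    · have hy' : y ∈ (univ ×ˢ Ioc 0 (2 * Real.pi) : Set (ℝ × ℝ)) :=
        ⟨mem_univ _, Ioo_subset_Ioc_self hy⟩
      simp only [indicator_of_mem hy']
      rw [ofStrip_cover g (Ioo_subset_Ico_self hy)]
    · have h0 : g y = 0 := image_eq_zero_of_notMem_tsupport fun hh => hy (hgs hh).2
      by_cases hy' : y ∈ (univ ×ˢ Ioc 0 (2 * Real.pi) : Set (ℝ × ℝ))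
      · have e : y.2 = 2 * Real.pi := by
          by_contra hne
          exact hy ⟨hy'.2.1, lt_of_le_of_ne hy'.2.2 hne⟩
        have e2 : ofStrip g (cover y) = 0 := by
          rw [← cover_add_period y (-1)]
          rw [ofStrip_cover g (by simp [e, Real.pi_pos])]
          refine image_eq_zero_of_notMem_tsupport fun hh => ?_
          have := (hgs hh).2.1
          simp [e] at this
        simp [indicator_of_mem hy', h0, e2]
      · simp [indicator_of_notMem hy', h0]

/-! ### Translation of test functions and of weak derivatives -/

theorem cover_add (y z : ℝ × ℝ) : cover (y + z) = cover y + cover z := rfl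

theorem cover_surjective : Function.Surjective cover := isOpenQuotientMap_cover.surjective

theorem continuous_cover : Continuous cover := isOpenQuotientMap_cover.continuous

/-- The unit vector of a coordinate direction. -/
def dirV (j : Bool) : ℝ × ℝ := if j then (0, 1) else (1, 0)

theorem coordDeriv_cover {Ω : Set Cyl} {φ : Cyl → ℝ} (h : IsTest Ω φ) (j : Bool) (y : ℝ × ℝ) :
    coordDeriv j φ (cover y) = fderiv ℝ (fun y => φ (cover y)) y (dirV j) := by
  cases j
  · exact dt_cover h.smooth y
  · exact ds_cover h.smooth y

theorem IsTest.hasDerivAt {Ω : Set Cyl} {φ : Cyl → ℝ} (h : IsTest Ω φ) (j : Bool) (x : Cyl)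
    (r : ℝ) : HasDerivAt (fun r : ℝ => φ (x + cover (r • dirV j)))
      (coordDeriv j φ (x + cover (r • dirV j))) r := by
  obtain ⟨y, rfl⟩ := cover_surjective x
  simp only [← cover_add]
  rw [coordDeriv_cover h]
  have h1 : HasFDerivAt (fun y => φ (cover y)) (fderiv ℝ (fun y => φ (cover y)) (y + r • dirV j))
      (y + r • dirV j) := (h.smooth.differentiable (by simp) _).hasFDerivAt
  have h2 : HasDerivAt (fun r : ℝ => y + r • dirV j) (dirV j) r := by
    simpa using ((hasDerivAt_id r).smul_const (dirV j)).const_add y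
  exact h1.comp_hasDerivAt r h2

theorem coordDeriv_translate (j : Bool) (φ : Cyl → ℝ) (c x : Cyl) :
    coordDeriv j (fun x => φ (c + x)) x = coordDeriv j φ (c + x) := by
  cases j
  · simp only [coordDeriv, dt]
    exact deriv_comp_const_add (f := fun t => φ (t, (c + x).2)) c.1 x.1
  · simp only [coordDeriv, ds]
    congr 1
    ext h
    congr 1
    ext1
    · rfl
    · exact (add_assoc c.2 x.2 (h : S1)).symm

theorem IsTest.translate {Ω : Set Cyl} {φ : Cyl → ℝ} (h : IsTest Ω φ) (c : Cyl) :
    IsTest ((c + ·) ⁻¹' Ω) (fun x => φ (c + x)) := by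
  obtain ⟨y, rfl⟩ := cover_surjective c
  refine ⟨?_, h.compact.comp_homeomorph (Homeomorph.addLeft (cover y)), ?_⟩
  · simp only [← cover_add]
    exact h.smooth.comp (contDiff_const.add contDiff_id)
  · have := tsupport_comp_eq_preimage φ (Homeomorph.addLeft (cover y))
    have e : (φ ∘ (Homeomorph.addLeft (cover y))) = fun x => φ (cover y + x) := rfl
    rw [← e, this]
    exact preimage_mono h.subset

theorem locallyIntegrableOn_translate {n : ℕ} {Ω : Set Cyl} {f : Cyl → E n}
    (hf : LocallyIntegrableOn f Ω) (c : Cyl) :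
    LocallyIntegrableOn (fun x => f (c + x)) ((c + ·) ⁻¹' Ω) := by
  intro x hx
  obtain ⟨s, hs, hfs⟩ := hf (c + x) hx
  refine ⟨(c + ·) ⁻¹' s, ?_, ?_⟩
  · have : Tendsto (c + ·) (𝓝[(c + ·) ⁻¹' Ω] x) (𝓝[Ω] (c + x)) :=
      (continuous_const_add c).continuousAt.continuousWithinAt.tendsto_nhdsWithin
        (mapsTo_preimage _ _)
    exact this hs
  · exact ((measurePreserving_add_left volume c).integrableOn_comp_preimage
      (measurableEmbedding_addLeft c)).2 hfs

theorem HasWeakDeriv.translate {n : ℕ} {j : Bool} {Ω : Set Cyl} {f g : Cyl → E n}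
    (h : HasWeakDeriv (coordDeriv j) Ω f g) (c : Cyl) :
    HasWeakDeriv (coordDeriv j) ((c + ·) ⁻¹' Ω) (fun x => f (c + x)) (fun x => g (c + x)) := by
  refine ⟨locallyIntegrableOn_translate h.left c, locallyIntegrableOn_translate h.right c,
    fun φ hφ => ?_⟩
  have ht : IsTest Ω (fun x => φ (-c + x)) := by
    have := hφ.translate (-c)
    rwa [← preimage_comp, show ((c + ·) ∘ (-c + ·) : Cyl → Cyl) = id from by ext x <;> simp,
      preimage_id] at this
  have h1 := h.byParts _ ht
  simp only [coordDeriv_translate] at h1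
  have e := fun u : Cyl → E n => (measurePreserving_add_left volume c).setIntegral_preimage_emb
    (measurableEmbedding_addLeft c) u Ω
  rw [← e, ← e] at h1
  simpa using h1

/-! ### Pairing with test functions -/

section Pairing

variable {n : ℕ} {p : ℝ≥0∞} [Fact (1 ≤ p)]

/-- Hölder: a continuous function with compact support lies in the dual `L^q`, `q = (1 - p⁻¹)⁻¹`,
also for `p = 1` and `p = ∞`. Weak identities are thereby stable under `L^p` limits. -/
theorem exists_pairing (μ : Measure Cyl) [IsFiniteMeasureOnCompacts μ] {φ : Cyl → ℝ}
    (hφ : Continuous φ) (hc : HasCompactSupport φ) :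
    ∃ L : Lp (E n) p μ →L[ℝ] E n, ∀ V, L V = ∫ x, φ x • V x ∂μ := by
  have hp : (1 : ℝ≥0∞) ≤ p := Fact.out
  have hH : ENNReal.HolderConjugate p (1 - p⁻¹)⁻¹ := by
    have := ENNReal.HolderConjugate.inv_one_sub_inv (a := p⁻¹) (ENNReal.inv_le_one.2 hp)
    rwa [inv_inv] at this
  have h1 : Fact (1 ≤ (1 - p⁻¹)⁻¹) := ⟨ENNReal.one_le_inv.2 tsub_le_self⟩
  have hm : MemLp φ (1 - p⁻¹)⁻¹ μ := hφ.memLp_of_hasCompactSupport hc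
  refine ⟨((ContinuousLinearMap.lsmul ℝ ℝ (E := E n)).flip.lpPairing μ p (1 - p⁻¹)⁻¹).flip
    (hm.toLp φ), fun V => ?_⟩
  rw [ContinuousLinearMap.flip_apply, ContinuousLinearMap.lpPairing_eq_integral]
  refine integral_congr_ae ?_
  filter_upwards [hm.coeFn_toLp] with x hx
  simp [hx]

theorem Lp.locallyIntegrable {μ : Measure Cyl} [IsLocallyFiniteMeasure μ] (V : Lp (E n) p μ) :
    LocallyIntegrable V μ := (Lp.memLp V).locallyIntegrable Fact.out

theorem Lp.locallyIntegrableOn {Ω : Set Cyl} (V : Lp (E n) p (volume.restrict Ω)) :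
    LocallyIntegrableOn V Ω :=
  locallyIntegrableOn_of_locallyIntegrable_restrict (Lp.locallyIntegrable V)

theorem IsTest.hasCompactSupport_coordDeriv {Ω : Set Cyl} {φ : Cyl → ℝ} (hφ : IsTest Ω φ)
    (j : Bool) : HasCompactSupport (coordDeriv j φ) :=
  HasCompactSupport.intro hφ.compact (coordDeriv_spec hφ j).2

/-- For `L^p` functions local integrability is automatic, so membership amounts to integration by
parts: one closed linear condition for each test function. -/
theorem isClosed_sobolev (n k : ℕ) (p : ℝ≥0∞) [Fact (1 ≤ p)] (Ω : Set Cyl) :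
    IsClosed (sobolev n k p Ω :
      Set (PiLp p (fun _ : MIdx k => Lp (E n) p (volume.restrict Ω)))) := by
  have e : (sobolev n k p Ω : Set (PiLp p (fun _ : MIdx k => Lp (E n) p (volume.restrict Ω)))) =
      {v | ∀ (j : Bool) (α β : MIdx k), MIdx.Step j α β → ∀ φ, IsTest Ω φ →
        ∫ x in Ω, coordDeriv j φ x • v α x = - ∫ x in Ω, φ x • v β x} := by
    ext v
    exact ⟨fun h j α β hs => (h j α β hs).byParts, fun h j α β hs =>
      ⟨Lp.locallyIntegrableOn _, Lp.locallyIntegrableOn _, h j α β hs⟩⟩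
  rw [e]
  simp only [ofPred_forall]
  refine isClosed_iInter fun j => isClosed_iInter fun α => isClosed_iInter fun β =>
    isClosed_iInter fun _ => isClosed_iInter fun φ => isClosed_iInter fun hφ => ?_
  obtain ⟨L₁, h₁⟩ := exists_pairing (n := n) (p := p) (volume.restrict Ω)
    (coordDeriv_spec hφ j).1 (hφ.hasCompactSupport_coordDeriv j)
  obtain ⟨L₂, h₂⟩ := exists_pairing (n := n) (p := p) (volume.restrict Ω)
    hφ.continuous hφ.compact
  simp only [← h₁, ← h₂]
  refine isClosed_eq ?_ ?_
  · exact L₁.continuous.comp (PiLp.continuous_apply p _ α)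
  · exact (L₂.continuous.comp (PiLp.continuous_apply p _ β)).neg

instance (n k : ℕ) (p : ℝ≥0∞) [Fact (1 ≤ p)] (Ω : Set Cyl) : CompleteSpace (sobolev n k p Ω) :=
  (isClosed_sobolev n k p Ω).completeSpace_coe

/-! ### Differentiability of translations -/

/-- The derivative falls on the smooth test function, under the integral sign, and is then moved to
`V` by the definition of the weak derivative. -/
theorem hasDerivAt_pairing_translate {j : Bool} {V W : Lp (E n) p (volume : Measure Cyl)}
    (h : HasWeakDeriv (coordDeriv j) univ V W) {φ : Cyl → ℝ} (hφ : IsTest univ φ) (r : ℝ) :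
    HasDerivAt (fun r : ℝ => ∫ x, φ (x - cover (r • dirV j)) • V x)
      (∫ x, φ (x - cover (r • dirV j)) • W x) r := by
  have hcov : Continuous fun r : ℝ => cover (r • dirV j) :=
    continuous_cover.comp (by fun_prop)
  set D := coordDeriv j φ with hD
  obtain ⟨hDc, hD0⟩ := coordDeriv_spec hφ j
  have hDcs := hφ.hasCompactSupport_coordDeriv j
  -- `K` contains the supports of all translates of `φ` with parameter within distance `1` of `r`;
  -- it carries the dominating function.
  set K : Set Cyl := (fun q : Cyl × ℝ => q.1 + cover (q.2 • dirV j)) ''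
    (tsupport φ ×ˢ Metric.closedBall r 1) with hK
  have hKc : IsCompact K := (hφ.compact.isCompact.prod (isCompact_closedBall r 1)).image
    (continuous_fst.add (hcov.comp continuous_snd))
  obtain ⟨C, hC⟩ := hDcs.exists_bound_of_continuous hDc
  have hneg : ∀ (x : Cyl) (s : ℝ), x - cover (s • dirV j) = x + cover ((-s) • dirV j) := by
    intro x s
    have : cover ((-s) • dirV j) = - cover (s • dirV j) := by
      rw [neg_smul]; rfl
    rw [this, sub_eq_add_neg]
  have hd : ∀ (x : Cyl) (s : ℝ), HasDerivAt (fun s : ℝ => φ (x - cover (s • dirV j)))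
      (-D (x - cover (s • dirV j))) s := by
    intro x s
    have h1 := (hφ.hasDerivAt j x (-s)).scomp s (hasDerivAt_neg s)
    simp only [hneg]
    simpa [Function.comp_def] using h1
  have hint : ∀ (ψ : Cyl → ℝ), Continuous ψ → HasCompactSupport ψ → ∀ s : ℝ,
      Integrable (fun x => ψ (x - cover (s • dirV j)) • V x) := by
    intro ψ hψ hψc s
    refine (Lp.locallyIntegrable V).integrable_smul_left_of_hasCompactSupport ?_ ?_
    · exact hψ.comp (continuous_id.sub continuous_const)
    · simp only [sub_eq_add_neg]
      exact hψc.comp_homeomorph (Homeomorph.addRight (-cover (s • dirV j)))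
  have key := (hasDerivAt_integral_of_dominated_loc_of_deriv_le (μ := (volume : Measure Cyl))
    (F := fun (s : ℝ) x => φ (x - cover (s • dirV j)) • V x)
    (F' := fun (s : ℝ) x => (-D (x - cover (s • dirV j))) • V x) (x₀ := r)
    (bound := fun x => C * K.indicator (fun x => ‖V x‖) x)
    (Metric.closedBall_mem_nhds r one_pos)
    (Eventually.of_forall fun s => (hint φ hφ.continuous hφ.compact s).aestronglyMeasurable)
    (hint φ hφ.continuous hφ.compact r)
    (by
      have := (hint D hDc hDcs r).aestronglyMeasurable.neg
      refine this.congr (Eventually.of_forall fun x => ?_)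
      simp)
    (Eventually.of_forall fun x s hs => by
      rw [norm_smul, norm_neg]
      by_cases hx : x ∈ K
      · rw [indicator_of_mem hx]
        gcongr
        exact hC _
      · have : D (x - cover (s • dirV j)) = 0 := by
          refine hD0 _ fun hmem => hx ⟨(x - cover (s • dirV j), s), ⟨hmem, hs⟩, ?_⟩
          simp
        simp [this, indicator_of_notMem hx])
    (((integrable_indicator_iff hKc.measurableSet).2
      ((Lp.locallyIntegrable V).integrableOn_isCompact hKc).norm).const_mul C)
    (Eventually.of_forall fun x s _ => (hd x s).smul_const (V x))).2
  have e : ∫ x, (-D (x - cover (r • dirV j))) • V x = ∫ x, φ (x - cover (r • dirV j)) • W x := by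
    have ht := hφ.translate (-cover (r • dirV j))
    have h1 := h.byParts _ ht
    simp only [Measure.restrict_univ, coordDeriv_translate] at h1
    simp only [neg_smul, integral_neg, sub_eq_neg_add]
    rw [h1, neg_neg]
  rw [e] at key
  exact key

variable [Fact (p ≠ ⊤)]

/-- The integral exists in `L^p` by strong continuity of translations. Paired with a test function,
the identity is the fundamental theorem of calculus, and test functions separate `L^p` functions. -/
theorem transL_eq_add_integral {j : Bool} {V W : Lp (E n) p (volume : Measure Cyl)}
    (h : HasWeakDeriv (coordDeriv j) univ V W) (r : ℝ) :
    transL (cover (r • dirV j)) V = V + ∫ s in (0 : ℝ)..r, transL (cover (s • dirV j)) W := by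
  have hcov : Continuous fun r : ℝ => cover (r • dirV j) := continuous_cover.comp (by fun_prop)
  have hcont : Continuous fun s : ℝ => transL (cover (s • dirV j)) W :=
    (continuous_transL W).comp hcov
  rw [← sub_eq_zero]
  set U := transL (cover (r • dirV j)) V -
    (V + ∫ s in (0 : ℝ)..r, transL (cover (s • dirV j)) W) with hU
  have : (U : Cyl → E n) =ᵐ[volume] 0 := by
    refine ae_eq_zero_of_integral_test (Lp.locallyIntegrable U) fun φ hφ => ?_
    obtain ⟨L, hL⟩ := exists_pairing (n := n) (p := p) (volume : Measure Cyl)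
      hφ.continuous hφ.compact
    have hLt : ∀ (s : ℝ) (Q : Lp (E n) p (volume : Measure Cyl)),
        L (transL (cover (s • dirV j)) Q) = ∫ x, φ (x - cover (s • dirV j)) • Q x := by
      intro s Q
      rw [hL, ← integral_add_left_eq_self (fun x => φ (x - cover (s • dirV j)) • Q x)
        (cover (s • dirV j))]
      refine integral_congr_ae ?_
      filter_upwards [coeFn_transL (cover (s • dirV j)) Q] with x hx
      simp [hx]
    rw [← hL, hU, map_sub, map_add, ← L.intervalIntegral_comp_comm (hcont.intervalIntegrable _ _)]
    have h1 : ∫ s in (0 : ℝ)..r, L (transL (cover (s • dirV j)) W) =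
        L (transL (cover (r • dirV j)) V) - L (transL (cover ((0 : ℝ) • dirV j)) V) := by
      refine intervalIntegral.integral_eq_sub_of_hasDerivAt
        (f := fun s : ℝ => L (transL (cover (s • dirV j)) V)) (fun s _ => ?_)
        ((L.continuous.comp hcont).intervalIntegrable _ _)
      simp only [hLt]
      exact hasDerivAt_pairing_translate h hφ s
    rw [h1, zero_smul, show cover 0 = 0 from rfl, transL_zero]
    abel
  exact Lp.ext (this.trans (Lp.coeFn_zero _ _ _).symm)

theorem hasDerivAt_transL {j : Bool} {V W : Lp (E n) p (volume : Measure Cyl)}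
    (h : HasWeakDeriv (coordDeriv j) univ V W) (a : Cyl) (r : ℝ) :
    HasDerivAt (fun r : ℝ => transL (a + cover (r • dirV j)) V)
      (transL (a + cover (r • dirV j)) W) r := by
  have hcov : Continuous fun r : ℝ => cover (r • dirV j) := continuous_cover.comp (by fun_prop)
  have hcont : Continuous fun s : ℝ => transL (cover (s • dirV j)) W :=
    (continuous_transL W).comp hcov
  simp only [transL_add]
  refine (transL a : Lp (E n) p (volume : Measure Cyl) →L[ℝ] _).hasFDerivAt.comp_hasDerivAt r ?_
  simp only [transL_eq_add_integral h]
  exact (hcont.integral_hasStrictDerivAt 0 r).hasDerivAt.const_add V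

/-- Translations of an `Lᵖ` function with weak derivatives in `Lᵖ` are differentiable. -/
theorem hasFDerivAt_transL {V Vt Vs : Lp (E n) p (volume : Measure Cyl)}
    (ht : HasWeakDeriv (coordDeriv false) univ V Vt)
    (hs : HasWeakDeriv (coordDeriv true) univ V Vs) (a : Cyl) (y : ℝ × ℝ) :
    HasFDerivAt (fun y => transL (a + cover y) V)
      ((ContinuousLinearMap.fst ℝ ℝ ℝ).smulRight (transL (a + cover y) Vt) +
        (ContinuousLinearMap.snd ℝ ℝ ℝ).smulRight (transL (a + cover y) Vs)) y := by
  have hcont : ∀ W : Lp (E n) p (volume : Measure Cyl),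
      Continuous fun y => transL (a + cover y) W := fun W =>
    (continuous_transL W).comp (continuous_const.add continuous_cover)
  have e1 : ∀ (r s : ℝ), a + cover (r, s) = (a + cover (0, s)) + cover (r • dirV false) := by
    intro r s
    rw [add_assoc, ← cover_add]
    simp [dirV]
  have e2 : ∀ (r s : ℝ), a + cover (r, s) = (a + cover (r, 0)) + cover (s • dirV true) := by
    intro r s
    rw [add_assoc, ← cover_add]
    simp [dirV]
  -- Both partial derivatives are continuous in the parameters, again by strong continuity, so the
  -- translates are jointly differentiable.
  have key := (hasStrictFDerivAt_uncurry_coprod (𝕜 := ℝ) (u := y)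
    (f := fun r s => transL (a + cover (r, s)) V)
    (f₁ := fun r s => ContinuousLinearMap.toSpanSingleton ℝ (transL (a + cover (r, s)) Vt))
    (f₂ := fun r s => ContinuousLinearMap.toSpanSingleton ℝ (transL (a + cover (r, s)) Vs))
    (Eventually.of_forall fun v => by
      have := (hasDerivAt_transL ht (a + cover (0, v.2)) v.1).hasFDerivAt
      simp only [← e1] at this
      exact this)
    (Eventually.of_forall fun v => by
      have := (hasDerivAt_transL hs (a + cover (v.1, 0)) v.2).hasFDerivAt
      simp only [← e2] at this
      exact this)
    ((ContinuousLinearMap.toSpanSingletonCLE (𝕜 := ℝ)).continuous.comp (hcont Vt)).continuousAt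
    ((ContinuousLinearMap.toSpanSingletonCLE (𝕜 := ℝ)).continuous.comp
      (hcont Vs)).continuousAt).hasFDerivAt
  refine key.congr_fderiv ?_
  ext <;> simp [Function.HasUncurry.uncurry]

end Pairing

/-! ### Products with functions of `t` -/

variable {n : ℕ}

theorem HasWeakDeriv.congr_ae {j : Bool} {Ω : Set Cyl} {f g f' g' : Cyl → E n}
    (h : HasWeakDeriv (coordDeriv j) Ω f g)
    (hf : f' =ᵐ[volume.restrict Ω] f) (hg : g' =ᵐ[volume.restrict Ω] g) :
    HasWeakDeriv (coordDeriv j) Ω f' g' := by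
  have hloc : ∀ u u' : Cyl → E n, u' =ᵐ[volume.restrict Ω] u → LocallyIntegrableOn u Ω →
      LocallyIntegrableOn u' Ω := by
    intro u u' he hu x hx
    obtain ⟨s, hs, hus⟩ := hu x hx
    refine ⟨s ∩ Ω, inter_mem hs self_mem_nhdsWithin, ?_⟩
    refine (hus.mono_set inter_subset_left).congr_fun_ae ?_
    exact ae_restrict_of_ae_restrict_of_subset inter_subset_right he.symm
  refine ⟨hloc _ _ hf h.left, hloc _ _ hg h.right, fun φ hφ => ?_⟩
  rw [integral_congr_ae (g := fun x => coordDeriv j φ x • f x)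
      (by filter_upwards [hf] with x hx; rw [hx]),
    integral_congr_ae (f := fun x => φ x • g' x) (g := fun x => φ x • g x)
      (by filter_upwards [hg] with x hx; rw [hx])]
  exact h.byParts φ hφ

theorem HasWeakDeriv.sum {j : Bool} {Ω : Set Cyl} {ι : Type*} (s : Finset ι)
    {f g : ι → Cyl → E n} (h : ∀ i ∈ s, HasWeakDeriv (coordDeriv j) Ω (f i) (g i)) :
    HasWeakDeriv (coordDeriv j) Ω (∑ i ∈ s, f i) (∑ i ∈ s, g i) := by
  classical
  induction s using Finset.induction_on with
  | empty => simpa using hasWeakDeriv_zero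
  | insert a s ha ih =>
    rw [Finset.sum_insert ha, Finset.sum_insert ha]
    exact (h a (Finset.mem_insert_self a s)).add
      (ih fun i hi => h i (Finset.mem_insert_of_mem hi))

theorem HasWeakDeriv.nsmul {j : Bool} {Ω : Set Cyl} {f g : Cyl → E n}
    (h : HasWeakDeriv (coordDeriv j) Ω f g) (m : ℕ) :
    HasWeakDeriv (coordDeriv j) Ω (m • f) (m • g) := by
  have := h.const_smul (m : ℝ)
  simpa only [Nat.cast_smul_eq_nsmul] using this

theorem integrableOn_smul_of_isCompact {Ω K : Set Cyl} (hK : IsCompact K) (hKΩ : K ⊆ Ω)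
    {c : Cyl → ℝ} (hc : Continuous c) (h0 : ∀ x, x ∉ K → c x = 0) {f : Cyl → E n}
    (hf : LocallyIntegrableOn f Ω) : IntegrableOn (fun x => c x • f x) Ω := by
  have h2 : IntegrableOn (fun x => c x • f x) K :=
    (hf.integrableOn_compact_subset hKΩ hK).continuousOn_smul hc.continuousOn hK
  refine Integrable.integrableOn ?_
  refine (integrableOn_iff_integrable_of_support_subset ?_).1 h2
  intro x hx
  by_contra hn
  exact hx (by simp [h0 x hn])

/-- A point over `T` has a compact neighbourhood inside `Ω`; near any other point the function is
zero. So the boundary of `Ω` causes no trouble. -/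
theorem locallyIntegrableOn_indicator_smul {Ω Ω' : Set Cyl} (hΩ : IsOpen Ω) {c : ℝ → ℝ}
    (hc : Continuous c) {T : Set ℝ} (hT : IsClosed T) (h0 : ∀ t, t ∉ T → c t = 0)
    (hs : ∀ x ∈ Ω', x.1 ∈ T → x ∈ Ω) {f : Cyl → E n} (hf : LocallyIntegrableOn f Ω) :
    LocallyIntegrableOn (Ω.indicator fun x => c x.1 • f x) Ω' := by
  intro x hx
  by_cases hxT : x.1 ∈ T
  · obtain ⟨K, hK, hKs, hKc⟩ := local_compact_nhds (hΩ.mem_nhds (hs x hx hxT))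
    refine ⟨K, mem_nhdsWithin_of_mem_nhds hK, ?_⟩
    refine IntegrableOn.indicator ?_ hΩ.measurableSet
    exact (hf.integrableOn_compact_subset hKs hKc).continuousOn_smul
      (hc.comp continuous_fst).continuousOn hKc
  · refine ⟨Prod.fst ⁻¹' Tᶜ, mem_nhdsWithin_of_mem_nhds
      ((hT.isOpen_compl.preimage continuous_fst).mem_nhds hxT), ?_⟩
    refine (integrableOn_zero (ε' := E n)).congr_fun (fun y hy => ?_)
      (hT.isOpen_compl.preimage continuous_fst).measurableSet
    have h1 : c y.1 = 0 := h0 y.1 hy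
    by_cases hyΩ : y ∈ Ω <;> simp [hyΩ, h1]

/-- The derivative of a function of `t` in a coordinate direction. -/
def dcoef (j : Bool) (ψ : ℝ → ℝ) (t : ℝ) : ℝ := if j then 0 else deriv ψ t

theorem isTest_mul {Ω Ω' : Set Cyl} {φ : Cyl → ℝ} (hφ : IsTest Ω' φ) {ψ : ℝ → ℝ}
    (hψ : ContDiff ℝ ∞ ψ) (hs : ∀ x ∈ Ω', x.1 ∈ tsupport ψ → x ∈ Ω) :
    IsTest Ω (fun x => φ x * ψ x.1) := by
  refine ⟨hφ.smooth.mul (hψ.comp contDiff_fst), hφ.compact.mul_right, fun x hx => ?_⟩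
  have h1 : x ∈ tsupport φ := tsupport_mul_subset_left hx
  refine hs x (hφ.subset h1) ?_
  have h2 : x ∈ tsupport (fun x : Cyl => ψ x.1) := tsupport_mul_subset_right hx
  exact tsupport_comp_subset_preimage ψ continuous_fst h2

theorem coordDeriv_mul {Ω Ω' : Set Cyl} {φ : Cyl → ℝ} (hφ : IsTest Ω' φ) {ψ : ℝ → ℝ}
    (hψ : ContDiff ℝ ∞ ψ) (hs : ∀ x ∈ Ω', x.1 ∈ tsupport ψ → x ∈ Ω) (j : Bool) (x : Cyl) :
    coordDeriv j (fun x => φ x * ψ x.1) x =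
      coordDeriv j φ x * ψ x.1 + φ x * dcoef j ψ x.1 := by
  have h1 := (isTest_mul hφ hψ hs).hasDerivAt j x 0
  have h2 := hφ.hasDerivAt j x 0
  have h3 : HasDerivAt (fun r : ℝ => ψ (x + cover (r • dirV j)).1) (dcoef j ψ x.1) 0 := by
    cases j
    · have h4 : HasDerivAt (fun r : ℝ => x.1 + r) 1 0 := (hasDerivAt_id 0).const_add x.1
      have h5 : HasDerivAt ψ (deriv ψ x.1) (x.1 + 0) := by
        rw [add_zero]
        exact (hψ.differentiable (by simp) x.1).hasDerivAt
      simpa [dcoef, dirV, cover, Function.comp_def] using h5.comp 0 h4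
    · simpa [dcoef, dirV, cover] using hasDerivAt_const (0 : ℝ) (ψ x.1)
  have h4 := h1.unique (h2.mul h3)
  have e : cover ((0 : ℝ) • dirV j) = 0 := by rw [zero_smul]; rfl
  simpa only [e, add_zero] using h4

/-- Leibniz rule for the product with a function of `t`, combined with an extension by zero. -/
theorem HasWeakDeriv.mul_indicator {j : Bool} {Ω Ω' : Set Cyl} (hΩ : IsOpen Ω)
    {f g : Cyl → E n} (h : HasWeakDeriv (coordDeriv j) Ω f g) {ψ : ℝ → ℝ} (hψ : ContDiff ℝ ∞ ψ)
    (hs : ∀ x ∈ Ω', x.1 ∈ tsupport ψ → x ∈ Ω) :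
    HasWeakDeriv (coordDeriv j) Ω' (Ω.indicator fun x => ψ x.1 • f x)
      (Ω.indicator fun x => dcoef j ψ x.1 • f x + ψ x.1 • g x) := by
  have hdc : Continuous (dcoef j ψ) := by
    cases j
    · exact hψ.continuous_deriv (by simp)
    · exact continuous_const
  have h0 : ∀ t, t ∉ tsupport ψ → ψ t = 0 := fun t ht => image_eq_zero_of_notMem_tsupport ht
  have h0' : ∀ t, t ∉ tsupport ψ → dcoef j ψ t = 0 := by
    intro t ht
    cases j
    · by_contra hne
      exact ht (support_deriv_subset hne)
    · rfl
  have e : (Ω.indicator fun x => dcoef j ψ x.1 • f x + ψ x.1 • g x) =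
      (Ω.indicator fun x => dcoef j ψ x.1 • f x) + Ω.indicator fun x => ψ x.1 • g x := by
    exact indicator_add _ _ _
  refine ⟨locallyIntegrableOn_indicator_smul hΩ hψ.continuous (isClosed_tsupport ψ) h0 hs h.left,
    ?_, fun φ hφ => ?_⟩
  · rw [e]
    exact (locallyIntegrableOn_indicator_smul hΩ hdc (isClosed_tsupport ψ) h0' hs h.left).add
      (locallyIntegrableOn_indicator_smul hΩ hψ.continuous (isClosed_tsupport ψ) h0 hs h.right)
  obtain ⟨hDc, hD0⟩ := coordDeriv_spec hφ j
  set K : Set Cyl := tsupport φ ∩ Prod.fst ⁻¹' tsupport ψ with hK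
  have hKc : IsCompact K :=
    hφ.compact.isCompact.inter_right ((isClosed_tsupport ψ).preimage continuous_fst)
  have hKΩ : K ⊆ Ω := fun x hx => hs x (hφ.subset hx.1) hx.2
  -- Coefficients that vanish off the support of `φ` allow `Ω'` to be traded for `Ω`, the indicator
  -- absorbing the difference.
  have hswap : ∀ (c : Cyl → ℝ) (u : Cyl → E n), (∀ x, x ∉ tsupport φ → c x = 0) →
      ∫ x in Ω', c x • Ω.indicator u x = ∫ x in Ω, c x • u x := by
    intro c u hc
    rw [setIntegral_eq_integral_of_forall_compl_eq_zero (fun x hx => ?_),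
      ← integral_indicator hΩ.measurableSet]
    · congr 1
      ext1 x
      by_cases hx : x ∈ Ω <;> simp [hx]
    · rw [hc x fun hh => hx (hφ.subset hh), zero_smul]
  rw [hswap _ _ hD0, hswap _ _ fun x hx => image_eq_zero_of_notMem_tsupport hx]
  have hφ0 : ∀ x, x ∉ tsupport φ → φ x = 0 := fun x hx => image_eq_zero_of_notMem_tsupport hx
  have hK0 : ∀ (c : Cyl → ℝ) (d : ℝ → ℝ), (∀ x, x ∉ tsupport φ → c x = 0) →
      (∀ t, t ∉ tsupport ψ → d t = 0) → ∀ x, x ∉ K → c x * d x.1 = 0 := by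
    intro c d hc hd x hx
    by_cases h1 : x ∈ tsupport φ
    · rw [hd x.1 fun h2 => hx ⟨h1, h2⟩, mul_zero]
    · rw [hc x h1, zero_mul]
  have i1 := integrableOn_smul_of_isCompact hKc hKΩ (hDc.mul (hψ.continuous.comp continuous_fst))
    (hK0 _ _ hD0 h0) h.left
  have i2 := integrableOn_smul_of_isCompact hKc hKΩ
    (hφ.continuous.mul (hdc.comp continuous_fst)) (hK0 _ _ hφ0 h0') h.left
  have i3 := integrableOn_smul_of_isCompact hKc hKΩ
    (hφ.continuous.mul (hψ.continuous.comp continuous_fst)) (hK0 _ _ hφ0 h0) h.right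
  -- `φ ψ` is a test function on `Ω`, and the term of its derivative that contains `ψ'` is the extra
  -- term of the Leibniz rule.
  have key := h.byParts _ (isTest_mul hφ hψ hs)
  simp only [coordDeriv_mul hφ hψ hs, add_smul] at key
  simp only [Pi.mul_apply, Function.comp_apply] at i1 i2 i3
  rw [integral_add i1 i2] at key
  simp only [smul_add, smul_smul]
  rw [integral_add i2 i3, neg_add, ← key]
  abel

/-! ### Families of derivatives -/

/-- The family `(v i j)` consists of a function and its weak derivatives `∂_t^i ∂_s^j`, up to the
order `k`. -/
def IsFam (k : ℕ) (Ω : Set Cyl) (v : ℕ → ℕ → Cyl → E n) : Prop :=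
  ∀ (d : Bool) (i j : ℕ), i + j + 1 ≤ k → HasWeakDeriv (coordDeriv d) Ω (v i j)
    (v (i + if d then 0 else 1) (j + if d then 1 else 0))

theorem IsFam.mono {k k' : ℕ} {Ω : Set Cyl} {v : ℕ → ℕ → Cyl → E n} (h : IsFam k Ω v)
    (hk : k' ≤ k) : IsFam k' Ω v := fun d i j hij => h d i j (hij.trans hk)

theorem IsFam.add {k : ℕ} {Ω : Set Cyl} {v w : ℕ → ℕ → Cyl → E n} (hv : IsFam k Ω v)
    (hw : IsFam k Ω w) : IsFam k Ω (fun i j => v i j + w i j) :=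
  fun d i j hij => (hv d i j hij).add (hw d i j hij)

theorem IsFam.const_smul {k : ℕ} {Ω : Set Cyl} {v : ℕ → ℕ → Cyl → E n} (hv : IsFam k Ω v)
    (c : ℝ) : IsFam k Ω (fun i j => c • v i j) :=
  fun d i j hij => (hv d i j hij).const_smul c

theorem IsFam.dt {k : ℕ} {Ω : Set Cyl} {v : ℕ → ℕ → Cyl → E n} (hv : IsFam (k + 1) Ω v) :
    IsFam k Ω (fun i j => v (i + 1) j) := by
  intro d i j hij
  have := hv d (i + 1) j (by omega)
  rwa [add_right_comm] at this

theorem IsFam.translate {k : ℕ} {Ω : Set Cyl} {v : ℕ → ℕ → Cyl → E n} (hv : IsFam k Ω v)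
    (c : Cyl) : IsFam k ((c + ·) ⁻¹' Ω) (fun i j x => v i j (c + x)) :=
  fun d i j hij => (hv d i j hij).translate c

theorem IsFam.congr_ae {k : ℕ} {Ω : Set Cyl} {v w : ℕ → ℕ → Cyl → E n}
    (hv : IsFam k Ω v) (h : ∀ i j, i + j ≤ k → w i j =ᵐ[volume.restrict Ω] v i j) :
    IsFam k Ω w := by
  intro d i j hij
  refine (hv d i j hij).congr_ae (h i j (by omega)) (h _ _ ?_)
  cases d <;> simp <;> omega

/-- The derivatives of a product `ψ(t) v`, by the Leibniz rule. -/
def leib (ψ : ℝ → ℝ) (v : ℕ → ℕ → Cyl → E n) (i j : ℕ) (x : Cyl) : E n :=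
  ∑ a ∈ Finset.HasAntidiagonal.antidiagonal i, i.choose a.1 • iteratedDeriv a.1 ψ x.1 • v a.2 j x

theorem contDiff_iteratedDeriv {ψ : ℝ → ℝ} (hψ : ContDiff ℝ ∞ ψ) (m : ℕ) :
    ContDiff ℝ ∞ (iteratedDeriv m ψ) := by
  induction m with
  | zero => simpa using hψ
  | succ m ih =>
    rw [iteratedDeriv_succ]
    exact (contDiff_infty_iff_deriv.1 ih).2

theorem tsupport_iteratedDeriv_subset (ψ : ℝ → ℝ) (m : ℕ) :
    tsupport (iteratedDeriv m ψ) ⊆ tsupport ψ := by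
  induction m with
  | zero => simp
  | succ m ih =>
    rw [iteratedDeriv_succ]
    exact (closure_minimal support_deriv_subset (isClosed_tsupport _)).trans ih

/-- A further `t`-derivative of a Leibniz sum is again a Leibniz sum, by Pascal's rule; an
`s`-derivative does not see `ψ`. -/
theorem IsFam.mul_indicator {k : ℕ} {Ω Ω' : Set Cyl} (hΩ : IsOpen Ω) {v : ℕ → ℕ → Cyl → E n}
    (hv : IsFam k Ω v) {ψ : ℝ → ℝ} (hψ : ContDiff ℝ ∞ ψ)
    (hs : ∀ x ∈ Ω', x.1 ∈ tsupport ψ → x ∈ Ω) :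
    IsFam k Ω' (fun i j => Ω.indicator (leib ψ v i j)) := by
  intro d i j hij
  have h1 : ∀ a ∈ Finset.HasAntidiagonal.antidiagonal i, HasWeakDeriv (coordDeriv d) Ω'
      (i.choose a.1 • Ω.indicator fun x => iteratedDeriv a.1 ψ x.1 • v a.2 j x)
      (i.choose a.1 • Ω.indicator fun x => dcoef d (iteratedDeriv a.1 ψ) x.1 • v a.2 j x +
        iteratedDeriv a.1 ψ x.1 • v (a.2 + if d then 0 else 1) (j + if d then 1 else 0) x) := by
    intro a ha
    have ha' : a.1 + a.2 = i := Finset.HasAntidiagonal.mem_antidiagonal.1 ha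
    exact ((hv d a.2 j (by omega)).mul_indicator hΩ (contDiff_iteratedDeriv hψ a.1)
      fun x hx hx' => hs x hx (tsupport_iteratedDeriv_subset ψ a.1 hx')).nsmul _
  have h2 := HasWeakDeriv.sum _ h1
  convert h2 using 1
  · ext1 x
    by_cases hx : x ∈ Ω <;> simp [hx, leib, Finset.sum_apply]
  · ext1 x
    by_cases hx : x ∈ Ω
    · simp only [hx, indicator_of_mem, Finset.sum_apply, Pi.smul_apply, leib]
      cases d
      · simp only [Bool.false_eq_true, if_false, dcoef, add_zero, smul_add,
          Finset.sum_add_distrib]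
        rw [Finset.sum_antidiagonal_choose_succ_nsmul
          (fun a b => iteratedDeriv a ψ x.1 • v b j x), add_comm]
        congr 1
        refine Finset.sum_congr rfl fun a ha => ?_
        rw [iteratedDeriv_succ, Nat.choose_symm_of_eq_add (Finset.HasAntidiagonal.mem_antidiagonal.1 ha).symm]
      · simp [dcoef]
    · simp [hx, Finset.sum_apply]

/-! ### Coefficients -/

open scoped BoundedContinuousFunction

/-- A bounded continuous function, as an element of the Banach space of these. -/
def toBCF (f : ℝ → ℝ) (hf : Continuous f) {C : ℝ} (hC : ∀ t, |f t| ≤ C) : ℝ →ᵇ ℝ :=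
  BoundedContinuousFunction.ofNormedAddCommGroup f hf C hC

/-- The mean value inequality holds at every `t` with the same constant, so pointwise information
becomes continuity in the sup norm. -/
theorem continuousAt_bcf_of_hasDerivAt {Q Q' : ℝ → ℝ →ᵇ ℝ} {R₀ C : ℝ}
    (hQ : ∀ᶠ R in 𝓝 R₀, ∀ t, HasDerivAt (fun R => Q R t) (Q' R t) R)
    (hC : ∀ᶠ R in 𝓝 R₀, ‖Q' R‖ ≤ C) : ContinuousAt Q R₀ := by
  obtain ⟨ρ, hρ, hball⟩ := Metric.eventually_nhds_iff_ball.1 (hQ.and hC)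
  have hC0 : 0 ≤ C := (norm_nonneg _).trans (hball R₀ (Metric.mem_ball_self hρ)).2
  rw [ContinuousAt, tendsto_iff_norm_sub_tendsto_zero]
  refine squeeze_zero' (g := fun R => C * ‖R - R₀‖)
    (Eventually.of_forall fun _ => norm_nonneg _) ?_ ?_
  · filter_upwards [Metric.ball_mem_nhds R₀ hρ] with R hR
    refine (BoundedContinuousFunction.norm_le (by positivity)).2 fun t => ?_
    exact (convex_ball R₀ ρ).norm_image_sub_le_of_norm_hasDerivWithin_le
      (f := fun R => Q R t) (f' := fun R => Q' R t)
      (fun x hx => ((hball x hx).1 t).hasDerivWithinAt)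
      (fun x hx => ((Q' x).norm_coe_le_norm t).trans (hball x hx).2) (Metric.mem_ball_self hρ) hR
  · have : Continuous fun R : ℝ => C * ‖R - R₀‖ := by fun_prop
    simpa using this.tendsto R₀

/-- The mean value inequality for `Q R t - R * Q' R₀ t` is uniform in `t` because `Q'` is continuous
in the sup norm. -/
theorem hasDerivAt_bcf {Q Q' : ℝ → ℝ →ᵇ ℝ} {R₀ : ℝ}
    (hQ : ∀ᶠ R in 𝓝 R₀, ∀ t, HasDerivAt (fun R => Q R t) (Q' R t) R)
    (hc : ContinuousAt Q' R₀) : HasDerivAt Q (Q' R₀) R₀ := by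
  rw [hasDerivAt_iff_isLittleO, Asymptotics.isLittleO_iff]
  intro c hcpos
  have h1 : ∀ᶠ R in 𝓝 R₀, ‖Q' R - Q' R₀‖ < c := by
    rw [ContinuousAt, tendsto_iff_norm_sub_tendsto_zero] at hc
    exact hc.eventually (gt_mem_nhds hcpos)
  obtain ⟨ρ, hρ, hball⟩ := Metric.eventually_nhds_iff_ball.1 (hQ.and h1)
  filter_upwards [Metric.ball_mem_nhds R₀ hρ] with R hR
  refine (BoundedContinuousFunction.norm_le (by positivity)).2 fun t => ?_
  have h2 := (convex_ball R₀ ρ).norm_image_sub_le_of_norm_hasDerivWithin_le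
      (f := fun R => Q R t - R * Q' R₀ t) (f' := fun R => Q' R t - Q' R₀ t) (C := c)
      (fun x hx => by
        have := ((hball x hx).1 t).sub ((hasDerivAt_id x).mul_const (Q' R₀ t))
        rw [one_mul] at this
        exact this.hasDerivWithinAt)
      (fun x hx => ((Q' x - Q' R₀).norm_coe_le_norm t).trans (hball x hx).2.le)
      (Metric.mem_ball_self hρ) hR
  refine (le_of_eq ?_).trans h2
  congr 1
  simp
  ring

/-! ### Bumps rescaled by the length function. -/

/-- Smooth functions with support in `[-1, 1]`. -/
structure IsBump (φ : ℝ → ℝ) : Prop where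
  smooth : ContDiff ℝ ∞ φ
  zero : ∀ y, 1 < |y| → φ y = 0

theorem IsBump.deriv {φ : ℝ → ℝ} (h : IsBump φ) : IsBump (deriv φ) := by
  refine ⟨(contDiff_infty_iff_deriv.1 h.smooth).2, fun y hy => ?_⟩
  have : φ =ᶠ[𝓝 y] fun _ => 0 := by
    filter_upwards [(isOpen_lt continuous_const continuous_abs).mem_nhds hy] with x hx
      using h.zero x hx
  simp [this.deriv_eq]

theorem IsBump.mul {φ ψ : ℝ → ℝ} (h : IsBump φ) (hψ : ContDiff ℝ ∞ ψ) :
    IsBump (fun y => ψ y * φ y) :=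
  ⟨hψ.mul h.smooth, fun y hy => by simp [h.zero y hy]⟩

theorem IsBump.add {φ ψ : ℝ → ℝ} (h : IsBump φ) (h' : IsBump ψ) :
    IsBump (fun y => φ y + ψ y) :=
  ⟨h.smooth.add h'.smooth, fun y hy => by simp [h.zero y hy, h'.zero y hy]⟩

theorem IsBump.exists_bound {φ : ℝ → ℝ} (h : IsBump φ) : ∃ C, 0 ≤ C ∧ ∀ y, |φ y| ≤ C := by
  have hc : HasCompactSupport φ := HasCompactSupport.intro (isCompact_Icc (a := -1) (b := 1))
    fun y hy => h.zero y (not_le.1 fun hh => hy (abs_le.1 hh))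
  obtain ⟨C, hC⟩ := hc.exists_bound_of_continuous h.smooth.continuous
  exact ⟨C, (norm_nonneg _).trans (hC 0), hC⟩

/-- The reciprocal of the length function. -/
def lam (R : ℝ) : ℝ := (lengthFn R)⁻¹

/-- The logarithmic derivative of `lam`. -/
def dlogLam (R : ℝ) : ℝ := -(1 / (2 * R) + 2 / (R * Real.log R))

theorem lengthFn_pos {R : ℝ} (hR : 1 < R) : 0 < lengthFn R :=
  mul_pos (Real.sqrt_pos.2 (zero_lt_one.trans hR)) (pow_pos (Real.log_pos hR) 2)

theorem lam_pos {R : ℝ} (hR : 1 < R) : 0 < lam R := inv_pos.2 (lengthFn_pos hR)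

theorem hasDerivAt_lam {R : ℝ} (hR : 1 < R) : HasDerivAt lam (dlogLam R * lam R) R := by
  have h0 : 0 < R := zero_lt_one.trans hR
  have hl := Real.log_pos hR
  have h1 : HasDerivAt lengthFn
      (1 / (2 * √R) * Real.log R ^ 2 + √R * (2 * Real.log R * R⁻¹)) R := by
    have := (Real.hasDerivAt_sqrt h0.ne').mul ((Real.hasDerivAt_log h0.ne').pow 2)
    refine HasDerivAt.congr_deriv (f := lengthFn) this ?_
    simp
  have h2 := h1.inv (lengthFn_pos hR).ne'
  refine HasDerivAt.congr_deriv (f := lam) h2 ?_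
  have hs : 0 < √R := Real.sqrt_pos.2 h0
  have hsq : √R ^ 2 = R := Real.sq_sqrt h0.le
  simp only [dlogLam, lam, lengthFn]
  generalize Real.log R = g at hl
  generalize √R = s at hs hsq
  subst hsq
  have := hl.ne'
  field_simp

/-- The coefficients `λ^j φ(λ x + 3σ) e^{-κ x}`, where `x = t + ε R` and `λ = 1 / L(R)`. -/
def coef (ε σ κ : ℝ) (j : ℕ) (φ : ℝ → ℝ) (R t : ℝ) : ℝ :=
  lam R ^ j * φ (lam R * (t + ε * R) + 3 * σ) * Real.exp (-(κ * (t + ε * R)))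

section Coef

variable {ε σ κ : ℝ}

theorem contDiff_coef {φ : ℝ → ℝ} (hφ : IsBump φ) (j : ℕ) (R : ℝ) :
    ContDiff ℝ ∞ (coef ε σ κ j φ R) := by
  unfold coef
  have := hφ.smooth
  fun_prop

/-- These coefficients are stable under `∂_t`, without loss of powers of `λ`, so their estimates
pass to all `t`-derivatives by induction. -/
theorem deriv_coef {φ : ℝ → ℝ} (hφ : IsBump φ) (j : ℕ) (R : ℝ) :
    deriv (coef ε σ κ j φ R) =
      coef ε σ κ (j + 1) (deriv φ) R + (-κ) • coef ε σ κ j φ R := by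
  ext t
  have h1 : HasDerivAt (fun t => lam R * (t + ε * R) + 3 * σ) (lam R) t := by
    simpa using (((hasDerivAt_id t).add_const (ε * R)).const_mul (lam R)).add_const (3 * σ)
  have h2 : HasDerivAt (fun t => -(κ * (t + ε * R))) (-κ) t := by
    have := (((hasDerivAt_id t).add_const (ε * R)).const_mul κ).neg
    rw [mul_one] at this
    exact this
  have h3 : HasDerivAt φ (deriv φ (lam R * (t + ε * R) + 3 * σ)) (lam R * (t + ε * R) + 3 * σ) :=
    (hφ.smooth.differentiable (by simp) _).hasDerivAt
  have h4 := ((h3.comp t h1).const_mul (lam R ^ j)).mul h2.exp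
  refine HasDerivAt.deriv (HasDerivAt.congr_deriv (f := coef ε σ κ j φ R) h4 ?_)
  simp only [coef, Pi.add_apply, Pi.smul_apply, smul_eq_mul, Function.comp_apply]
  ring

/-- With `y` the argument of `φ`, the change of `λ` contributes `λ'/λ` times `λ x = y - 3σ`, the
motion of `x` contributes `ε λ`. The result is again a combination of such coefficients. -/
theorem hasDerivAt_coef {φ : ℝ → ℝ} (hφ : IsBump φ) (j : ℕ) {R : ℝ} (hR : 1 < R) (t : ℝ) :
    HasDerivAt (fun R => coef ε σ κ j φ R t)
      (dlogLam R * coef ε σ κ j (fun y => j * φ y + (y - 3 * σ) * deriv φ y) R t +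
        ε * coef ε σ κ (j + 1) (deriv φ) R t + (-(κ * ε)) * coef ε σ κ j φ R t) R := by
  have hx : HasDerivAt (fun R => t + ε * R) ε R := by
    simpa using ((hasDerivAt_id R).const_mul ε).const_add t
  have hl := hasDerivAt_lam hR
  have h1 := (hl.mul hx).add_const (3 * σ)
  have h3 : HasDerivAt φ (deriv φ (lam R * (t + ε * R) + 3 * σ)) (lam R * (t + ε * R) + 3 * σ) :=
    (hφ.smooth.differentiable (by simp) _).hasDerivAt
  have h4 := ((hl.pow j).mul (h3.comp R h1)).mul ((hx.const_mul κ).neg.exp)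
  refine HasDerivAt.congr_deriv (f := fun R => coef ε σ κ j φ R t) h4 ?_
  simp only [coef, Function.comp_apply, Pi.mul_apply, Pi.pow_apply, Pi.neg_apply]
  rcases j with _ | j
  · simp only [Nat.cast_zero, pow_zero]
    ring
  · simp only [Nat.add_sub_cancel]
    push_cast
    ring

/-- On the support `x = (y - 3σ) L(R)` with `|y| ≤ 1`, so `η` bounds from below the exponent per
unit of `L(R)`. -/
theorem abs_coef_le {φ : ℝ → ℝ} (hφ : IsBump φ) {C : ℝ} (hC : ∀ y, |φ y| ≤ C) (j : ℕ) {η : ℝ}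
    (hη : ∀ y, |y| ≤ 1 → η ≤ κ * (y - 3 * σ)) {R : ℝ} (hR : 1 < R) (t : ℝ) :
    |coef ε σ κ j φ R t| ≤ lam R ^ j * C * Real.exp (-(η * lengthFn R)) := by
  have hl := lam_pos hR
  have hC0 : 0 ≤ C := (abs_nonneg _).trans (hC 0)
  set y := lam R * (t + ε * R) + 3 * σ with hy
  by_cases h : |y| ≤ 1
  · rw [coef, abs_mul, abs_mul, abs_of_nonneg (pow_nonneg hl.le j), Real.abs_exp, ← hy]
    refine mul_le_mul (mul_le_mul_of_nonneg_left (hC y) (by positivity))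
      (Real.exp_le_exp.2 (neg_le_neg ?_)) (Real.exp_pos _).le (by positivity)
    · have h1 : t + ε * R = (y - 3 * σ) * lengthFn R := by
        have := (lengthFn_pos hR).ne'
        rw [hy, lam]
        field_simp
        ring
      rw [h1, ← mul_assoc]
      exact mul_le_mul_of_nonneg_right (hη y h) (lengthFn_pos hR).le
  · rw [coef, ← hy, hφ.zero y (not_le.1 h)]
    simp only [mul_zero, zero_mul, abs_zero]
    positivity

end Coef

/-! ### Coefficients measured against the speed of the gluing profile. -/

/-- The size of the derivative of the gluing profile, as a function of `R`. -/
def profileSpeed (c R : ℝ) : ℝ := (R + c) * Real.log (R + c) ^ 2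

/-- A family of bounded functions, parametrized by `R > 1`, which is of class `C¹`, tends to zero
for `R → ∞`, and whose derivative with respect to the gluing parameter tends to zero; if `fast`
holds, so does its product with the derivative of the gluing profile. -/
structure IsCoef (c : ℝ) (fast : Prop) (Q : ℝ → ℝ →ᵇ ℝ) : Prop where
  deriv : ∃ Q' : ℝ → ℝ →ᵇ ℝ, (∀ R, 1 < R → HasDerivAt Q (Q' R) R) ∧ ContinuousOn Q' (Ioi 1) ∧
    Tendsto (fun R => profileSpeed c R * ‖Q' R‖) atTop (𝓝 0)
  tendsto : Tendsto (fun R => ‖Q R‖) atTop (𝓝 0)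
  tendsto_fast : fast → Tendsto (fun R => profileSpeed c R * ‖Q R‖) atTop (𝓝 0)

theorem profileSpeed_nonneg {c R : ℝ} (hc : 0 ≤ c) (hR : 0 ≤ R) : 0 ≤ profileSpeed c R :=
  mul_nonneg (by linarith) (sq_nonneg _)

theorem IsCoef.add {c : ℝ} (hc : 0 ≤ c) {fast : Prop} {Q₁ Q₂ : ℝ → ℝ →ᵇ ℝ}
    (h₁ : IsCoef c fast Q₁) (h₂ : IsCoef c fast Q₂) : IsCoef c fast (fun R => Q₁ R + Q₂ R) := by
  have hev : ∀ᶠ R : ℝ in atTop, 0 ≤ profileSpeed c R := by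
    filter_upwards [eventually_ge_atTop 0] with R hR using profileSpeed_nonneg hc hR
  have aux : ∀ {P₁ P₂ : ℝ → ℝ →ᵇ ℝ}, Tendsto (fun R => profileSpeed c R * ‖P₁ R‖) atTop (𝓝 0) →
      Tendsto (fun R => profileSpeed c R * ‖P₂ R‖) atTop (𝓝 0) →
      Tendsto (fun R => profileSpeed c R * ‖P₁ R + P₂ R‖) atTop (𝓝 0) := by
    intro P₁ P₂ t₁ t₂
    have t := t₁.add t₂
    rw [add_zero] at t
    refine squeeze_zero' ?_ ?_ t
    · filter_upwards [hev] with R hR using mul_nonneg hR (norm_nonneg _)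
    · filter_upwards [hev] with R hR
      rw [← mul_add]
      exact mul_le_mul_of_nonneg_left (norm_add_le _ _) hR
  obtain ⟨Q₁', d₁, c₁, t₁⟩ := h₁.deriv
  obtain ⟨Q₂', d₂, c₂, t₂⟩ := h₂.deriv
  refine ⟨⟨fun R => Q₁' R + Q₂' R, fun R hR => (d₁ R hR).add (d₂ R hR), c₁.add c₂, aux t₁ t₂⟩, ?_,
    fun hf => aux (h₁.tendsto_fast hf) (h₂.tendsto_fast hf)⟩
  have t := h₁.tendsto.add h₂.tendsto
  rw [add_zero] at t
  exact squeeze_zero (fun _ => norm_nonneg _) (fun R => norm_add_le _ _) t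

theorem IsCoef.const_smul {c : ℝ} {fast : Prop} {Q : ℝ → ℝ →ᵇ ℝ}
    (h : IsCoef c fast Q) (a : ℝ) : IsCoef c fast (fun R => a • Q R) := by
  obtain ⟨Q', d, hc, t⟩ := h.deriv
  refine ⟨⟨fun R => a • Q' R, fun R hR => (d R hR).const_smul a, hc.const_smul a, ?_⟩, ?_,
    fun hf => ?_⟩
  · simpa [norm_smul, mul_left_comm] using t.const_mul |a|
  · simpa [norm_smul] using h.tendsto.const_mul |a|
  · simpa [norm_smul, mul_left_comm] using (h.tendsto_fast hf).const_mul |a|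

/-! ### Asymptotics -/

theorem tendsto_lam : Tendsto lam atTop (𝓝 0) := by
  refine tendsto_inv_atTop_zero.comp ?_
  refine Tendsto.atTop_mul_atTop₀ Real.tendsto_sqrt_atTop ?_
  exact (tendsto_pow_atTop (by norm_num)).comp Real.tendsto_log_atTop

/-- For large `R` both `R + c ≤ 2R` and `R + c ≤ R²`, which gives `8 = 2 · 2²`. -/
theorem eventually_profileSpeed_le {c : ℝ} (hc : 0 ≤ c) :
    ∀ᶠ R in atTop, 0 ≤ profileSpeed c R ∧ profileSpeed c R ≤ 8 * R * Real.log R ^ 2 := by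
  filter_upwards [eventually_ge_atTop c, eventually_ge_atTop 2] with R h1 h2
  have h3 : R + c ≤ R ^ 2 := by nlinarith
  refine ⟨profileSpeed_nonneg hc (by linarith), ?_⟩
  have h4 : Real.log (R + c) ≤ 2 * Real.log R := by
    have := Real.log_le_log (by linarith) h3
    rwa [Real.log_pow] at this
  have h5 : 0 ≤ Real.log (R + c) := Real.log_nonneg (by linarith)
  calc (R + c) * Real.log (R + c) ^ 2 ≤ (2 * R) * (2 * Real.log R) ^ 2 := by
        gcongr
        linarith
    _ = 8 * R * Real.log R ^ 2 := by ring

/-- The decisive estimate: `L(R)² = R ln⁴R` exceeds the speed, of order `R ln²R`, by `ln²R`. It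
controls the motion of `λ φ(λx)`, whose slope is of order `λ²`. -/
theorem tendsto_profileSpeed_mul_lam_sq {c : ℝ} (hc : 0 ≤ c) :
    Tendsto (fun R => profileSpeed c R * lam R ^ 2) atTop (𝓝 0) := by
  have t : Tendsto (fun R => 8 * (Real.log R ^ 2)⁻¹) atTop (𝓝 0) := by
    have := (tendsto_inv_atTop_zero.comp ((tendsto_pow_atTop (two_ne_zero)).comp
      Real.tendsto_log_atTop)).const_mul (8 : ℝ)
    simpa using this
  refine squeeze_zero' ?_ ?_ t
  · filter_upwards [eventually_profileSpeed_le hc] with R hR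
    exact mul_nonneg hR.1 (sq_nonneg _)
  · filter_upwards [eventually_profileSpeed_le hc, eventually_gt_atTop 1] with R hR h1
    have hl := Real.log_pos h1
    refine (mul_le_mul_of_nonneg_right hR.2 (sq_nonneg _)).trans (le_of_eq ?_)
    rw [lam, lengthFn, inv_pow, mul_pow, Real.sq_sqrt (by linarith)]
    field_simp

/-- This controls the change of `λ` itself: `|λ'| ≤ 3λ/R`, and `R ln²R · λ/R = R^{-1/2}`. -/
theorem tendsto_profileSpeed_mul_dlogLam_mul_lam {c : ℝ} (hc : 0 ≤ c) :
    Tendsto (fun R => profileSpeed c R * (|dlogLam R| * lam R)) atTop (𝓝 0) := by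
  have t : Tendsto (fun R => 24 * (√R)⁻¹) atTop (𝓝 0) := by
    simpa using (tendsto_inv_atTop_zero.comp Real.tendsto_sqrt_atTop).const_mul (24 : ℝ)
  refine squeeze_zero' ?_ ?_ t
  · filter_upwards [eventually_profileSpeed_le hc, eventually_gt_atTop 1] with R hR h1
    exact mul_nonneg hR.1 (mul_nonneg (abs_nonneg _) (lam_pos h1).le)
  · filter_upwards [eventually_profileSpeed_le hc, eventually_gt_atTop 1,
      Real.tendsto_log_atTop.eventually_ge_atTop 1] with R hR h1 hlog
    have h0 : 0 < R := by linarith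
    have hd : |dlogLam R| ≤ 3 / R := by
      rw [dlogLam, abs_neg, abs_of_nonneg (by positivity)]
      have e1 : 1 / (2 * R) ≤ 1 / R := by gcongr; linarith
      have e2 : 2 / (R * Real.log R) ≤ 2 / R := by
        gcongr
        nlinarith
      calc _ ≤ 1 / R + 2 / R := add_le_add e1 e2
        _ = 3 / R := by ring
    have hs : 0 < √R := Real.sqrt_pos.2 h0
    calc _ ≤ (8 * R * Real.log R ^ 2) * (3 / R * lam R) := by
          gcongr
          · exact mul_nonneg (abs_nonneg _) (lam_pos h1).le
          · exact hR.2
          · exact (lam_pos h1).le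
      _ = 24 * (√R)⁻¹ := by
          rw [lam, lengthFn]
          field_simp
          norm_num

/-- Once `ln R ≥ 1`, `L(R) ≥ √R`, while the speed is at most `8R³ = 8(√R)⁶`. -/
theorem tendsto_profileSpeed_mul_exp {c η : ℝ} (hc : 0 ≤ c) (hη : 0 < η) :
    Tendsto (fun R => profileSpeed c R * Real.exp (-(η * lengthFn R))) atTop (𝓝 0) := by
  have t : Tendsto (fun R => 8 * ((√R) ^ (6 : ℝ) * Real.exp (-η * √R))) atTop (𝓝 0) := by
    simpa using ((tendsto_rpow_mul_exp_neg_mul_atTop_nhds_zero 6 η hη).comp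
      Real.tendsto_sqrt_atTop).const_mul (8 : ℝ)
  refine squeeze_zero' ?_ ?_ t
  · filter_upwards [eventually_profileSpeed_le hc] with R hR
    exact mul_nonneg hR.1 (Real.exp_pos _).le
  · filter_upwards [eventually_profileSpeed_le hc, eventually_gt_atTop 1,
      Real.tendsto_log_atTop.eventually_ge_atTop 1] with R hR h1 hlog
    have h0 : 0 < R := by linarith
    have hlog2 : Real.log R ≤ R := Real.log_le_self h0.le
    have e1 : profileSpeed c R ≤ 8 * √R ^ (6 : ℝ) := by
      refine hR.2.trans ?_
      have : √R ^ (6 : ℝ) = R ^ 3 := by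
        rw [show (6 : ℝ) = (6 : ℕ) by norm_num, Real.rpow_natCast,
          show √R ^ 6 = (√R ^ 2) ^ 3 by ring, Real.sq_sqrt h0.le]
      rw [this]
      calc 8 * R * Real.log R ^ 2 ≤ 8 * R * R ^ 2 := by gcongr
        _ = 8 * R ^ 3 := by ring
    rw [← mul_assoc]
    gcongr
    rw [neg_mul]
    refine neg_le_neg ?_
    gcongr
    exact le_mul_of_one_le_right (Real.sqrt_nonneg R) (one_le_pow₀ hlog)

/-- The coefficients `coef` as bounded continuous functions of `t`. -/
theorem exists_bcf_coef {ε σ κ η : ℝ} (hη : ∀ y, |y| ≤ 1 → η ≤ κ * (y - 3 * σ))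
    {φ : ℝ → ℝ} (hφ : IsBump φ) (j : ℕ) :
    ∃ Q : ℝ → ℝ →ᵇ ℝ, (∀ R, 1 < R → ∀ t, Q R t = coef ε σ κ j φ R t) ∧
      ∃ C, 0 ≤ C ∧ ∀ R, 1 < R → ‖Q R‖ ≤ lam R ^ j * C * Real.exp (-(η * lengthFn R)) := by
  classical
  obtain ⟨C, hC0, hC⟩ := hφ.exists_bound
  refine ⟨fun R => if hR : 1 < R then toBCF (coef ε σ κ j φ R) (contDiff_coef hφ j R).continuous
    (abs_coef_le hφ hC j hη hR) else 0, fun R hR t => ?_, C, hC0, fun R hR => ?_⟩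
  · simp [hR, toBCF]
  · have := lam_pos hR
    simp only [hR, dif_pos]
    exact (BoundedContinuousFunction.norm_le (by positivity)).2 (abs_coef_le hφ hC j hη hR)

theorem continuousOn_dlogLam : ContinuousOn dlogLam (Ioi 1) := by
  unfold dlogLam
  have h0 : ∀ R ∈ Ioi (1 : ℝ), R ≠ 0 := fun R hR => (zero_lt_one.trans hR).ne'
  have h1 : ∀ R ∈ Ioi (1 : ℝ), Real.log R ≠ 0 := fun R hR => (Real.log_pos hR).ne'
  refine ContinuousOn.neg (ContinuousOn.add ?_ ?_)
  · exact continuousOn_const.div (continuousOn_const.mul continuousOn_id) fun R hR => by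
      simpa using h0 R hR
  · exact continuousOn_const.div (continuousOn_id.mul (Real.continuousOn_log.mono h0)) fun R hR =>
      mul_ne_zero (h0 R hR) (h1 R hR)

theorem continuousOn_lam : ContinuousOn lam (Ioi 1) := fun _ hR =>
  (hasDerivAt_lam hR).continuousAt.continuousWithinAt

theorem continuousOn_bcf_coef {ε σ κ η : ℝ} (hη : ∀ y, |y| ≤ 1 → η ≤ κ * (y - 3 * σ))
    (hη0 : 0 ≤ η) {φ : ℝ → ℝ} (hφ : IsBump φ) (j : ℕ) {Q : ℝ → ℝ →ᵇ ℝ}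
    (hQ : ∀ R, 1 < R → ∀ t, Q R t = coef ε σ κ j φ R t) : ContinuousOn Q (Ioi 1) := by
  have hφ₁ : IsBump fun y => j * φ y + (y - 3 * σ) * deriv φ y :=
    (hφ.mul contDiff_const).add (hφ.deriv.mul (contDiff_id.sub contDiff_const))
  obtain ⟨Q₁, e₁, C₁, hC₁, b₁⟩ := exists_bcf_coef (ε := ε) hη hφ₁ j
  obtain ⟨Q₂, e₂, C₂, hC₂, b₂⟩ := exists_bcf_coef (ε := ε) hη hφ.deriv (j + 1)
  obtain ⟨Q₃, e₃, C₃, hC₃, b₃⟩ := exists_bcf_coef (ε := ε) hη hφ j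
  intro R₀ hR₀
  refine ContinuousAt.continuousWithinAt ?_
  -- `B` bounds the norm of the `R`-derivative and is continuous, hence locally bounded.
  let B : ℝ → ℝ := fun R => |dlogLam R| * (lam R ^ j * C₁) + |ε| * (lam R ^ (j + 1) * C₂) +
    |-(κ * ε)| * (lam R ^ j * C₃)
  have hB : ContinuousAt B R₀ := by
    have h1 : ContinuousAt dlogLam R₀ := continuousOn_dlogLam.continuousAt (Ioi_mem_nhds hR₀)
    have h2 : ContinuousAt lam R₀ := continuousOn_lam.continuousAt (Ioi_mem_nhds hR₀)
    fun_prop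
  have hexp : ∀ R, 1 < R → Real.exp (-(η * lengthFn R)) ≤ 1 := fun R hR =>
    Real.exp_le_one_iff.2 (by have := lengthFn_pos hR; nlinarith)
  refine continuousAt_bcf_of_hasDerivAt
    (Q' := fun R => dlogLam R • Q₁ R + ε • Q₂ R + (-(κ * ε)) • Q₃ R) (C := B R₀ + 1) ?_ ?_
  · filter_upwards [Ioi_mem_nhds hR₀] with R hR t
    have h1 := hasDerivAt_coef (ε := ε) (σ := σ) (κ := κ) hφ j hR t
    have h2 : (fun R => Q R t) =ᶠ[𝓝 R] fun R => coef ε σ κ j φ R t := by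
      filter_upwards [Ioi_mem_nhds hR] with R' hR' using hQ R' hR' t
    refine (h1.congr_of_eventuallyEq h2).congr_deriv ?_
    simp [e₁ R hR, e₂ R hR, e₃ R hR]
  · filter_upwards [Ioi_mem_nhds hR₀, hB.eventually (gt_mem_nhds (lt_add_one (B R₀)))] with R hR hlt
    refine le_trans ?_ hlt.le
    have hl := lam_pos hR
    refine (norm_add₃_le).trans ?_
    simp only [norm_smul, Real.norm_eq_abs, B]
    gcongr
    · exact (b₁ R hR).trans (mul_le_of_le_one_right (by positivity) (hexp R hR))
    · exact (b₂ R hR).trans (mul_le_of_le_one_right (by positivity) (hexp R hR))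
    · exact (b₃ R hR).trans (mul_le_of_le_one_right (by positivity) (hexp R hR))

/-- Of the three parts of the `R`-derivative, the first two are `O(|λ'|)` and `O(λ²)` because `j ≥
1`. The third, from the exponential, gains no power of `λ`: it must vanish (`κ = 0`) or decay
exponentially (`η > 0`). -/
theorem isCoef_coef {c : ℝ} (hc : 0 ≤ c) {ε σ κ η : ℝ}
    (hη : ∀ y, |y| ≤ 1 → η ≤ κ * (y - 3 * σ)) (hη0 : 0 ≤ η) (hκ : κ = 0 ∨ 0 < η)
    {φ : ℝ → ℝ} (hφ : IsBump φ) {j : ℕ} (hj : 1 ≤ j) :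
    ∃ Q : ℝ → ℝ →ᵇ ℝ, IsCoef c (0 < η) Q ∧ ∀ R, 1 < R → ∀ t, Q R t = coef ε σ κ j φ R t := by
  have hφ₁ : IsBump fun y => j * φ y + (y - 3 * σ) * deriv φ y :=
    (hφ.mul contDiff_const).add (hφ.deriv.mul (contDiff_id.sub contDiff_const))
  obtain ⟨Q₁, e₁, C₁, hC₁, b₁⟩ := exists_bcf_coef (ε := ε) hη hφ₁ j
  obtain ⟨Q₂, e₂, C₂, hC₂, b₂⟩ := exists_bcf_coef (ε := ε) hη hφ.deriv (j + 1)
  obtain ⟨Q₃, e₃, C₃, hC₃, b₃⟩ := exists_bcf_coef (ε := ε) hη hφ j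
  have hexp : ∀ R, 1 < R → Real.exp (-(η * lengthFn R)) ≤ 1 := fun R hR =>
    Real.exp_le_one_iff.2 (by have := lengthFn_pos hR; nlinarith)
  have hlam1 : ∀ᶠ R in atTop, 1 < R ∧ lam R ≤ 1 :=
    (eventually_gt_atTop 1).and (tendsto_lam.eventually (ge_mem_nhds zero_lt_one))
  have hfast : 0 < η → Tendsto (fun R => profileSpeed c R * ‖Q₃ R‖) atTop (𝓝 0) := by
    intro hpos
    have t := (tendsto_profileSpeed_mul_exp hc hpos).const_mul C₃
    rw [mul_zero] at t
    refine squeeze_zero' ?_ ?_ t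
    · filter_upwards [eventually_profileSpeed_le hc] with R hR using
        mul_nonneg hR.1 (norm_nonneg _)
    · filter_upwards [eventually_profileSpeed_le hc, hlam1] with R hR ⟨h1, h2⟩
      rw [mul_left_comm]
      refine mul_le_mul_of_nonneg_left ((b₃ R h1).trans ?_) hR.1
      gcongr
      exact mul_le_of_le_one_left hC₃ (pow_le_one₀ (lam_pos h1).le h2)
  refine ⟨Q₃, ⟨⟨fun R => dlogLam R • Q₁ R + ε • Q₂ R + (-(κ * ε)) • Q₃ R, fun R hR => ?_, ?_, ?_⟩,
    ?_, hfast⟩, e₃⟩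
  · refine hasDerivAt_bcf
      (Q' := fun R => dlogLam R • Q₁ R + ε • Q₂ R + (-(κ * ε)) • Q₃ R) ?_ ?_
    · filter_upwards [Ioi_mem_nhds hR] with R hR t
      have h1 := hasDerivAt_coef (ε := ε) (σ := σ) (κ := κ) hφ j hR t
      have h2 : (fun R => Q₃ R t) =ᶠ[𝓝 R] fun R => coef ε σ κ j φ R t := by
        filter_upwards [Ioi_mem_nhds hR] with R' hR' using e₃ R' hR' t
      refine (h1.congr_of_eventuallyEq h2).congr_deriv ?_
      simp [e₁ R hR, e₂ R hR, e₃ R hR]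
    · have h1 := continuousOn_dlogLam.continuousAt (Ioi_mem_nhds hR)
      have h2 := (continuousOn_bcf_coef hη hη0 hφ₁ j e₁).continuousAt (Ioi_mem_nhds hR)
      have h3 := (continuousOn_bcf_coef hη hη0 hφ.deriv (j + 1) e₂).continuousAt (Ioi_mem_nhds hR)
      have h4 := (continuousOn_bcf_coef hη hη0 hφ j e₃).continuousAt (Ioi_mem_nhds hR)
      exact ((h1.smul h2).add (h3.const_smul ε)).add (h4.const_smul (-(κ * ε)))
  · exact ((continuousOn_dlogLam.smul (continuousOn_bcf_coef hη hη0 hφ₁ j e₁)).add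
      ((continuousOn_bcf_coef hη hη0 hφ.deriv (j + 1) e₂).const_smul ε)).add
      ((continuousOn_bcf_coef hη hη0 hφ j e₃).const_smul (-(κ * ε)))
  · have t₁ := (tendsto_profileSpeed_mul_dlogLam_mul_lam hc).const_mul C₁
    have t₂ := (tendsto_profileSpeed_mul_lam_sq hc).const_mul (|ε| * C₂)
    have t₃ : Tendsto (fun R => |κ * ε| * (profileSpeed c R * ‖Q₃ R‖)) atTop (𝓝 0) := by
      rcases hκ with h | h
      · simp [h]
      · simpa using (hfast h).const_mul |κ * ε|
    have t := (t₁.add t₂).add t₃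
    simp only [mul_zero, add_zero] at t
    refine squeeze_zero' ?_ ?_ t
    · filter_upwards [eventually_profileSpeed_le hc] with R hR using
        mul_nonneg hR.1 (norm_nonneg _)
    · filter_upwards [eventually_profileSpeed_le hc, hlam1] with R hR ⟨h1, h2⟩
      have hl := lam_pos h1
      have n1 : ‖Q₁ R‖ ≤ lam R * C₁ := by
        refine (b₁ R h1).trans ((mul_le_of_le_one_right (by positivity) (hexp R h1)).trans ?_)
        gcongr
        exact pow_le_of_le_one hl.le h2 (by omega)
      have n2 : ‖Q₂ R‖ ≤ lam R ^ 2 * C₂ := by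
        refine (b₂ R h1).trans ((mul_le_of_le_one_right (by positivity) (hexp R h1)).trans ?_)
        gcongr ?_ * _
        exact pow_le_pow_of_le_one hl.le h2 (by omega)
      calc profileSpeed c R * ‖dlogLam R • Q₁ R + ε • Q₂ R + (-(κ * ε)) • Q₃ R‖
          ≤ profileSpeed c R * (|dlogLam R| * (lam R * C₁) + |ε| * (lam R ^ 2 * C₂) +
            |κ * ε| * ‖Q₃ R‖) := by
            refine mul_le_mul_of_nonneg_left ?_ hR.1
            refine (norm_add₃_le).trans ?_
            simp only [norm_smul, Real.norm_eq_abs, abs_neg]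
            gcongr
        _ = _ := by ring
  · have t := tendsto_lam.mul_const C₃
    rw [zero_mul] at t
    refine squeeze_zero' (Eventually.of_forall fun _ => norm_nonneg _) ?_ t
    filter_upwards [hlam1] with R ⟨h1, h2⟩
    have hl := lam_pos h1
    refine (b₃ R h1).trans ((mul_le_of_le_one_right (by positivity) (hexp R h1)).trans ?_)
    gcongr
    exact pow_le_of_le_one hl.le h2 (by omega)

theorem exists_isCoef_iteratedDeriv {c : ℝ} (hc : 0 ≤ c) {ε σ κ η : ℝ}
    (hη : ∀ y, |y| ≤ 1 → η ≤ κ * (y - 3 * σ)) (hη0 : 0 ≤ η) (hκ : κ = 0 ∨ 0 < η) (m : ℕ)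
    {φ : ℝ → ℝ} (hφ : IsBump φ) {j : ℕ} (hj : 1 ≤ j) :
    ∃ Q : ℝ → ℝ →ᵇ ℝ, IsCoef c (0 < η) Q ∧
      ∀ R, 1 < R → ∀ t, Q R t = iteratedDeriv m (coef ε σ κ j φ R) t := by
  induction m generalizing φ j with
  | zero => simpa using isCoef_coef hc hη hη0 hκ hφ hj
  | succ m ih =>
    obtain ⟨Q₁, h₁, e₁⟩ := ih hφ.deriv (j := j + 1) (by omega)
    obtain ⟨Q₂, h₂, e₂⟩ := ih hφ hj
    refine ⟨fun R => Q₁ R + (-κ) • Q₂ R, h₁.add hc (h₂.const_smul _), fun R hR t => ?_⟩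
    have c1 : ContDiff ℝ m (coef ε σ κ (j + 1) (deriv φ) R) :=
      (contDiff_coef hφ.deriv (j + 1) R).of_le (by exact_mod_cast le_top)
    have c2 : ContDiff ℝ m (coef ε σ κ j φ R) :=
      (contDiff_coef hφ j R).of_le (by exact_mod_cast le_top)
    rw [iteratedDeriv_succ', deriv_coef hφ]
    have e := iteratedDeriv_add (x := t) c1.contDiffAt (c2.const_smul (-κ)).contDiffAt
    refine Eq.trans ?_ e.symm
    have e' := iteratedDeriv_const_smul_field (n := m) (-κ) (coef ε σ κ j φ R) (x := t)
    refine Eq.trans ?_ (congrArg₂ (· + ·) rfl e'.symm)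
    simp [e₁ R hR, e₂ R hR]

/-! ### The gluing profile and the shift of the gluing -/

section Profile

variable {r₀ : ℝ}

theorem gluingProfile_add (r₀ r : ℝ) :
    gluingProfile r₀ r + Real.exp (1 / r₀) = Real.exp (1 / r) := by
  simp [gluingProfile]

theorem profileSpeed_gluingProfile (r₀ r : ℝ) :
    profileSpeed (Real.exp (1 / r₀)) (gluingProfile r₀ r) = Real.exp (1 / r) * (1 / r) ^ 2 := by
  rw [profileSpeed, gluingProfile_add, Real.log_exp]

theorem hasDerivAt_gluingProfile {r : ℝ} (hr : r ≠ 0) :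
    HasDerivAt (gluingProfile r₀)
      (-profileSpeed (Real.exp (1 / r₀)) (gluingProfile r₀ r)) r := by
  have h1 : HasDerivAt (fun r : ℝ => 1 / r) (-(1 / r) ^ 2) r := by
    simpa using hasDerivAt_inv hr
  refine HasDerivAt.congr_deriv (f := gluingProfile r₀) (h1.exp.sub_const _) ?_
  rw [profileSpeed_gluingProfile]
  ring

theorem tendsto_gluingProfile (r₀ : ℝ) : Tendsto (gluingProfile r₀) (𝓝[>] 0) atTop := by
  refine tendsto_atTop_add_const_right _ _ (Real.tendsto_exp_atTop.comp ?_)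
  have : (HDiv.hDiv 1 : ℝ → ℝ) = fun x => x⁻¹ := by
    ext x
    exact one_div x
  rw [this]
  exact tendsto_inv_nhdsGT_zero (𝕜 := ℝ)

theorem tendsto_norm_punctured : Tendsto (fun z : ℂ => ‖z‖) (𝓝[≠] 0) (𝓝[>] 0) :=
  tendsto_norm_nhdsNE_zero

theorem tendsto_gluingProfile_norm (r₀ : ℝ) :
    Tendsto (fun z : ℂ => gluingProfile r₀ ‖z‖) (𝓝[≠] 0) atTop :=
  (tendsto_gluingProfile r₀).comp tendsto_norm_punctured

theorem hasFDerivAt_gluingProfile_norm {z : ℂ} (hz : z ≠ 0) :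
    HasFDerivAt (fun z : ℂ => gluingProfile r₀ ‖z‖)
      ((-profileSpeed (Real.exp (1 / r₀)) (gluingProfile r₀ ‖z‖)) • dNorm z) z :=
  (hasDerivAt_gluingProfile (norm_ne_zero_iff.2 hz)).comp_hasFDerivAt z (hasFDerivAt_norm_complex hz)

theorem hasFDerivAt_comp_gluingProfile_norm {F : Type*} [NormedAddCommGroup F] [NormedSpace ℝ F]
    {Q : ℝ → F} {Q' : F} {z : ℂ} (hz : z ≠ 0) (hQ : HasDerivAt Q Q' (gluingProfile r₀ ‖z‖)) :
    HasFDerivAt (fun z : ℂ => Q (gluingProfile r₀ ‖z‖)) ((dNorm z).smulRight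
      ((-profileSpeed (Real.exp (1 / r₀)) (gluingProfile r₀ ‖z‖)) • Q')) z := by
  refine (HasFDerivAt.comp (g := Q) z hQ.hasFDerivAt
    (hasFDerivAt_gluingProfile_norm (r₀ := r₀) hz)).congr_fderiv ?_
  ext w
  simp [smul_smul, mul_comm]

theorem continuousOn_gluingProfile_norm :
    ContinuousOn (fun z : ℂ => gluingProfile r₀ ‖z‖) {0}ᶜ := fun _ hz =>
  (hasFDerivAt_gluingProfile_norm hz).continuousAt.continuousWithinAt

theorem continuousOn_profileSpeed_norm :
    ContinuousOn (fun z : ℂ => profileSpeed (Real.exp (1 / r₀)) (gluingProfile r₀ ‖z‖)) {0}ᶜ := by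
  simp only [profileSpeed_gluingProfile]
  have h1 : ContinuousOn (fun z : ℂ => 1 / ‖z‖) {0}ᶜ :=
    continuousOn_const.div continuous_norm.continuousOn fun z hz => norm_ne_zero_iff.2 hz
  exact (Real.continuous_exp.comp_continuousOn h1).mul (h1.pow 2)

/-- The shift `(2 s R, 2 s θ)` between the coordinates on the two half-cylinders. -/
def gluingShift (r₀ : ℝ) (s : ℤ) (z : ℂ) : Cyl :=
  (2 * s * gluingProfile r₀ ‖z‖, (2 * s) • ((Complex.arg z : ℝ) : S1))

/-- The principal argument jumps along the negative axis, but only its class in `S¹` matters, and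
`arg (z / z₀)` is a local lift that is smooth near `z₀`. -/
theorem gluingShift_eq (s : ℤ) {z₀ z : ℂ} (hz₀ : z₀ ≠ 0) (hz : z ≠ 0) :
    gluingShift r₀ s z = ((0, (2 * s) • ((Complex.arg z₀ : ℝ) : S1)) : Cyl) +
      cover (2 * s * gluingProfile r₀ ‖z‖, 2 * s * Complex.arg (z / z₀)) := by
  have h1 : ((Complex.arg (z / z₀) : ℝ) : S1) = (Complex.arg z : S1) - (Complex.arg z₀ : S1) :=
    Complex.arg_div_coe_angle hz hz₀
  have h2 : ((2 * s * Complex.arg (z / z₀) : ℝ) : S1) =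
      (2 * s) • ((Complex.arg (z / z₀) : ℝ) : S1) := by
    rw [← AddCircle.coe_zsmul]
    simp
  ext1
  · simp [gluingShift, cover]
  · simp only [gluingShift, cover, Prod.snd_add]
    rw [h2, h1, smul_sub]
    abel

theorem hasFDerivAt_arg_div {z₀ : ℂ} (hz₀ : z₀ ≠ 0) :
    HasFDerivAt (fun z : ℂ => Complex.arg (z / z₀)) (dArg z₀) z₀ := by
  have h1 : HasDerivAt (fun z : ℂ => Complex.log (z / z₀)) z₀⁻¹ z₀ := by
    have h2 : HasDerivAt (fun z : ℂ => z / z₀) (1 / z₀) z₀ := (hasDerivAt_id z₀).div_const z₀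
    have := h2.clog (by simp [div_self hz₀])
    simpa [div_self hz₀] using this
  have h3 := Complex.imCLM.hasFDerivAt.comp z₀ (h1.hasFDerivAt.restrictScalars ℝ)
  simp only [Function.comp_def, Complex.imCLM_apply, Complex.log_im] at h3
  refine h3.congr_fderiv ?_
  ext w
  simp [dArg, mul_comm]

theorem continuousOn_gluingShift (s : ℤ) : ContinuousOn (gluingShift r₀ s) {0}ᶜ := by
  refine ContinuousOn.prodMk (continuousOn_const.mul continuousOn_gluingProfile_norm) ?_
  intro z hz
  have : ContinuousAt (fun z : ℂ => ((Complex.arg z : ℝ) : S1)) z :=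
    Complex.continuousAt_arg_coe_angle hz
  exact (this.zsmul (2 * s)).continuousWithinAt

end Profile

/-! ### Differentiability of the terms of the filled section -/

section Terms

variable {n : ℕ} {p : ℝ≥0∞} [Fact (1 ≤ p)] {r₀ r₁ : ℝ} {Q : ℝ → ℝ →ᵇ ℝ} {fast : Prop}

/-- Multiplication with a coefficient that depends on the gluing parameter. -/
def diagOp (r₀ : ℝ) (Q : ℝ → ℝ →ᵇ ℝ) (μ : Measure Cyl) (z : ℂ) :
    Lp (E n) p μ →L[ℝ] Lp (E n) p μ :=
  if z = 0 then 0 else mulL μ (Q (gluingProfile r₀ ‖z‖))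

/-- Shift, multiplication with a coefficient that depends on the gluing parameter, and
restriction. -/
def crossOp (r₀ : ℝ) (s : ℤ) (Q : ℝ → ℝ →ᵇ ℝ) (Ω : Set Cyl) (z : ℂ) :
    Lp (E n) p (volume : Measure Cyl) →L[ℝ] Lp (E n) p (volume.restrict Ω) :=
  if z = 0 then 0 else (LpToLpRestrictCLM Cyl (E n) ℝ volume p Ω).comp
    ((mulL volume (Q (gluingProfile r₀ ‖z‖))).comp (transL (gluingShift r₀ s z)))

/-- Nothing is translated here: the angular derivative is zero and `V` needs no regularity. The
radial one is the profile speed times `Q'`. -/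
theorem contDiffOn_diagOp (hQ : IsCoef (Real.exp (1 / r₀)) fast Q)
    (hR : ∀ r ∈ Ioo 0 r₁, 1 < gluingProfile r₀ r) (μ : Measure Cyl) (V : Lp (E n) p μ) :
    ContDiffOn ℝ 1 (fun z => diagOp r₀ Q μ z V) (Metric.ball 0 r₁) := by
  obtain ⟨Q', hd, hc, ht⟩ := hQ.deriv
  have hR' : ∀ z ∈ Metric.ball (0 : ℂ) r₁, z ≠ 0 → 1 < gluingProfile r₀ ‖z‖ := fun z hz h0 =>
    hR _ ⟨norm_pos_iff.2 h0, by simpa using hz⟩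
  refine contDiffOn_one_of_polar
    (A := fun z => (-profileSpeed (Real.exp (1 / r₀)) (gluingProfile r₀ ‖z‖)) •
      mulL μ (Q' (gluingProfile r₀ ‖z‖)) V) (B := fun _ => 0) (fun z hz h0 => ?_) ?_
      continuousOn_const ?_ ?_ (by simp)
  · have h1 : HasFDerivAt (fun z : ℂ => mulL μ (Q (gluingProfile r₀ ‖z‖)) V) _ z :=
      ((mulL μ : (ℝ →ᵇ ℝ) →L[ℝ] Lp (E n) p μ →L[ℝ] Lp (E n) p μ).flip V).hasFDerivAt.comp z
        (hasFDerivAt_comp_gluingProfile_norm h0 (hd _ (hR' z hz h0)))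
    have h2 : (fun z : ℂ => diagOp r₀ Q μ z V) =ᶠ[𝓝 z]
        fun z : ℂ => mulL μ (Q (gluingProfile r₀ ‖z‖)) V := by
      filter_upwards [isOpen_ne.mem_nhds h0] with w hw
      simp [diagOp, show w ≠ 0 from hw]
    refine (h1.congr_of_eventuallyEq h2).congr_fderiv ?_
    ext w
    simp [smul_smul, mul_comm]
  · have hm : MapsTo (fun z : ℂ => gluingProfile r₀ ‖z‖) (Metric.ball 0 r₁ \ {0}) (Ioi 1) :=
      fun z hz => hR' z hz.1 hz.2
    have hsub : Metric.ball (0 : ℂ) r₁ \ {0} ⊆ {0}ᶜ := fun z hz => hz.2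
    have h1 := hc.comp (continuousOn_gluingProfile_norm.mono hsub) hm
    have h2 := ((mulL μ : (ℝ →ᵇ ℝ) →L[ℝ] Lp (E n) p μ →L[ℝ] Lp (E n) p μ).flip
      V).continuous.comp_continuousOn h1
    exact (continuousOn_profileSpeed_norm.mono hsub).neg.smul h2
  · have h1 : (fun z : ℂ => diagOp r₀ Q μ z V) 0 = 0 := by simp [diagOp]
    simp only [h1]
    have t := (hQ.tendsto.comp (tendsto_gluingProfile_norm r₀)).mul_const ‖V‖
    rw [zero_mul] at t
    refine squeeze_zero_norm' ?_ t
    filter_upwards [self_mem_nhdsWithin] with z hz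
    have : z ≠ 0 := hz
    simpa [diagOp, this] using norm_mulL_le (Q (gluingProfile r₀ ‖z‖)) V
  · have t := (ht.comp (tendsto_gluingProfile_norm r₀)).mul_const ‖V‖
    rw [zero_mul] at t
    refine squeeze_zero_norm' (Eventually.of_forall fun z => ?_) t
    rw [norm_smul, norm_neg, Function.comp_apply, mul_assoc, Real.norm_of_nonneg (by
      rw [profileSpeed_gluingProfile]; positivity)]
    exact mul_le_mul_of_nonneg_left (norm_mulL_le _ _)
      (by rw [profileSpeed_gluingProfile]; positivity)

/-- The factor `1/r` of the angular derivative is dominated by the speed `e^{1/r}/r²`, so decay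
against the speed also settles the angle. -/
theorem eventually_inv_norm_le_profileSpeed (r₀ : ℝ) :
    ∀ᶠ z : ℂ in 𝓝[≠] 0,
      ‖z‖⁻¹ ≤ profileSpeed (Real.exp (1 / r₀)) (gluingProfile r₀ ‖z‖) := by
  have h1 : ∀ᶠ z : ℂ in 𝓝[≠] 0, ‖z‖ < 1 := by
    refine nhdsWithin_le_nhds ?_
    filter_upwards [Metric.ball_mem_nhds (0 : ℂ) one_pos] with z hz
    simpa using hz
  filter_upwards [h1, self_mem_nhdsWithin] with z hz h0
  have hpos : 0 < ‖z‖ := norm_pos_iff.2 h0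
  rw [profileSpeed_gluingProfile]
  have h2 : 1 ≤ 1 / ‖z‖ := (one_le_div hpos).2 hz.le
  have h3 : 1 ≤ Real.exp (1 / ‖z‖) := Real.one_le_exp (by positivity)
  rw [inv_eq_one_div]
  nlinarith

variable [Fact (p ≠ ⊤)]

/-- Differentiating the translation costs one derivative of `V` and multiplies the speed by `Q`
itself, not only by `Q'`; this is the reason for `fast`. -/
theorem contDiffOn_crossOp (hQ : IsCoef (Real.exp (1 / r₀)) fast Q) (hf : fast)
    (hR : ∀ r ∈ Ioo 0 r₁, 1 < gluingProfile r₀ r) (s : ℤ) (Ω : Set Cyl)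
    {V Vt Vs : Lp (E n) p (volume : Measure Cyl)}
    (hVt : HasWeakDeriv (coordDeriv false) univ V Vt)
    (hVs : HasWeakDeriv (coordDeriv true) univ V Vs) :
    ContDiffOn ℝ 1 (fun z => crossOp r₀ s Q Ω z V) (Metric.ball 0 r₁) := by
  obtain ⟨Q', hd, hc, ht⟩ := hQ.deriv
  have hR' : ∀ z ∈ Metric.ball (0 : ℂ) r₁, z ≠ 0 → 1 < gluingProfile r₀ ‖z‖ := fun z hz h0 =>
    hR _ ⟨norm_pos_iff.2 h0, by simpa using hz⟩
  let res : Lp (E n) p (volume : Measure Cyl) →L[ℝ] Lp (E n) p (volume.restrict Ω) :=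
    LpToLpRestrictCLM Cyl (E n) ℝ volume p Ω
  let m : (ℝ →ᵇ ℝ) →L[ℝ] Lp (E n) p (volume : Measure Cyl) →L[ℝ]
    Lp (E n) p (volume : Measure Cyl) := mulL volume
  let S : ℂ → ℝ := fun z => profileSpeed (Real.exp (1 / r₀)) (gluingProfile r₀ ‖z‖)
  have hS0 : ∀ z, 0 ≤ S z := fun z => by
    simp only [S, profileSpeed_gluingProfile]
    positivity
  let q : ℂ → ℝ →ᵇ ℝ := fun z => Q (gluingProfile r₀ ‖z‖)
  let q' : ℂ → ℝ →ᵇ ℝ := fun z => Q' (gluingProfile r₀ ‖z‖)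
  let τ : ℂ → Lp (E n) p (volume : Measure Cyl) →L[ℝ] Lp (E n) p (volume : Measure Cyl) :=
    fun z => transL (gluingShift r₀ s z)
  have hsub : Metric.ball (0 : ℂ) r₁ \ {0} ⊆ {0}ᶜ := fun z hz => hz.2
  have hm : MapsTo (fun z : ℂ => gluingProfile r₀ ‖z‖) (Metric.ball 0 r₁ \ {0}) (Ioi 1) :=
    fun z hz => hR' z hz.1 hz.2
  have cS : ContinuousOn S (Metric.ball 0 r₁ \ {0}) := continuousOn_profileSpeed_norm.mono hsub
  have cq' : ContinuousOn q' (Metric.ball 0 r₁ \ {0}) :=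
    hc.comp (continuousOn_gluingProfile_norm.mono hsub) hm
  have cQ : ContinuousOn Q (Ioi 1) := fun R hR => (hd R hR).continuousAt.continuousWithinAt
  have cq : ContinuousOn q (Metric.ball 0 r₁ \ {0}) :=
    cQ.comp (continuousOn_gluingProfile_norm.mono hsub) hm
  have cτ : ∀ W : Lp (E n) p (volume : Measure Cyl),
      ContinuousOn (fun z => τ z W) (Metric.ball 0 r₁ \ {0}) := fun W =>
    (continuous_transL W).comp_continuousOn ((continuousOn_gluingShift s).mono hsub)
  have nb : ∀ (u : ℝ →ᵇ ℝ) (z : ℂ) (W : Lp (E n) p (volume : Measure Cyl)),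
      ‖res (m u (τ z W))‖ ≤ ‖res‖ * (‖u‖ * ‖W‖) := by
    intro u z W
    refine (res.le_opNorm _).trans ?_
    gcongr
    refine (norm_mulL_le u _).trans (le_of_eq ?_)
    rw [norm_transL]
  have tq : Tendsto (fun z => ‖q z‖) (𝓝[≠] 0) (𝓝 0) :=
    hQ.tendsto.comp (tendsto_gluingProfile_norm r₀)
  have tSq : Tendsto (fun z => S z * ‖q z‖) (𝓝[≠] 0) (𝓝 0) :=
    (hQ.tendsto_fast hf).comp (tendsto_gluingProfile_norm r₀)
  have tSq' : Tendsto (fun z => S z * ‖q' z‖) (𝓝[≠] 0) (𝓝 0) :=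
    ht.comp (tendsto_gluingProfile_norm r₀)
  refine contDiffOn_one_of_polar
    (A := fun z => (-S z) • res (m (q' z) (τ z V)) + (-(2 * s * S z)) • res (m (q z) (τ z Vt)))
    (B := fun z => (2 * s : ℝ) • res (m (q z) (τ z Vs))) (fun z₀ hz₀ h0 => ?_) ?_ ?_ ?_ ?_ ?_
  · let a₀ : Cyl := (0, (2 * s) • ((Complex.arg z₀ : ℝ) : S1))
    let y : ℂ → ℝ × ℝ := fun z => (2 * s * gluingProfile r₀ ‖z‖, 2 * s * Complex.arg (z / z₀))
    have hshift : ∀ z, z ≠ 0 → gluingShift r₀ s z = a₀ + cover (y z) := fun z hz =>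
      gluingShift_eq s h0 hz
    have hy : HasFDerivAt y (((2 * s : ℝ) • ((-S z₀) • dNorm z₀)).prod
        ((2 * s : ℝ) • dArg z₀)) z₀ :=
      ((hasFDerivAt_gluingProfile_norm h0).const_mul (2 * s : ℝ)).prodMk
        ((hasFDerivAt_arg_div h0).const_mul (2 * s : ℝ))
    have h1 : HasFDerivAt (fun z => transL (a₀ + cover (y z)) V) _ z₀ :=
      HasFDerivAt.comp z₀ (hasFDerivAt_transL hVt hVs a₀ (y z₀)) hy
    have h2 : HasFDerivAt (fun z => m (q z)) _ z₀ := m.hasFDerivAt.comp z₀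
      (hasFDerivAt_comp_gluingProfile_norm h0 (hd _ (hR' z₀ hz₀ h0)))
    have h3 : HasFDerivAt (fun z => res (m (q z) (transL (a₀ + cover (y z)) V))) _ z₀ :=
      res.hasFDerivAt.comp z₀ (h2.clm_apply h1)
    have h4 : (fun z : ℂ => crossOp r₀ s Q Ω z V) =ᶠ[𝓝 z₀]
        fun z => res (m (q z) (transL (a₀ + cover (y z)) V)) := by
      filter_upwards [isOpen_ne.mem_nhds h0] with w hw
      simp [crossOp, show w ≠ 0 from hw, hshift w hw, res, m, q]
    refine (h3.congr_of_eventuallyEq h4).congr_fderiv ?_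
    refine ContinuousLinearMap.ext fun w => ?_
    simp only [τ, hshift z₀ h0, ContinuousLinearMap.comp_apply, add_apply,
      ContinuousLinearMap.smulRight_apply, ContinuousLinearMap.flip_apply,
      ContinuousLinearMap.prod_apply, smul_apply, map_add, map_smul,
      ContinuousLinearMap.coe_fst', ContinuousLinearMap.coe_snd', smul_eq_mul, smul_add, smul_smul,
      S, q, q']
    module
  · have hresm : ∀ (u : ℂ → ℝ →ᵇ ℝ) (W : Lp (E n) p (volume : Measure Cyl)),
        ContinuousOn u (Metric.ball 0 r₁ \ {0}) →
        ContinuousOn (fun z => res (m (u z) (τ z W))) (Metric.ball 0 r₁ \ {0}) := fun u W hu =>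
      res.continuous.comp_continuousOn ((m.continuous.comp_continuousOn hu).clm_apply (cτ W))
    exact (cS.neg.smul (hresm _ _ cq')).add ((continuousOn_const.mul cS).neg.smul (hresm _ _ cq))
  · exact (res.continuous.comp_continuousOn
      ((m.continuous.comp_continuousOn cq).clm_apply (cτ Vs))).const_smul (2 * s : ℝ)
  · have h1 : (fun z : ℂ => crossOp r₀ s Q Ω z V) 0 = 0 := by simp [crossOp]
    simp only [h1]
    have t := (tq.mul_const ‖V‖).const_mul ‖res‖
    rw [zero_mul, mul_zero] at t
    refine squeeze_zero_norm' ?_ t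
    filter_upwards [self_mem_nhdsWithin] with z hz
    have : z ≠ 0 := hz
    simpa [crossOp, this] using nb (q z) z V
  · have t := ((tSq'.mul_const ‖V‖).const_mul ‖res‖).add
      (((tSq.mul_const ‖Vt‖).const_mul ‖res‖).const_mul |(2 * s : ℝ)|)
    simp only [zero_mul, mul_zero, add_zero] at t
    refine squeeze_zero_norm' (Eventually.of_forall fun z => ?_) t
    refine (norm_add_le _ _).trans ?_
    rw [norm_smul, norm_smul, norm_neg, norm_neg, norm_mul, Real.norm_of_nonneg (hS0 z),
      Real.norm_eq_abs]
    have e1 := mul_le_mul_of_nonneg_left (nb (q' z) z V) (hS0 z)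
    have e2 := mul_le_mul_of_nonneg_left (nb (q z) z Vt)
      (mul_nonneg (abs_nonneg (2 * s : ℝ)) (hS0 z))
    refine (add_le_add e1 e2).trans (le_of_eq ?_)
    ring
  · have t := ((tSq.mul_const ‖Vs‖).const_mul ‖res‖).const_mul |(2 * s : ℝ)|
    simp only [zero_mul, mul_zero] at t
    refine squeeze_zero' (Eventually.of_forall fun z => by positivity) ?_ t
    filter_upwards [eventually_inv_norm_le_profileSpeed r₀] with z hz
    rw [norm_smul, Real.norm_eq_abs]
    calc ‖z‖⁻¹ * (|(2 * s : ℝ)| * ‖res (m (q z) (τ z Vs))‖)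
        ≤ S z * (|(2 * s : ℝ)| * (‖res‖ * (‖q z‖ * ‖Vs‖))) := by
          gcongr
          · exact hS0 z
          · exact nb (q z) z Vs
      _ = _ := by ring

end Terms

/-! ### The filled section on one half-cylinder -/

section Side

variable {n k : ℕ} {p : ℝ≥0∞} [Fact (1 ≤ p)] {Ω : Set Cyl}

/-- The weak derivative `∂_t^i ∂_s^j` of an element of the Sobolev space (zero for an order above
`k`). -/
def jet (i j : ℕ) : sobolev n k p Ω →L[ℝ] Lp (E n) p (volume.restrict Ω) :=
  if h : i + j ≤ k then
    (PiLp.proj p (𝕜 := ℝ) (fun _ : MIdx k => Lp (E n) p (volume.restrict Ω))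
      ⟨(⟨i, by omega⟩, ⟨j, by omega⟩), h⟩).comp (sobolev n k p Ω).subtypeL
  else 0

theorem jet_apply {i j : ℕ} (h : i + j ≤ k) (v : sobolev n k p Ω) :
    jet i j v = v.1 ⟨(⟨i, by omega⟩, ⟨j, by omega⟩), h⟩ := by
  simp [jet, h]

theorem jet_zero (v : sobolev n k p Ω) : jet 0 0 v = v.1 (MIdx.zero k) :=
  jet_apply (Nat.zero_le k) v

theorem isFam_jet (v : sobolev n k p Ω) : IsFam k Ω (fun i j => jet i j v) := by
  intro d i j hij
  have h1 : i + j ≤ k := by omega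
  have h2 : (i + if d then 0 else 1) + (j + if d then 1 else 0) ≤ k := by
    cases d <;> simp <;> omega
  simp only [jet_apply h1, jet_apply h2]
  exact v.2 d _ _ ⟨rfl, rfl⟩

/-- The Leibniz rule for products in `L^p`. -/
def leibL (μ : Measure Cyl) (q : ℕ → ℝ →ᵇ ℝ) (v : ℕ → ℕ → Lp (E n) p μ) (i j : ℕ) : Lp (E n) p μ :=
  ∑ a ∈ Finset.HasAntidiagonal.antidiagonal i, i.choose a.1 • mulL μ (q a.1) (v a.2 j)

theorem coeFn_leibL {μ : Measure Cyl} {q : ℕ → ℝ →ᵇ ℝ} {ψ : ℝ → ℝ}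
    (hq : ∀ m t, q m t = iteratedDeriv m ψ t) (v : ℕ → ℕ → Lp (E n) p μ) (i j : ℕ) :
    leibL μ q v i j =ᵐ[μ] leib ψ (fun i j => v i j) i j := by
  have h1 := Lp.coeFn_finsetSum (μ := μ) (p := p) (Finset.HasAntidiagonal.antidiagonal i)
    (fun a => i.choose a.1 • mulL μ (q a.1) (v a.2 j))
  have h2 : ∀ a : ℕ × ℕ, ∀ᵐ x ∂μ, (i.choose a.1 • mulL μ (q a.1) (v a.2 j) : Lp (E n) p μ) x =
      i.choose a.1 • iteratedDeriv a.1 ψ x.1 • v a.2 j x := by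
    intro a
    have e : (i.choose a.1 • mulL μ (q a.1) (v a.2 j) : Lp (E n) p μ) =
      (i.choose a.1 : ℝ) • mulL μ (q a.1) (v a.2 j) := (Nat.cast_smul_eq_nsmul ℝ _ _).symm
    rw [e]
    filter_upwards [Lp.coeFn_smul (i.choose a.1 : ℝ) (mulL μ (q a.1) (v a.2 j)),
      coeFn_mulL (q a.1) (v a.2 j)] with x h3 h4
    rw [h3, Pi.smul_apply, h4, hq, Nat.cast_smul_eq_nsmul]
  filter_upwards [h1, ae_all_iff.2 h2] with x h3 h4
  rw [leibL, h3, Finset.sum_apply]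
  exact Finset.sum_congr rfl fun a _ => h4 a

variable {X : Type*} [NormedAddCommGroup X] [NormedSpace ℝ X]

/-- The function with components `J`, cut off by `χ` and extended by zero. -/
def cutL (hΩ : MeasurableSet Ω) (χ : ℕ → ℝ →ᵇ ℝ)
    (J : ℕ → ℕ → X →L[ℝ] Lp (E n) p (volume.restrict Ω)) (i j : ℕ) :
    X →L[ℝ] Lp (E n) p (volume : Measure Cyl) :=
  ∑ a ∈ Finset.HasAntidiagonal.antidiagonal i,
    i.choose a.1 • (mulL volume (χ a.1)).comp ((extL hΩ).comp (J a.2 j))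

theorem cutL_apply (hΩ : MeasurableSet Ω) (χ : ℕ → ℝ →ᵇ ℝ)
    (J : ℕ → ℕ → X →L[ℝ] Lp (E n) p (volume.restrict Ω)) (i j : ℕ) (u : X) :
    cutL hΩ χ J i j u = leibL volume χ (fun i j => extL hΩ (J i j u)) i j := by
  simp [cutL, leibL]

theorem coeFn_cutL (hΩ : MeasurableSet Ω) {χ : ℕ → ℝ →ᵇ ℝ} {ψ : ℝ → ℝ}
    (hχ : ∀ m t, χ m t = iteratedDeriv m ψ t)
    (J : ℕ → ℕ → X →L[ℝ] Lp (E n) p (volume.restrict Ω)) (i j : ℕ) (u : X) :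
    cutL hΩ χ J i j u =ᵐ[volume] Ω.indicator (leib ψ (fun i j => J i j u) i j) := by
  rw [cutL_apply]
  have h2 : ∀ a : ℕ, extL hΩ (J a j u) =ᵐ[volume] Ω.indicator (J a j u) :=
    fun a => coeFn_extL hΩ _
  filter_upwards [coeFn_leibL hχ (fun i j => extL hΩ (J i j u)) i j, ae_all_iff.2 h2] with x h3 h4
  rw [h3]
  by_cases hx : x ∈ Ω
  · simp only [leib, h4, hx, indicator_of_mem]
  · simp [leib, h4, hx]

/-- Extension by zero alone would create a jump at the boundary of `Ω`. The cutoff is supported away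
from it, so the weak derivatives persist on the whole cylinder. -/
theorem isFam_cutL (hΩ : IsOpen Ω) {χ : ℕ → ℝ →ᵇ ℝ} {ψ : ℝ → ℝ}
    (hχ : ∀ m t, χ m t = iteratedDeriv m ψ t) (hψ : ContDiff ℝ ∞ ψ)
    (hs : ∀ x : Cyl, x.1 ∈ tsupport ψ → x ∈ Ω)
    {J : ℕ → ℕ → X →L[ℝ] Lp (E n) p (volume.restrict Ω)} {u : X}
    (hJ : IsFam k Ω (fun i j => J i j u)) :
    IsFam k univ (fun i j => cutL hΩ.measurableSet χ J i j u) := by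
  refine (hJ.mul_indicator (Ω' := univ) hΩ hψ fun x _ hx => hs x hx).congr_ae fun i j _ => ?_
  rw [Measure.restrict_univ]
  exact coeFn_cutL hΩ.measurableSet hχ J i j u

variable {r₀ r₁ : ℝ}

/-- The components of the filled section on one half-cylinder. -/
def sideL (r₀ : ℝ) (s : ℤ) (δ : ℝ) (Qd Qc : ℕ → ℝ → ℝ →ᵇ ℝ)
    (J : ℕ → ℕ → X →L[ℝ] Lp (E n) p (volume.restrict Ω))
    (V : ℕ → ℕ → X →L[ℝ] Lp (E n) p (volume : Measure Cyl)) (i j : ℕ) (z : ℂ) :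
    X →L[ℝ] Lp (E n) p (volume.restrict Ω) :=
  J (i + 1) j + (s * δ) • J i j +
    ∑ a ∈ Finset.HasAntidiagonal.antidiagonal i,
      i.choose a.1 • (diagOp r₀ (Qd a.1) (volume.restrict Ω) z).comp (J a.2 j) +
    ∑ a ∈ Finset.HasAntidiagonal.antidiagonal i,
      i.choose a.1 • (crossOp r₀ s (Qc a.1) Ω z).comp (V a.2 j)

variable {s : ℤ} {δ : ℝ} {Qd Qc : ℕ → ℝ → ℝ →ᵇ ℝ}
  {J : ℕ → ℕ → X →L[ℝ] Lp (E n) p (volume.restrict Ω)}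
  {V : ℕ → ℕ → X →L[ℝ] Lp (E n) p (volume : Measure Cyl)}

theorem sideL_zero (i j : ℕ) (u : X) :
    sideL r₀ s δ Qd Qc J V i j 0 u = J (i + 1) j u + (s * δ) • J i j u := by
  simp [sideL, diagOp, crossOp]

theorem sideL_apply {z : ℂ} (hz : z ≠ 0) (i j : ℕ) (u : X) :
    sideL r₀ s δ Qd Qc J V i j z u = J (i + 1) j u + (s * δ) • J i j u +
      leibL (volume.restrict Ω) (fun m => Qd m (gluingProfile r₀ ‖z‖)) (fun i j => J i j u) i j +
      LpToLpRestrictCLM Cyl (E n) ℝ volume p Ω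
        (leibL volume (fun m => Qc m (gluingProfile r₀ ‖z‖))
          (fun i j => transL (gluingShift r₀ s z) (V i j u)) i j) := by
  simp [sideL, diagOp, crossOp, hz, leibL, map_sum]

theorem coeFn_sideL_zero (i j : ℕ) (u : X) :
    sideL r₀ s δ Qd Qc J V i j 0 u =ᵐ[volume.restrict Ω]
      (J (i + 1) j u : Cyl → E n) + (s * δ) • (J i j u : Cyl → E n) := by
  rw [sideL_zero]
  filter_upwards [Lp.coeFn_add (J (i + 1) j u) ((s * δ) • J i j u),
    Lp.coeFn_smul (s * δ : ℝ) (J i j u)] with x h1 h2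
  rw [h1, Pi.add_apply, h2, Pi.add_apply]

theorem coeFn_sideL {ψd ψc : ℝ → ℝ} {z : ℂ} (hz : z ≠ 0)
    (hd : ∀ m t, Qd m (gluingProfile r₀ ‖z‖) t = iteratedDeriv m ψd t)
    (hc : ∀ m t, Qc m (gluingProfile r₀ ‖z‖) t = iteratedDeriv m ψc t) (i j : ℕ) (u : X) :
    sideL r₀ s δ Qd Qc J V i j z u =ᵐ[volume.restrict Ω]
      (J (i + 1) j u : Cyl → E n) + (s * δ) • (J i j u : Cyl → E n) +
        leib ψd (fun i j => J i j u) i j +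
        leib ψc (fun i j x => V i j u (gluingShift r₀ s z + x)) i j := by
  rw [sideL_apply hz]
  set A := J (i + 1) j u
  set B := (s * δ : ℝ) • J i j u with hB
  set C := leibL (volume.restrict Ω) (fun m => Qd m (gluingProfile r₀ ‖z‖)) (fun i j => J i j u) i j
    with hC
  set D := leibL volume (fun m => Qc m (gluingProfile r₀ ‖z‖))
          (fun i j => transL (gluingShift r₀ s z) (V i j u)) i j with hD
  have eD := ae_restrict_of_ae (s := Ω)
    (coeFn_leibL hc (fun i j => transL (gluingShift r₀ s z) (V i j u)) i j)
  have et : ∀ m : ℕ, ∀ᵐ x ∂volume.restrict Ω,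
      transL (gluingShift r₀ s z) (V m j u) x = V m j u (gluingShift r₀ s z + x) :=
    fun m => ae_restrict_of_ae (coeFn_transL _ _)
  filter_upwards [Lp.coeFn_add (A + B + C) (LpToLpRestrictCLM Cyl (E n) ℝ volume p Ω D),
    Lp.coeFn_add (A + B) C, Lp.coeFn_add A B, Lp.coeFn_smul (s * δ : ℝ) (J i j u),
    coeFn_leibL hd (fun i j => J i j u) i j, LpToLpRestrictCLM_coeFn ℝ Ω D, eD,
    ae_all_iff.2 et] with x h1 h2 h3 h4 h5 h6 h7 h8
  rw [h1, Pi.add_apply, h2, Pi.add_apply, h3, Pi.add_apply, h4, h5, h6, h7]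
  simp only [Pi.add_apply, leib, h8]

/-- Each summand is a family of derivatives: a shift of index for `∂_t`, which costs one order, and
Leibniz families for the products. -/
theorem isFam_sideL (hk : 1 ≤ k) (hΩ : IsOpen Ω) {u : X} (hJ : IsFam k Ω (fun i j => J i j u))
    (hV : IsFam k univ (fun i j => V i j u)) {z : ℂ} {ψd ψc : ℝ → ℝ} (hψd : ContDiff ℝ ∞ ψd)
    (hψc : ContDiff ℝ ∞ ψc)
    (hd : z ≠ 0 → ∀ m t, Qd m (gluingProfile r₀ ‖z‖) t = iteratedDeriv m ψd t)
    (hc : z ≠ 0 → ∀ m t, Qc m (gluingProfile r₀ ‖z‖) t = iteratedDeriv m ψc t) :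
    IsFam (k - 1) Ω (fun i j => sideL r₀ s δ Qd Qc J V i j z u) := by
  obtain ⟨k, rfl⟩ : ∃ m, k = m + 1 := ⟨k - 1, by omega⟩
  rw [Nat.add_sub_cancel]
  have h12 := hJ.dt.add ((hJ.mono k.le_succ).const_smul (s * δ : ℝ))
  rcases eq_or_ne z 0 with rfl | hz
  · exact h12.congr_ae fun i j _ => coeFn_sideL_zero i j u
  · have h3 := (hJ.mono k.le_succ).mul_indicator (Ω' := Ω) hΩ hψd fun x hx _ => hx
    have h4 := ((hV.mono k.le_succ).translate (gluingShift r₀ s z)).mul_indicator (Ω' := Ω)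
      isOpen_univ hψc fun x _ _ => mem_univ x
    refine ((h12.add h3).add h4).congr_ae fun i j _ => ?_
    filter_upwards [coeFn_sideL (δ := δ) (J := J) (V := V) hz (hd hz) (hc hz) i j u,
      ae_restrict_mem hΩ.measurableSet] with x h5 h6
    rw [h5]
    simp [h6]

variable [Fact (p ≠ ⊤)] [CompleteSpace X]

/-- The condition `i + j + 1 ≤ k` leaves the one derivative that is lost when the translation is
differentiated. -/
theorem contDiffOn_sideL {fd fc : Prop} (hd : ∀ m, IsCoef (Real.exp (1 / r₀)) fd (Qd m))
    (hc : ∀ m, IsCoef (Real.exp (1 / r₀)) fc (Qc m)) (hf : fc)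
    (hR : ∀ r ∈ Ioo 0 r₁, 1 < gluingProfile r₀ r)
    (hV : ∀ u, IsFam k univ (fun i j => V i j u)) {i j : ℕ} (hij : i + j + 1 ≤ k) :
    ContDiffOn ℝ 1 (fun q : X × ℂ => sideL r₀ s δ Qd Qc J V i j q.2 q.1)
      (univ ×ˢ Metric.ball 0 r₁) := by
  refine contDiffOn_one_of_linear_family Metric.isOpen_ball fun u => ?_
  simp only [sideL, add_apply, smul_apply, sum_apply,
    ContinuousLinearMap.comp_apply]
  refine (contDiffOn_const.add (ContDiffOn.sum fun a _ => ?_)).add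
    (ContDiffOn.sum fun a ha => ?_)
  · exact (contDiffOn_diagOp (hd a.1) hR _ _).const_smul _
  · have ha' : a.1 + a.2 = i := Finset.HasAntidiagonal.mem_antidiagonal.1 ha
    exact (contDiffOn_crossOp (hc a.1) hf hR s Ω (hV u false a.2 j (by omega))
      (hV u true a.2 j (by omega))).const_smul _

theorem exists_sideSection (hk : 1 ≤ k) (hΩ : IsOpen Ω)
    (hJ : ∀ u, IsFam k Ω (fun i j => J i j u)) (hV : ∀ u, IsFam k univ (fun i j => V i j u))
    {ψd ψc : ℝ → ℝ → ℝ} (hψd : ∀ R, ContDiff ℝ ∞ (ψd R)) (hψc : ∀ R, ContDiff ℝ ∞ (ψc R))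
    {fd fc : Prop} (hd : ∀ m, IsCoef (Real.exp (1 / r₀)) fd (Qd m))
    (hc : ∀ m, IsCoef (Real.exp (1 / r₀)) fc (Qc m)) (hf : fc)
    (hd' : ∀ m R, 1 < R → ∀ t, Qd m R t = iteratedDeriv m (ψd R) t)
    (hc' : ∀ m R, 1 < R → ∀ t, Qc m R t = iteratedDeriv m (ψc R) t)
    (hR : ∀ r ∈ Ioo 0 r₁, 1 < gluingProfile r₀ r) :
    ∃ Ψ : X × ℂ → sobolev n (k - 1) p Ω, ContDiffOn ℝ 1 Ψ (univ ×ˢ Metric.ball 0 r₁) ∧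
      ∀ u, ∀ z ∈ Metric.ball (0 : ℂ) r₁,
        (Ψ (u, z)).1 (MIdx.zero (k - 1)) = sideL r₀ s δ Qd Qc J V 0 0 z u := by
  classical
  have hmem : ∀ u, ∀ z ∈ Metric.ball (0 : ℂ) r₁,
      WithLp.toLp p (fun a : MIdx (k - 1) => sideL r₀ s δ Qd Qc J V a.1.1 a.1.2 z u) ∈
        sobolev n (k - 1) p Ω := by
    intro u z hz d a c hac
    have h1 : z ≠ 0 → 1 < gluingProfile r₀ ‖z‖ := fun h0 =>
      hR _ ⟨norm_pos_iff.2 h0, by simpa using hz⟩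
    have h2 := isFam_sideL (s := s) (δ := δ) hk hΩ (hJ u) (hV u) (hψd (gluingProfile r₀ ‖z‖))
      (hψc (gluingProfile r₀ ‖z‖)) (fun h0 m t => hd' m _ (h1 h0) t)
      (fun h0 m t => hc' m _ (h1 h0) t)
    have h3 := h2 d a.1.1 a.1.2 (by
      have e1 := hac.1
      have e2 := hac.2
      have e3 := c.2
      cases d <;> simp at e1 e2 <;> omega)
    rw [← hac.1, ← hac.2] at h3
    exact h3
  -- Off the disk the components need not form a Sobolev function, so the value there is set to `0`.
  refine ⟨fun q => if h : q.2 ∈ Metric.ball (0 : ℂ) r₁ then ⟨_, hmem q.1 q.2 h⟩ else 0, ?_,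
    fun u z hz => ?_⟩
  · refine contDiffOn_one_of_coe (isClosed_sobolev n (k - 1) p Ω)
      (isOpen_univ.prod Metric.isOpen_ball) ?_
    refine ContDiffOn.congr (f := fun q : X × ℂ => WithLp.toLp p (fun a : MIdx (k - 1) =>
      sideL r₀ s δ Qd Qc J V a.1.1 a.1.2 q.2 q.1)) ?_ fun q hq => ?_
    · rw [contDiffOn_piLp]
      exact fun a => contDiffOn_sideL hd hc hf hR hV (by have := a.2; omega)
    · simp only [hq.2, dif_pos]
  · simp only [hz, dif_pos]
    rfl

end Side

/-! ### Cutoff functions, and bounds for the gluing profile -/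

theorem exists_cutoff {s : ℝ} (hs : s * s = 1) (b : ℝ) :
    ∃ ψ : ℝ → ℝ, ContDiff ℝ ∞ ψ ∧ (∀ t ∈ tsupport ψ, b < s * t) ∧ (∀ t, b + 2 ≤ s * t → ψ t = 1) ∧
      ∃ χ : ℕ → ℝ →ᵇ ℝ, ∀ m t, χ m t = iteratedDeriv m ψ t := by
  -- The transition takes place for `b + 1 ≤ s t ≤ b + 2`, so that even the closed support avoids `s
  -- t = b`.
  let ψ : ℝ → ℝ := fun t => Real.smoothTransition (s * t - b - 1)
  have hψ : ContDiff ℝ ∞ ψ := Real.smoothTransition.contDiff.comp (by fun_prop)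
  have h0 : ∀ t, s * t ≤ b + 1 → ψ t = 0 := fun t ht =>
    Real.smoothTransition.zero_of_nonpos (by linarith)
  have h1 : ∀ t, b + 2 ≤ s * t → ψ t = 1 := fun t ht =>
    Real.smoothTransition.one_of_one_le (by linarith)
  have hc : HasCompactSupport (deriv ψ) := by
    refine HasCompactSupport.intro (isCompact_Icc (a := -(|b| + 2)) (b := |b| + 2)) fun t ht => ?_
    have ht' : |b| + 2 < |s * t| := by
      have : |s| = 1 := by nlinarith [abs_mul_abs_self s, abs_nonneg s]
      rw [abs_mul, this, one_mul]
      exact not_le.1 fun hh => ht (abs_le.1 hh)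
    have hcont : Continuous fun t : ℝ => s * t := by fun_prop
    have hb := neg_abs_le b
    have hb' := le_abs_self b
    rcases lt_abs.1 ht' with h | h
    · have : ψ =ᶠ[𝓝 t] fun _ => 1 := by
        filter_upwards [(isOpen_Ioi.preimage hcont).mem_nhds h] with y hy
        exact h1 y (by have : |b| + 2 < s * y := hy; linarith)
      simp [this.deriv_eq]
    · have : ψ =ᶠ[𝓝 t] fun _ => 0 := by
        filter_upwards [(isOpen_Iio.preimage hcont).mem_nhds
          (show s * t < -(|b| + 2) by linarith)] with y hy
        exact h0 y (by have : s * y < -(|b| + 2) := hy; linarith)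
      simp [this.deriv_eq]
  have hb : ∀ m, ∃ C, ∀ t, |iteratedDeriv m ψ t| ≤ C := by
    intro m
    rcases m with _ | m
    · refine ⟨1, fun t => ?_⟩
      rw [iteratedDeriv_zero, abs_of_nonneg (Real.smoothTransition.nonneg _)]
      exact Real.smoothTransition.le_one _
    · rw [iteratedDeriv_succ']
      exact (hc.mono' (subset_closure.trans
        (tsupport_iteratedDeriv_subset _ m))).exists_bound_of_continuous
        (contDiff_iteratedDeriv (contDiff_infty_iff_deriv.1 hψ).2 m).continuous
  choose C hC using hb
  refine ⟨ψ, hψ, fun t ht => ?_, h1, fun m => toBCF (iteratedDeriv m ψ)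
    (contDiff_iteratedDeriv hψ m).continuous (hC m), fun m t => rfl⟩
  have hcl : IsClosed {t : ℝ | b + 1 ≤ s * t} := isClosed_le continuous_const (by fun_prop)
  have : t ∈ {t : ℝ | b + 1 ≤ s * t} := by
    refine closure_minimal (fun y hy => ?_) hcl ht
    by_contra hn
    exact hy (h0 y (not_le.1 hn).le)
  have h2 : b + 1 ≤ s * t := this
  linarith

/-- If the profile were at most `e²` at `r`, it would take the value `e²` at some `ρ ≤ r`. There `L
= 4e`, and the fit condition reads `b + 16e < e²`, which is false. -/
theorem exp_two_lt_gluingProfile {b r₀ r₁ : ℝ} (hb : 0 ≤ b)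
    (hfit : ∀ r ∈ Ioo 0 r₁, b + 4 * lengthFn (gluingProfile r₀ r) < gluingProfile r₀ r)
    {r : ℝ} (hr : r ∈ Ioo 0 r₁) : Real.exp 2 < gluingProfile r₀ r := by
  by_contra! hle
  have hexp := Real.exp_pos (1 / r₀)
  have h1 : 1 < Real.exp 2 := Real.one_lt_exp_iff.2 two_pos
  set ρ := 1 / Real.log (Real.exp 2 + Real.exp (1 / r₀)) with hρ
  have hlog : 0 < Real.log (Real.exp 2 + Real.exp (1 / r₀)) := Real.log_pos (by linarith)
  have h2 : 1 / ρ = Real.log (Real.exp 2 + Real.exp (1 / r₀)) := by rw [hρ, one_div_one_div]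
  have h3 : gluingProfile r₀ ρ = Real.exp 2 := by
    rw [gluingProfile, h2, Real.exp_log (by linarith)]
    ring
  have h4 : ρ ≤ r := by
    have : 1 / r ≤ 1 / ρ := by
      rw [h2, Real.le_log_iff_exp_le (by linarith), ← gluingProfile_add r₀ r]
      linarith
    exact (one_div_le_one_div hr.1 (by positivity)).1 this
  have h5 := hfit ρ ⟨by positivity, h4.trans_lt hr.2⟩
  rw [h3, lengthFn, Real.log_exp] at h5
  have h6 : √(Real.exp 2) = Real.exp 1 := by
    rw [show (2 : ℝ) = 1 + 1 by norm_num, Real.exp_add, Real.sqrt_mul_self (Real.exp_pos 1).le]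
  have h7 : Real.exp 2 = Real.exp 1 * Real.exp 1 := by
    rw [← Real.exp_add]
    norm_num
  rw [h6, h7] at h5
  have h8 := Real.exp_one_lt_d9
  nlinarith [Real.exp_pos 1]

theorem one_le_lengthFn {R : ℝ} (hR : Real.exp 2 < R) : 1 ≤ lengthFn R := by
  have h1 : 1 < Real.exp 2 := Real.one_lt_exp_iff.2 two_pos
  have h2 : 2 ≤ Real.log R := (Real.le_log_iff_exp_le (by linarith)).2 hR.le
  have h3 : 1 ≤ √R := Real.one_le_sqrt.2 (by linarith)
  have h4 : 1 ≤ Real.log R ^ 2 := one_le_pow₀ (by linarith)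
  exact one_le_mul_of_one_le_of_one_le h3 h4

/-! ### The filled section on one half-cylinder in terms of functions -/

section Half

variable {n k : ℕ} {p : ℝ≥0∞} [Fact (1 ≤ p)] {Ω Ω' : Set Cyl} {s : ℤ} {b δ r₀ r₁ : ℝ}

theorem leib_zero_left (ψ : ℝ → ℝ) (v : ℕ → ℕ → Cyl → E n) (j : ℕ) (x : Cyl) :
    leib ψ v 0 j x = ψ x.1 • v 0 j x := by
  simp [leib]

/-- The weak derivative `∂_t u` of an element of the weighted Sobolev space, on a half-cylinder on
which `|t| = -s t`. -/
def dtFun (s : ℤ) (δ : ℝ) (v : sobolev n k p Ω) (x : Cyl) : E n :=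
  Real.exp (s * δ * x.1) • (jet 1 0 v x + (s * δ) • jet 0 0 v x)

theorem toFun_eq (hΩ : ∀ x ∈ Ω, |x.1| = -(s * x.1)) (v : sobolev n k p Ω) {x : Cyl} (hx : x ∈ Ω) :
    WSob.toFun (δ := δ) v x = Real.exp (s * δ * x.1) • jet 0 0 v x := by
  rw [WSob.toFun, hΩ x hx, jet_zero]
  congr 2
  ring

theorem hasWeakDeriv_toFun (hk : 1 ≤ k) (hΩo : IsOpen Ω) (hΩ : ∀ x ∈ Ω, |x.1| = -(s * x.1))
    (v : sobolev n k p Ω) :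
    HasWeakDeriv (coordDeriv false) Ω (WSob.toFun (δ := δ) v) (dtFun s δ v) := by
  have h1 := isFam_jet v false 0 0 hk
  have h2 : ContDiff ℝ ∞ fun t : ℝ => Real.exp (s * δ * t) := by fun_prop
  have h3 := h1.mul_indicator (Ω' := Ω) hΩo h2 fun x hx _ => hx
  refine h3.congr_ae ?_ ?_
  · filter_upwards [ae_restrict_mem hΩo.measurableSet] with x hx
    rw [toFun_eq hΩ v hx, indicator_of_mem hx]
  · filter_upwards [ae_restrict_mem hΩo.measurableSet] with x hx
    rw [indicator_of_mem hx, dtFun]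
    have h4 : deriv (fun t : ℝ => Real.exp (s * δ * t)) x.1 =
        Real.exp (s * δ * x.1) * (s * δ) := by
      have : HasDerivAt (fun t : ℝ => s * δ * t) (s * δ : ℝ) x.1 := by
        simpa using (hasDerivAt_id x.1).const_mul (s * δ : ℝ)
      exact this.exp.deriv
    simp only [dcoef, Bool.false_eq_true, if_false, h4]
    rw [smul_add, smul_smul, add_comm]

/-- The sign `s` is `1` for `C_-` and `-1` for `C_+`; `Ω'` is the opposite half-cylinder. For `v =
e^{-sδt} u` the operator `∂_t` becomes `∂_t + sδ`, the diagonal coefficient is unchanged, and the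
cross coefficient acquires `e^{-sδt} e^{-sδ(t+2sR)} = e^{-2δs(t+sR)}`. -/
theorem exists_halfSection [Fact (p ≠ ⊤)] {X : Type*} [NormedAddCommGroup X] [NormedSpace ℝ X]
    [CompleteSpace X] (hk : 1 ≤ k) (hs : s * s = 1) (hb : 0 ≤ b) (hδ : 0 < δ)
    (hΩ : Ω = {x | b < -(s * x.1)}) (hΩ' : Ω' = {x | b < s * x.1})
    (hfit : ∀ r ∈ Ioo 0 r₁, b + 4 * lengthFn (gluingProfile r₀ r) < gluingProfile r₀ r)
    (π : X →L[ℝ] sobolev n k p Ω) (π' : X →L[ℝ] sobolev n k p Ω')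
    {φd φc : ℝ → ℝ} (hφd : IsBump φd) (hφc : IsBump φc) :
    ∃ Ψ : X × ℂ → sobolev n (k - 1) p Ω, ContDiffOn ℝ 1 Ψ (univ ×ˢ Metric.ball 0 r₁) ∧
      ∀ u, ∀ z ∈ Metric.ball (0 : ℂ) r₁,
        (z = 0 → WSob.toFun (δ := δ) (Ψ (u, z)) =ᵐ[volume.restrict Ω] dtFun s δ (π u)) ∧
        (z ≠ 0 → WSob.toFun (δ := δ) (Ψ (u, z)) =ᵐ[volume.restrict Ω] fun x =>
          dtFun s δ (π u) x +
          (lam (gluingProfile r₀ ‖z‖) * φd (lam (gluingProfile r₀ ‖z‖) *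
            (x.1 + s * gluingProfile r₀ ‖z‖) + 3 * s)) • WSob.toFun (δ := δ) (π u) x +
          (lam (gluingProfile r₀ ‖z‖) * φc (lam (gluingProfile r₀ ‖z‖) *
            (x.1 + s * gluingProfile r₀ ‖z‖) - 3 * s)) •
            Ω'.indicator (WSob.toFun (δ := δ) (π' u)) (gluingShift r₀ s z + x)) := by
  have hs' : (s : ℝ) * s = 1 := by exact_mod_cast hs
  have hsabs : |(s : ℝ)| = 1 := by nlinarith [abs_mul_abs_self (s : ℝ), abs_nonneg (s : ℝ)]
  have hΩo : IsOpen Ω := by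
    rw [hΩ]
    exact isOpen_lt (by fun_prop) (by fun_prop)
  have hΩo' : IsOpen Ω' := by
    rw [hΩ']
    exact isOpen_lt (by fun_prop) (by fun_prop)
  have habs : ∀ x ∈ Ω, |x.1| = -(s * x.1) := by
    intro x hx
    rw [hΩ] at hx
    have : b < -(s * x.1) := hx
    rw [← one_mul |x.1|, ← hsabs, ← abs_mul, abs_of_neg (by linarith)]
  have habs' : ∀ x ∈ Ω', |x.1| = s * x.1 := by
    intro x hx
    rw [hΩ'] at hx
    have : b < s * x.1 := hx
    rw [← one_mul |x.1|, ← hsabs, ← abs_mul, abs_of_pos (by linarith)]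
  have hR2 : ∀ r ∈ Ioo 0 r₁, Real.exp 2 < gluingProfile r₀ r := fun r hr =>
    exp_two_lt_gluingProfile hb hfit hr
  have hR : ∀ r ∈ Ioo 0 r₁, 1 < gluingProfile r₀ r := fun r hr =>
    (Real.one_lt_exp_iff.2 two_pos).trans (hR2 r hr)
  obtain ⟨ψ, hψ, hψs, hψ1, χ, hχ⟩ := exists_cutoff hs' b
  have hc0 : 0 ≤ Real.exp (1 / r₀) := (Real.exp_pos _).le
  choose Qd hQd eQd using fun m => exists_isCoef_iteratedDeriv hc0 (ε := s) (σ := s) (κ := 0)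
    (η := 0) (fun y _ => by simp) le_rfl (Or.inl rfl) m hφd le_rfl
  -- On the support of the bump `s (y + 3s) ≥ 2`, whence the rate `4δ = 2δ · 2`.
  have hη : ∀ y : ℝ, |y| ≤ 1 → 4 * δ ≤ 2 * δ * s * (y - 3 * (-s : ℝ)) := by
    intro y hy
    have h1 : |s * y| ≤ 1 := by rwa [abs_mul, hsabs, one_mul]
    have h2 := (abs_le.1 h1).1
    have h3 : 2 * δ * s * (y - 3 * (-s : ℝ)) = 2 * δ * (s * y) + 6 * δ * (s * s) := by ring
    rw [h3, hs']
    nlinarith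
  choose Qc hQc eQc using fun m => exists_isCoef_iteratedDeriv hc0 (ε := s) (σ := -s)
    (κ := 2 * δ * s) (η := 4 * δ) hη (by positivity) (Or.inr (by positivity)) m hφc le_rfl
  let J : ℕ → ℕ → X →L[ℝ] Lp (E n) p (volume.restrict Ω) := fun i j => (jet i j).comp π
  let J' : ℕ → ℕ → X →L[ℝ] Lp (E n) p (volume.restrict Ω') := fun i j => (jet i j).comp π'
  let V := cutL hΩo'.measurableSet χ J'
  have hJ : ∀ u, IsFam k Ω (fun i j => J i j u) := fun u => isFam_jet (π u)
  have hJ' : ∀ u, IsFam k Ω' (fun i j => J' i j u) := fun u => isFam_jet (π' u)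
  have hV : ∀ u, IsFam k univ (fun i j => V i j u) := fun u =>
    isFam_cutL hΩo' hχ hψ (fun x hx => by rw [hΩ']; exact hψs _ hx) (hJ' u)
  obtain ⟨Ψ, hΨ, eΨ⟩ := exists_sideSection (s := s) (δ := δ) hk hΩo hJ hV
    (fun R => contDiff_coef hφd 1 R) (fun R => contDiff_coef hφc 1 R) hQd hQc (by positivity)
    eQd eQc hR
  refine ⟨Ψ, hΨ, fun u z hz => ⟨fun h0 => ?_, fun h0 => ?_⟩⟩
  · subst h0
    have h1 := coeFn_sideL_zero (r₀ := r₀) (s := s) (δ := δ) (Qd := Qd) (Qc := Qc) (J := J) (V := V)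
      0 0 u
    filter_upwards [h1, ae_restrict_mem hΩo.measurableSet] with x h2 hx
    rw [toFun_eq habs _ hx, jet_zero, eΨ u 0 hz, h2]
    rfl
  · have hr : ‖z‖ ∈ Ioo 0 r₁ := ⟨norm_pos_iff.2 h0, by simpa using hz⟩
    have h1 := hR _ hr
    have h2 := coeFn_sideL (s := s) (δ := δ) (J := J) (V := V) h0 (fun m t => eQd m _ h1 t)
      (fun m t => eQc m _ h1 t) 0 0 u
    have h3 : ∀ᵐ x ∂volume.restrict Ω, V 0 0 u (gluingShift r₀ s z + x) =
        Ω'.indicator (leib ψ (fun i j => J' i j u) 0 0) (gluingShift r₀ s z + x) :=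
      ae_restrict_of_ae ((measurePreserving_add_left volume
        (gluingShift r₀ s z)).quasiMeasurePreserving.ae
          (coeFn_cutL hΩo'.measurableSet hχ J' 0 0 u))
    filter_upwards [h2, h3, ae_restrict_mem hΩo.measurableSet] with x e2 e3 hx
    rw [toFun_eq habs _ hx, jet_zero, eΨ u z hz, e2]
    set R := gluingProfile r₀ ‖z‖ with hRdef
    have hl := lengthFn_pos h1
    have hl1 := one_le_lengthFn (hR2 _ hr)
    have hlam : lam R * lengthFn R = 1 := inv_mul_cancel₀ hl.ne'
    have hfit' := hfit _ hr
    simp only [Pi.add_apply, Pi.smul_apply, leib_zero_left, e3]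
    have hcross : Real.exp (s * δ * x.1) • coef s (-s) (2 * δ * s) 1 φc R x.1 •
        Ω'.indicator (leib ψ (fun i j => J' i j u) 0 0) (gluingShift r₀ s z + x) =
        (lam R * φc (lam R * (x.1 + s * R) - 3 * s)) •
          Ω'.indicator (WSob.toFun (δ := δ) (π' u)) (gluingShift r₀ s z + x) := by
      by_cases hy : gluingShift r₀ s z + x ∈ Ω'
      swap
      · simp [hy]
      rw [indicator_of_mem hy, indicator_of_mem hy, toFun_eq (s := -s)
        (fun x hx => by rw [habs' x hx]; simp) _ hy, coef]
      have e4 : lam R * (x.1 + s * R) + 3 * -(s : ℝ) = lam R * (x.1 + s * R) - 3 * s := by ring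
      rw [e4]
      by_cases hφ : φc (lam R * (x.1 + s * R) - 3 * s) = 0
      · simp [hφ]
      have h5 : |lam R * (x.1 + s * R) - 3 * s| ≤ 1 := not_lt.1 fun hh => hφ (hφc.zero _ hh)
      have h6 : |s * (lam R * (x.1 + s * R) - 3 * s)| ≤ 1 := by rwa [abs_mul, hsabs, one_mul]
      have h7 := (abs_le.1 h6).1
      have h8 : (gluingShift r₀ s z + x).1 = 2 * s * R + x.1 := rfl
      have h9 : s * (gluingShift r₀ s z + x).1 = s * (x.1 + s * R) + R := by
        rw [h8]
        linear_combination R * hs'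
      have h10 : 2 ≤ lam R * (s * (x.1 + s * R)) := by nlinarith
      have h11 : 2 * lengthFn R ≤ s * (x.1 + s * R) := by
        have := mul_le_mul_of_nonneg_right h10 hl.le
        nlinarith
      -- Where the cross coefficient is nonzero, the translated point lies at `s t ≥ R + 2 L(R) ≥ b
      -- + 2`. So the cutoff is `1` there and has not altered the term.
      have h12 : ψ (gluingShift r₀ s z + x).1 = 1 := hψ1 _ (by rw [h9]; linarith)
      simp only [leib_zero_left, h12, one_smul, smul_smul, J',
        ContinuousLinearMap.comp_apply]
      congr 1
      rw [pow_one, mul_comm, mul_assoc, ← Real.exp_add, h8]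
      congr 2
      push_cast
      ring
    rw [smul_add, smul_add, hcross]
    congr 2
    rw [toFun_eq habs _ hx, smul_smul, smul_smul]
    congr 1
    simp [coef, mul_comm]

end Half

/-! ### The splicing matrix -/

section Splicing

variable {n : ℕ}

theorem matAct_mul (M N : Matrix (Fin 2) (Fin 2) ℝ) (v : E n × E n) :
    matAct (M * N) v = matAct M (matAct N v) := by
  ext1 <;> simp only [matAct, Matrix.mul_apply, Fin.sum_univ_two] <;> module

theorem matAct_add (M : Matrix (Fin 2) (Fin 2) ℝ) (v w : E n × E n) :
    matAct M (v + w) = matAct M v + matAct M w := by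
  ext1 <;> simp only [matAct, Prod.fst_add, Prod.snd_add] <;> module

theorem add_matAct (M N : Matrix (Fin 2) (Fin 2) ℝ) (v : E n × E n) :
    matAct (M + N) v = matAct M v + matAct N v := by
  ext1 <;> simp only [matAct, Prod.fst_add, Prod.snd_add, Matrix.add_apply] <;> module

theorem matAct_one (v : E n × E n) : matAct 1 v = v := by
  ext1 <;> simp [matAct]

/-- By the product rule the new term is `T⁻¹(T' + ω T)`, and `ω T` removes the first row of `T'`;
there remains `T⁻¹` applied to the matrix with rows `0` and `(q', m')`. -/
theorem splicing_conj {m q m' q' : ℝ} (hD : m * m + q * q ≠ 0) (v v' : E n × E n) :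
    matAct (!![m, -q; q, m])⁻¹ (matAct !![m, -q; q, m] v' + matAct !![m', -q'; q', m'] v +
      matAct (-(!![m', -q'; 0, 0] * (!![m, -q; q, m])⁻¹)) (matAct !![m, -q; q, m] v)) =
    v' + matAct !![q * q' / (m * m + q * q), q * m' / (m * m + q * q);
      m * q' / (m * m + q * q), m * m' / (m * m + q * q)] v := by
  have hdet : (!![m, -q; q, m] : Matrix (Fin 2) (Fin 2) ℝ).det = m * m + q * q := by
    rw [Matrix.det_fin_two_of]
    ring
  have hu : IsUnit (!![m, -q; q, m] : Matrix (Fin 2) (Fin 2) ℝ).det := by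
    rw [hdet]
    exact hD.isUnit
  have hinv : (!![m, -q; q, m] : Matrix (Fin 2) (Fin 2) ℝ)⁻¹ =
      !![m / (m * m + q * q), q / (m * m + q * q);
        -q / (m * m + q * q), m / (m * m + q * q)] := by
    rw [Matrix.inv_def, hdet, Ring.inverse_eq_inv', Matrix.adjugate_fin_two_of]
    ext i j
    fin_cases i <;> fin_cases j <;> simp <;> ring
  rw [← matAct_mul, add_assoc, ← add_matAct, matAct_add, ← matAct_mul, ← matAct_mul,
    Matrix.nonsing_inv_mul _ hu, matAct_one, neg_mul, mul_assoc, Matrix.nonsing_inv_mul _ hu,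
    mul_one, hinv]
  congr 2
  ext i j
  fin_cases i <;> fin_cases j <;> simp [Matrix.mul_apply, Fin.sum_univ_two] <;> ring

end Splicing

section Beta

variable {α : ℝ → ℝ} {R : ℝ}

theorem betaMinus_eq (α : ℝ → ℝ) (hl : lengthFn R ≠ 0) (t : ℝ) :
    betaMinus α R t = α (lam R * t - 3) := by
  rw [betaMinus, lam]
  congr 1
  field_simp

theorem betaPlus_eq (α : ℝ → ℝ) (hl : lengthFn R ≠ 0) (t : ℝ) :
    betaPlus α R t = 1 - α (lam R * t + 3) := by
  rw [betaPlus, lam]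
  congr 2
  field_simp

theorem contDiff_betaMinus (hα : ContDiff ℝ ∞ α) : ContDiff ℝ ∞ (betaMinus α R) := by
  unfold betaMinus
  fun_prop

theorem contDiff_betaPlus (hα : ContDiff ℝ ∞ α) : ContDiff ℝ ∞ (betaPlus α R) := by
  unfold betaPlus
  fun_prop

theorem deriv_betaMinus (hα : ContDiff ℝ ∞ α) (hl : lengthFn R ≠ 0) (t : ℝ) :
    deriv (betaMinus α R) t = lam R * deriv α (lam R * t - 3) := by
  have h1 : HasDerivAt α (deriv α (lam R * t - 3)) (lam R * t - 3) :=
    (hα.differentiable (by simp) _).hasDerivAt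
  have h2 : HasDerivAt (fun t => lam R * t - 3) (lam R) t := by
    simpa using ((hasDerivAt_id t).const_mul (lam R)).sub_const 3
  rw [show betaMinus α R = fun t => α (lam R * t - 3) from funext (betaMinus_eq α hl), mul_comm]
  exact (h1.comp t h2).deriv

theorem deriv_betaPlus (hα : ContDiff ℝ ∞ α) (hl : lengthFn R ≠ 0) (t : ℝ) :
    deriv (betaPlus α R) t = -(lam R * deriv α (lam R * t + 3)) := by
  have h1 : HasDerivAt α (deriv α (lam R * t + 3)) (lam R * t + 3) :=
    (hα.differentiable (by simp) _).hasDerivAt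
  have h2 : HasDerivAt (fun t => lam R * t + 3) (lam R) t := by
    simpa using ((hasDerivAt_id t).const_mul (lam R)).add_const 3
  rw [show betaPlus α R = fun t => 1 - α (lam R * t + 3) from funext (betaPlus_eq α hl), mul_comm]
  exact ((h1.comp t h2).const_sub 1).deriv

theorem tsupport_betaMinus (hα0 : ∀ t, 1 < t → α t = 0) (hl : 0 < lengthFn R) {t : ℝ}
    (ht : t ∈ tsupport (betaMinus α R)) :
    t ≤ 4 * lengthFn R := by
  refine closure_minimal (fun y hy => ?_) (isClosed_Iic (a := 4 * lengthFn R)) ht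
  by_contra hn
  refine hy (hα0 _ ?_)
  rw [lt_div_iff₀ hl]
  have : 4 * lengthFn R < y := not_le.1 hn
  linarith

theorem tsupport_betaPlus (hα1 : ∀ t, t < -1 → α t = 1) (hl : 0 < lengthFn R) {t : ℝ}
    (ht : t ∈ tsupport (betaPlus α R)) :
    -(4 * lengthFn R) ≤ t := by
  refine closure_minimal (fun y hy => ?_) (isClosed_Ici (a := -(4 * lengthFn R))) ht
  by_contra hn
  refine hy ?_
  rw [betaPlus, hα1, sub_self]
  rw [div_lt_iff₀ hl]
  have : y < -(4 * lengthFn R) := not_le.1 hn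
  linarith

theorem isBump_deriv (hα1 : ∀ t, t < -1 → α t = 1) (hα0 : ∀ t, 1 < t → α t = 0)
    (hα : ContDiff ℝ ∞ α) : IsBump (deriv α) := by
  refine ⟨(contDiff_infty_iff_deriv.1 hα).2, fun y hy => ?_⟩
  rcases lt_abs.1 hy with h | h
  · have : α =ᶠ[𝓝 y] fun _ => 0 := by
      filter_upwards [Ioi_mem_nhds h] with x hx using hα0 x hx
    simp [this.deriv_eq]
  · have : α =ᶠ[𝓝 y] fun _ => 1 := by
      filter_upwards [Iio_mem_nhds (show y < -1 by linarith)] with x hx using hα1 x hx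
    simp [this.deriv_eq]

end Beta

/-! ### The filled section in coordinates -/

section Formula

variable {n : ℕ} {α : ℝ → ℝ} {b R : ℝ}

/-- The coefficient of `u_-` in the component of the filled section on `C_-`. -/
def diagMinus (α : ℝ → ℝ) (y : ℝ) : ℝ :=
  -(1 - α y) / (1 + (1 - α y) * (1 - α y)) * deriv α y

/-- The coefficient of `u_+` in the component of the filled section on `C_-`. -/
def crossMinus (α : ℝ → ℝ) (y : ℝ) : ℝ := 1 / (1 + α y * α y) * deriv α y

/-- The coefficient of `u_+` in the component of the filled section on `C_+`. -/
def diagPlus (α : ℝ → ℝ) (y : ℝ) : ℝ := α y / (1 + α y * α y) * deriv α y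

/-- The coefficient of `u_-` in the component of the filled section on `C_+`. -/
def crossPlus (α : ℝ → ℝ) (y : ℝ) : ℝ :=
  -1 / (1 + (1 - α y) * (1 - α y)) * deriv α y

theorem one_add_mul_self_ne_zero (a : ℝ) : 1 + a * a ≠ 0 := by nlinarith [mul_self_nonneg a]

theorem isBump_coefficients (hα : ContDiff ℝ ∞ α) (hα1 : ∀ t, t < -1 → α t = 1)
    (hα0 : ∀ t, 1 < t → α t = 0) :
    IsBump (diagMinus α) ∧ IsBump (crossMinus α) ∧ IsBump (diagPlus α) ∧ IsBump (crossPlus α) := by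
  have h := isBump_deriv hα1 hα0 hα
  have h1 : ContDiff ℝ ∞ fun y => 1 - α y := contDiff_const.sub hα
  have h2 : ContDiff ℝ ∞ fun y => 1 + (1 - α y) * (1 - α y) := contDiff_const.add (h1.mul h1)
  have h3 : ContDiff ℝ ∞ fun y => 1 + α y * α y := contDiff_const.add (hα.mul hα)
  exact ⟨h.mul (h1.neg.div h2 fun y => one_add_mul_self_ne_zero _),
    h.mul (contDiff_const.div h3 fun y => one_add_mul_self_ne_zero _),
    h.mul (hα.div h3 fun y => one_add_mul_self_ne_zero _),
    h.mul (contDiff_const.div h2 fun y => one_add_mul_self_ne_zero _)⟩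

theorem deriv_eq_zero_or (hα : ContDiff ℝ ∞ α) (hα1 : ∀ t, t < -1 → α t = 1)
    (hα0 : ∀ t, 1 < t → α t = 0) (y : ℝ) : deriv α y = 0 ∨ (-1 ≤ y ∧ y ≤ 1) := by
  by_cases h : |y| ≤ 1
  · exact Or.inr (abs_le.1 h)
  · exact Or.inl ((isBump_deriv hα1 hα0 hα).zero y (not_le.1 h))

/-- At every point one of the cutoffs is `1`, so `D` is of the form `1 + a²`. Where one cutoff
varies the other is `1`, so each coefficient involves just one of the arguments `λt ± 3` and is a
fixed bump times `λ`. -/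
theorem splicing_coefficients (hα : ContDiff ℝ ∞ α) (hα1 : ∀ t, t < -1 → α t = 1)
    (hα0 : ∀ t, 1 < t → α t = 0) (hl : lengthFn R ≠ 0) (t : ℝ) :
    let D := betaMinus α R t * betaMinus α R t + betaPlus α R t * betaPlus α R t
    D ≠ 0 ∧
    betaPlus α R t * deriv (betaPlus α R) t / D = lam R * diagMinus α (lam R * t + 3) ∧
    betaPlus α R t * deriv (betaMinus α R) t / D = lam R * crossMinus α (lam R * t - 3) ∧
    betaMinus α R t * deriv (betaPlus α R) t / D = lam R * crossPlus α (lam R * t + 3) ∧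
    betaMinus α R t * deriv (betaMinus α R) t / D = lam R * diagPlus α (lam R * t - 3) := by
  rw [deriv_betaMinus hα hl, deriv_betaPlus hα hl, betaMinus_eq α hl, betaPlus_eq α hl]
  set y := lam R * t
  have hminus : deriv α (y - 3) = 0 ∨ α (y + 3) = 0 := by
    rcases deriv_eq_zero_or hα hα1 hα0 (y - 3) with h | h
    · exact Or.inl h
    · exact Or.inr (hα0 _ (by linarith [h.1]))
  have hplus : deriv α (y + 3) = 0 ∨ α (y - 3) = 1 := by
    rcases deriv_eq_zero_or hα hα1 hα0 (y + 3) with h | h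
    · exact Or.inl h
    · exact Or.inr (hα1 _ (by linarith [h.2]))
  have e : ∀ a : ℝ, a * a + 1 = 1 + a * a := fun a => add_comm _ _
  refine ⟨?_, ?_, ?_, ?_, ?_⟩
  · rcases lt_or_ge y 2 with h | h
    · rw [hα1 (y - 3) (by linarith), one_mul]
      exact one_add_mul_self_ne_zero _
    · rw [hα0 (y + 3) (by linarith), sub_zero, one_mul, add_comm]
      exact one_add_mul_self_ne_zero _
  · rcases hplus with h | h <;> simp only [diagMinus, h, one_mul] <;> ring
  · rcases hminus with h | h <;> simp only [crossMinus, h, sub_zero, one_mul, e] <;> ring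
  · rcases hplus with h | h <;> simp only [crossPlus, h, one_mul] <;> ring
  · rcases hminus with h | h <;> simp only [diagPlus, h, sub_zero, one_mul, e] <;> ring

theorem HasWeakDeriv.mul_translate_indicator {j : Bool} {Ω Ω' : Set Cyl} (hΩ : IsOpen Ω)
    {f g : Cyl → E n} (h : HasWeakDeriv (coordDeriv j) Ω f g) {ψ : ℝ → ℝ} (hψ : ContDiff ℝ ∞ ψ)
    (c : Cyl) (hs : ∀ x ∈ Ω', x.1 ∈ tsupport ψ → c + x ∈ Ω) :
    HasWeakDeriv (coordDeriv j) Ω' (fun x => ψ x.1 • Ω.indicator f (c + x))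
      (fun x => dcoef j ψ x.1 • Ω.indicator f (c + x) + ψ x.1 • Ω.indicator g (c + x)) := by
  have h1 := (h.translate c).mul_indicator (Ω' := Ω')
    (hΩ.preimage (continuous_const.add continuous_id)) hψ hs
  convert h1 using 1
  · ext1 x
    by_cases hx : c + x ∈ Ω <;> simp [hx]
  · ext1 x
    by_cases hx : c + x ∈ Ω <;> simp [hx]

/-- The witness is `∂_t(T V) = T V' + T' V`. On the infinite cylinder the extensions by zero of
`u_∓` jump at `t = ±(R - b)`, but `β_∓` vanishes already for `±t > 4l`, before the jump; on the neck
there are no jumps. -/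
theorem isPsiFinite_of_formula (hα : ContDiff ℝ ∞ α) (hα1 : ∀ t, t < -1 → α t = 1)
    (hα0 : ∀ t, 1 < t → α t = 0) (hl : 0 < lengthFn R) (hR : b + 4 * lengthFn R < R) (θ : S1)
    {u u' w : (Cyl → E n) × (Cyl → E n)}
    (hu₁ : HasWeakDeriv (coordDeriv false) (Cminus b) u.1 u'.1)
    (hu₂ : HasWeakDeriv (coordDeriv false) (Cplus b) u.2 u'.2)
    (hw₁ : w.1 =ᵐ[volume.restrict (Cminus b)] fun x => u'.1 x +
      (lam R * diagMinus α (lam R * (x.1 + R) + 3)) • u.1 x +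
      (lam R * crossMinus α (lam R * (x.1 + R) - 3)) •
        (Cplus b).indicator u.2 (x.1 + R + R, x.2 + θ + θ))
    (hw₂ : w.2 =ᵐ[volume.restrict (Cplus b)] fun x => u'.2 x +
      (lam R * diagPlus α (lam R * (x.1 - R) - 3)) • u.2 x +
      (lam R * crossPlus α (lam R * (x.1 - R) + 3)) •
        (Cminus b).indicator u.1 (x.1 - R - R, x.2 - θ - θ)) :
    IsPsiFinite α b R θ u w := by
  have hom : IsOpen (Cminus b) := isOpen_lt continuous_fst continuous_const
  have hop : IsOpen (Cplus b) := isOpen_lt continuous_const continuous_fst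
  have em : ∀ x : Cyl, ((-R, -θ) : Cyl) + x = (x.1 - R, x.2 - θ) := fun x =>
    Prod.ext (neg_add_eq_sub _ _) (neg_add_eq_sub _ _)
  have ep : ∀ x : Cyl, ((R, θ) : Cyl) + x = (x.1 + R, x.2 + θ) := fun x =>
    Prod.ext (add_comm _ _) (add_comm _ _)
  have sm : ∀ x : Cyl, x.1 < R - b → ((-R, -θ) : Cyl) + x ∈ Cminus b := fun x hx => by
    rw [em]
    change x.1 - R < -b
    linarith
  have sp : ∀ x : Cyl, -(R - b) < x.1 → ((R, θ) : Cyl) + x ∈ Cplus b := fun x hx => by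
    rw [ep]
    change b < x.1 + R
    linarith
  have cm := contDiff_betaMinus (R := R) hα
  have cp := contDiff_betaPlus (R := R) hα
  let M : ℝ → Matrix (Fin 2) (Fin 2) ℝ := fun t =>
    !![deriv (betaMinus α R) t, -deriv (betaPlus α R) t;
      deriv (betaPlus α R) t, deriv (betaMinus α R) t]
  let V : (Cyl → E n) × (Cyl → E n) → Cyl → E n × E n := fun v x =>
    ((Cminus b).indicator v.1 (x.1 - R, x.2 - θ), (Cplus b).indicator v.2 (x.1 + R, x.2 + θ))
  have key : ∀ x, matAct (splicingMatrix α R x.1)⁻¹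
      (matAct (splicingMatrix α R x.1) (V u' x) + matAct (M x.1) (V u x) +
        matAct (connectionMatrix α R x.1) (totalGluing α b R θ u x)) = _ := fun x =>
    splicing_conj (splicing_coefficients hα hα1 hα0 hl.ne' x.1).1 (V u x) (V u' x)
  refine ⟨fun x => matAct (splicingMatrix α R x.1) (V u' x) + matAct (M x.1) (V u x),
    ⟨?_, ?_⟩, ?_, ?_⟩
  · have h1 := hu₁.mul_translate_indicator (Ω' := univ) hom cm (-R, -θ)
      fun x _ hx => sm x (by linarith [tsupport_betaMinus hα0 hl hx])
    have h2 := hu₂.mul_translate_indicator (Ω' := univ) hop cp (R, θ)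
      fun x _ hx => sp x (by linarith [tsupport_betaPlus hα1 hl hx])
    change HasWeakDeriv (coordDeriv false) univ _ _
    convert h1.add (h2.const_smul (-1)) using 1
    · ext1 x
      simp [totalGluing, matAct, splicingMatrix, em, ep]
    · ext1 x
      simp only [matAct, splicingMatrix, M, V, Pi.add_apply, Pi.smul_apply, em, ep, dcoef,
        Prod.fst_add]
      simp
      module
  · have h1 := hu₁.mul_translate_indicator (Ω' := neck b R) hom cp (-R, -θ)
      fun x hx _ => sm x hx.2
    have h2 := hu₂.mul_translate_indicator (Ω' := neck b R) hop cm (R, θ)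
      fun x hx _ => sp x hx.1
    change HasWeakDeriv (coordDeriv false) (neck b R) _ _
    convert h1.add h2 using 1
    · ext1 x
      simp [totalGluing, matAct, splicingMatrix, em, ep]
    · ext1 x
      simp only [matAct, splicingMatrix, M, V, Pi.add_apply, em, ep, dcoef, Prod.snd_add]
      simp
      module
  · filter_upwards [hw₁, ae_restrict_mem hom.measurableSet] with x hx hxm
    obtain ⟨-, c1, c2, -, -⟩ := splicing_coefficients hα hα1 hα0 hl.ne' (x.1 + R)
    rw [hx]
    refine Eq.trans ?_ (congrArg Prod.fst (key (x.1 + R, x.2 + θ))).symm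
    simp [matAct, V, c1, c2, hxm, add_assoc]
  · filter_upwards [hw₂, ae_restrict_mem hop.measurableSet] with x hx hxm
    obtain ⟨-, -, -, c1, c2⟩ := splicing_coefficients hα hα1 hα0 hl.ne' (x.1 - R)
    rw [hx]
    refine Eq.trans ?_ (congrArg Prod.snd (key (x.1 - R, x.2 - θ))).symm
    simp only [Prod.snd_add, matAct, V, c1, c2]
    simp [hxm, add_assoc, add_comm]

end Formula

end FilledSection

end

/-! ### The two half-cylinders together. -/

theorem theorem1p1 (n k : ℕ) (hk : 1 ≤ k) (p : ℝ≥0∞) [Fact (1 ≤ p)] (hp : 2 < p) (hp' : p ≠ ⊤)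
    (δ : ℝ) (hδ : 0 < δ) (hδ' : δ < 1)
    (α : ℝ → ℝ) (hα : ContDiff ℝ ∞ α) (hα01 : ∀ t, α t ∈ Icc (0 : ℝ) 1)
    (hα1 : ∀ t, t < -1 → α t = 1) (hα0 : ∀ t, 1 < t → α t = 0) (hα' : ∀ t, deriv α t ≤ 0)
    (b : ℝ) (hb : 0 ≤ b) (r₀ r₁ : ℝ) (hr₀ : 0 < r₀) (hr₁ : 0 < r₁) (hr : r₁ ≤ r₀)
    (hfit : ∀ r ∈ Ioo 0 r₁, b + 4 * FilledSection.lengthFn (FilledSection.gluingProfile r₀ r) <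
      FilledSection.gluingProfile r₀ r) :
    ∃ Ψ : FilledSection.WSobS n k p δ b × ℂ → FilledSection.WSobS n (k - 1) p δ b,
      (∀ (u : FilledSection.WSobS n k p δ b), ∀ z ∈ Metric.ball (0 : ℂ) r₁,
        FilledSection.IsPsi α b r₀ z (FilledSection.WSobS.toFun (δ := δ) u)
          (FilledSection.WSobS.toFun (δ := δ) (Ψ (u, z)))) ∧
      ContDiffOn ℝ 1 Ψ (univ ×ˢ Metric.ball (0 : ℂ) r₁) := by
  open FilledSection in
  have : Fact (p ≠ ⊤) := ⟨hp'⟩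
  obtain ⟨bdm, bcm, bdp, bcp⟩ := isBump_coefficients hα hα1 hα0
  have em : Cminus b = {x | b < -(((1 : ℤ) : ℝ) * x.1)} := by
    ext x
    simp only [Cminus, mem_ofPred_eq, Int.cast_one, one_mul]
    exact lt_neg
  have ep : Cplus b = {x | b < ((1 : ℤ) : ℝ) * x.1} := by
    ext x
    simp [Cplus]
  -- Each half-cylinder is described with both signs, as it serves once as `Ω` and once as `Ω'`.
  have em' : Cminus b = {x | b < ((-1 : ℤ) : ℝ) * x.1} := by
    rw [em]
    simp
  have ep' : Cplus b = {x | b < -(((-1 : ℤ) : ℝ) * x.1)} := by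
    rw [ep]
    simp
  have am : ∀ x ∈ Cminus b, |x.1| = -(((1 : ℤ) : ℝ) * x.1) := fun x hx => by
    have : x.1 < -b := hx
    rw [Int.cast_one, one_mul, abs_of_neg (by linarith)]
  have ap : ∀ x ∈ Cplus b, |x.1| = -(((-1 : ℤ) : ℝ) * x.1) := fun x hx => by
    have : b < x.1 := hx
    simp [abs_of_pos (hb.trans_lt this)]
  have hom : IsOpen (Cminus b) := isOpen_lt continuous_fst continuous_const
  have hop : IsOpen (Cplus b) := isOpen_lt continuous_const continuous_fst
  obtain ⟨Ψm, cm, fm⟩ := exists_halfSection hk (s := 1) (by norm_num) hb hδ em ep hfit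
    (ContinuousLinearMap.fst ℝ (WSob n k p δ (Cminus b)) (WSob n k p δ (Cplus b)))
    (ContinuousLinearMap.snd ℝ (WSob n k p δ (Cminus b)) (WSob n k p δ (Cplus b))) bdm bcm
  obtain ⟨Ψp, cp, fp⟩ := exists_halfSection hk (s := -1) (by norm_num) hb hδ ep' em' hfit
    (ContinuousLinearMap.snd ℝ (WSob n k p δ (Cminus b)) (WSob n k p δ (Cplus b)))
    (ContinuousLinearMap.fst ℝ (WSob n k p δ (Cminus b)) (WSob n k p δ (Cplus b))) bdp bcp
  refine ⟨fun q => (Ψm q, Ψp q), fun u z hz => ⟨fun h0 => ⟨?_, ?_⟩, fun h0 => ?_⟩, cm.prodMk cp⟩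
  · exact (hasWeakDeriv_toFun hk hom am u.1).congr_ae (EventuallyEq.refl _ _) ((fm u z hz).1 h0)
  · exact (hasWeakDeriv_toFun hk hop ap u.2).congr_ae (EventuallyEq.refl _ _) ((fp u z hz).1 h0)
  · have hr : ‖z‖ ∈ Ioo 0 r₁ := ⟨norm_pos_iff.2 h0, by simpa using hz⟩
    have hl : 0 < lengthFn (gluingProfile r₀ ‖z‖) :=
      zero_lt_one.trans_le (one_le_lengthFn (exp_two_lt_gluingProfile hb hfit hr))
    refine isPsiFinite_of_formula hα hα1 hα0 hl (hfit _ hr) _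
      (u' := (dtFun 1 δ u.1, dtFun (-1) δ u.2))
      (hasWeakDeriv_toFun hk hom am u.1) (hasWeakDeriv_toFun hk hop ap u.2) ?_ ?_
    · refine ((fm u z hz).2 h0).trans (Eventually.of_forall fun x => ?_)
      have e : gluingShift r₀ 1 z + x = (x.1 + gluingProfile r₀ ‖z‖ + gluingProfile r₀ ‖z‖,
          x.2 + (Complex.arg z : S1) + (Complex.arg z : S1)) := by
        refine Prod.ext ?_ ?_
        · simp only [gluingShift, Prod.fst_add]
          push_cast
          ring
        · simp only [gluingShift, Prod.snd_add, mul_one, two_zsmul]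
          abel
      simp [e, WSobS.toFun]
    · refine ((fp u z hz).2 h0).trans (Eventually.of_forall fun x => ?_)
      have e : gluingShift r₀ (-1) z + x = (x.1 - gluingProfile r₀ ‖z‖ - gluingProfile r₀ ‖z‖,
          x.2 - (Complex.arg z : S1) - (Complex.arg z : S1)) := by
        refine Prod.ext ?_ ?_
        · simp only [gluingShift, Prod.fst_add]
          push_cast
          ring
        · simp only [gluingShift, Prod.snd_add, mul_neg, mul_one, neg_smul, two_zsmul]
          abel
      simp [e, WSobS.toFun, sub_eq_add_neg]
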